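/- Let $N\ge 5$ and $T>0$ be real, and let $\omega\in C^\infty(\mathbb R)$ satisfy $\omega=1$ on $]-\infty,1/3]$, $0<\omega<1$ on $]1/3,2/3[$, $\omega=0$ on $[2/3,\infty[$. *Norms.* Put $N_0=5$, $N_1=N$, and use the coordinate $s=x$ for $\mu=0$, $s=1-x$ for $\mu=1$. Let $\triangle_{[\mu]}=s\frac{d^2}{ds^2}+\frac{N_\mu}{2}\frac{d}{ds}$ and $\|f\|_{[\mu]}^2=\int_0^1|f|^2s^{N_\mu/2-1}ds$. For a function $u(x)$ on $[0,1]$ write $u^{[0]}=\omega u$, $u^{[1]}=(1-\omega)u$, and $(\|u\|^*_\kappa)^2=\sum_{\mu=0,1}\sum_{m\le\kappa}\|\triangle_{[\mu]}^m u^{[\mu]}\|_{[\mu]}^2$. For $\nu\in\mathbb Z_{\ge0}$ and functions on $[0,T]\times[0,1]$ put $$(\|u\|_\nu^{(2)})^2=\sum_{\iota+\kappa\le\nu}\int_0^T\big(\|(-\partial_t^2)^\iota u(t,\cdot)\|_\kappa^*\big)^2dt,\qquad (\|(y,v)\|^{(2)}_\nu)^2=(\|y\|^{(2)}_\nu)^2+(\|v\|^{(2)}_\nu)^2,$$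 and for functions $U(t,s)$ on $]-2T,2T[\times[0,1[$ put $$(\|U\|_{[\mu]\nu}^{\sharp})^2=\sum_{\iota+\kappa\le\nu}\int_{-2T}^{2T}\|(-\partial_t^2)^\iota\triangle_{[\mu]}^\kappa U(t,\cdot)\|_{[\mu]}^2dt .$$ *Truncated expansions.* For $a,b\ge1$ let $\phi_a(t)=\frac1{\sqrt{2T}}\sin\frac{a\pi(t+2T)}{4T}$ be the normalized Dirichlet eigenfunctions of $-\partial_t^2$ on $]-2T,2T[$, and let $\psi^{[\mu]}_b(s)$ be the multiple of $\Psi(\mu_b s)$ of norm $\|\cdot\|_{[\mu]}=1$ (with positive factor), where, with $p=\frac{N_\mu}2-1$, $\Psi(z)=J_p(2\sqrt z)(\sqrt z)^{-p}$, $\mu_b=(\frac12 j_{p,b})^2$, and $j_{p,b}$ is the $b$-th positive zero of the Bessel function $J_p$; these are the eigenfunctions of $-\triangle_{[\mu]}$ with Dirichlet condition at $s=1$. For $U\in C_0^\infty(]-2T,2T[\times[0,1[)$ and $\theta\ge0$ let $$\tilde S_{[\mu]}(\theta)U=\sum_{a^2\le\theta,\ b^2\le\theta}c_{ab}\,\phi_a(t)\,\psi^{[\mu]}_b(s),\qquad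 c_{ab}=\int_{-2T}^{2T}\!\int_0^1U\,\phi_a\,\psi^{[\mu]}_b\,s^{N_\mu/2-1}\,ds\,dt .$$ *Smoothing operators.* For $\mu=0,1$ there is a linear extension operator $u\mapsto\tilde u$ from the functions $u(t,s)\in C^\infty([0,T]\times[0,1[)$ vanishing for $s\ge 2/3$ to $C_0^\infty(]-2T,2T[\times[0,1[)$ such that $\tilde u=u$ on $[0,T]\times[0,1[$ and, for every $\nu$, $\|\tilde u\|^\sharp_{[\mu]\nu}\simeq\|u\|^{(2)}_\nu$ (two-sided bounds with constants independent of $u$; on the right $u$ is regarded as a function of $(t,x)$). Fix any such extension operators, and for $u\in C^\infty([0,T]\times[0,1])$ set $$S(\theta)u=\tilde S_{[0]}(\theta)\widetilde{u^{[0]}}+\tilde S_{[1]}(\theta)\widetilde{u^{[1]}}\quad\text{on }[0,T]\times[0,1],\qquad \vec S(\theta)(y,v)=(S(\theta)y,S(\theta)v).$$ *Claim.* For all integers $0\le\nu\le\bar\nu$ there is a constant $C$ such that for all $\theta\ge0$, $\mu\in\{0,1\}$ and $U\in C_0^\infty(]-2T,2T[\times[0,1[)$ $$\|\tilde S_{[\mu]}(\theta)U\|^\sharp_{[\mu]\bar\nu}\le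 C\theta^{\bar\nu-\nu}\|U\|^\sharp_{[\mu]\nu},\qquad \|(I-\tilde S_{[\mu]}(\theta))U\|^\sharp_{[\mu]\nu}\le C\theta^{\nu-\bar\nu}\|U\|^\sharp_{[\mu]\bar\nu},$$ and for all $\theta\ge0$ and $\vec u=(y,v)$ with $y,v\in C^\infty([0,T]\times[0,1])$ $$\|\vec S(\theta)\vec u\|^{(2)}_{\bar\nu}\le C\theta^{\bar\nu-\nu}\|\vec u\|^{(2)}_\nu,\qquad \|(I-\vec S(\theta))\vec u\|^{(2)}_\nu\le C\theta^{\nu-\bar\nu}\|\vec u\|^{(2)}_{\bar\nu}.$$ (For $\theta=0$ and $\nu<\bar\nu$ the factor $\theta^{\nu-\bar\nu}$ is read as $+\infty$, with $\infty\cdot0=0$.) -/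

import Mathlib

open Set MeasureTheory
open scoped NNReal ENNReal ContDiff

namespace Smoothing

noncomputable section

/-! ### Bessel functions and their zeros -/

/-- The entire function `Ψ_p(z) = ∑ₖ (-1)ᵏ zᵏ / (k! Γ(k + p + 1))`, which is
`J_p(2 √z) (√z)^(-p)` for `z > 0` (see `besselPsi_eq`). -/
def besselPsi (p z : ℝ) : ℝ :=
  ∑' k : ℕ, (-1) ^ k * z ^ k / ((k.factorial : ℝ) * Real.Gamma (k + p + 1))

/-- The Bessel function `J_p(r) = ∑ₖ (-1)ᵏ / (k! Γ(k + p + 1)) (r/2)^(2k+p)` for `r > 0`. -/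
def besselJ (p r : ℝ) : ℝ := (r / 2) ^ p * besselPsi p ((r / 2) ^ 2)

theorem besselPsi_eq (p z : ℝ) (hz : 0 < z) :
    besselPsi p z = besselJ p (2 * √z) * (√z) ^ (-p) := by
  have h : 0 < √z := Real.sqrt_pos.mpr hz
  have h1 : 2 * √z / 2 = √z := by ring
  rw [besselJ, h1, Real.sq_sqrt hz.le, mul_right_comm, ← Real.rpow_add h]
  simp

/-- `besselZero p b` is the `b`-th positive zero of `J_p` for `b ≥ 1` (and `0` for `b = 0`). -/
def besselZero (p : ℝ) : ℕ → ℝ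
  | 0 => 0
  | b + 1 => sInf {r : ℝ | besselZero p b < r ∧ besselJ p r = 0}

/-! ### Eigenfunctions -/

/-- The Dirichlet eigenfunctions `φ_a`, `a ≥ 1`, of `-d²/dt²` on `]-2T, 2T[`, normalized in `L²`. -/
def phi (T : ℝ) (a : ℕ) (t : ℝ) : ℝ :=
  1 / √(2 * T) * Real.sin (a * Real.pi * (t + 2 * T) / (4 * T))

/-- The eigenvalues `μ_b = (j_{M/2-1,b} / 2)²`, `b ≥ 1`, of `-(x d²/dx² + (M/2) d/dx)` in
`L²(]0,1[, x^(M/2-1) dx)` with the Dirichlet condition at `x = 1`. -/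
def eigMu (M : ℝ) (b : ℕ) : ℝ := (besselZero (M / 2 - 1) b / 2) ^ 2

/-- The normalized eigenfunction `ψ_b` belonging to `μ_b`. -/
def psi (M : ℝ) (b : ℕ) (x : ℝ) : ℝ :=
  besselPsi (M / 2 - 1) (eigMu M b * x) /
    √(∫ s in (0 : ℝ)..1, besselPsi (M / 2 - 1) (eigMu M b * s) ^ 2 * s ^ (M / 2 - 1))

/-- The coefficient `c_ab` of `U` in the expansion `U = ∑ c_ab φ_a(t) ψ_b(x)`. -/
def coeff (M T : ℝ) (U : ℝ → ℝ → ℝ) (a b : ℕ) : ℝ :=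
  ∫ t in (-(2 * T))..(2 * T), ∫ x in (0 : ℝ)..1,
    U t x * phi T a t * psi M b x * x ^ (M / 2 - 1)

/-- The indices `a ≥ 1` with `a² ≤ θ`. -/
def indices (θ : ℝ) : Finset ℕ := {a ∈ Finset.Icc 1 ⌊θ⌋₊ | (a : ℝ) ^ 2 ≤ θ}

/-- The truncated double expansion `S̃(θ) U`. -/
def truncation (M T θ : ℝ) (U : ℝ → ℝ → ℝ) (t x : ℝ) : ℝ :=
  ∑ a ∈ indices θ, ∑ b ∈ indices θ, coeff M T U a b * phi T a t * psi M b x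

/-! ### Differential operators and norms

Only interior points of the domains enter the norms, so that `deriv` is the genuine derivative for
the smooth functions considered below. The norms take values in `[0, ∞]`. -/

/-- The operator `x d²/dx² + (M/2) d/dx`. -/
def lap (M : ℝ) (f : ℝ → ℝ) (x : ℝ) : ℝ := x * deriv (deriv f) x + M / 2 * deriv f x

/-- The operator `-∂_t²`. -/
def timeLap (u : ℝ → ℝ → ℝ) (t x : ℝ) : ℝ := -deriv (deriv fun r => u r x) t

/-- The square of the norm of `L²(]0,1[, x^(M/2-1) dx)`. -/
def l2Sq (M : ℝ) (f : ℝ → ℝ) : ℝ≥0∞ :=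
  ∫⁻ x in Ioo (0 : ℝ) 1, ‖f x‖ₑ ^ 2 * ENNReal.ofReal (x ^ (M / 2 - 1))

/-- The pairs `(ι, κ)` of natural numbers with `ι + κ ≤ ν`. -/
def orders (ν : ℕ) : Finset (ℕ × ℕ) :=
  {p ∈ Finset.range (ν + 1) ×ˢ Finset.range (ν + 1) | p.1 + p.2 ≤ ν}

/-- The norm `‖U‖_ν^♯` of functions on `]-2T, 2T[ × ]0,1[`. -/
def sharpNorm (M T : ℝ) (ν : ℕ) (U : ℝ → ℝ → ℝ) : ℝ≥0∞ :=
  (∑ p ∈ orders ν, ∫⁻ t in Ioo (-(2 * T)) (2 * T),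
    l2Sq M (timeLap^[p.1] (fun r => (lap M)^[p.2] (U r)) t)) ^ (1 / 2 : ℝ)

/-- The parameter `M` of the operator `x d²/dx² + (M/2) d/dx` at the two ends `x = 0` and `x = 1`:
it is `5` for `μ = 0` and `N` for `μ = 1`. -/
def param (N : ℝ) (μ : Fin 2) : ℝ := if μ = 0 then 5 else N

/-- The coordinate `x` for `μ = 0` and `X = 1 - x` for `μ = 1`; the map is its own inverse. -/
def chart (μ : Fin 2) (x : ℝ) : ℝ := if μ = 0 then x else 1 - x

/-- The cut-off function `χ`. -/
structure IsCutoff (χ : ℝ → ℝ) : Prop where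
  smooth : ContDiff ℝ ∞ χ
  eq_one : ∀ x ≤ 1 / 3, χ x = 1
  between : ∀ x, 1 / 3 < x → x < 2 / 3 → 0 < χ x ∧ χ x < 1
  eq_zero : ∀ x, 2 / 3 ≤ x → χ x = 0

/-- The partition of unity `χ`, `1 - χ`. -/
def weight (χ : ℝ → ℝ) (μ : Fin 2) (x : ℝ) : ℝ := if μ = 0 then χ x else 1 - χ x

/-- The piece `u^[μ]` of `u`, that is `u^[0] = χ u` or `u^[1] = (1 - χ) u`, written in the
coordinate `s = x` or `s = 1 - x`, respectively. -/
def piece (χ : ℝ → ℝ) (μ : Fin 2) (u : ℝ → ℝ) (s : ℝ) : ℝ := weight χ μ (chart μ s) * u (chart μ s)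

/-- The square of the norm `‖u‖_κ^*` of functions of `x`. -/
def starNormSq (N : ℝ) (χ : ℝ → ℝ) (κ : ℕ) (u : ℝ → ℝ) : ℝ≥0∞ :=
  ∑ μ : Fin 2, ∑ m ∈ Finset.range (κ + 1),
    l2Sq (param N μ) ((lap (param N μ))^[m] (piece χ μ u))

/-- The norm `‖u‖_ν^(2)` of functions on `]0,T[ × ]0,1[`. -/
def norm2 (N T : ℝ) (χ : ℝ → ℝ) (ν : ℕ) (u : ℝ → ℝ → ℝ) : ℝ≥0∞ :=
  (∑ p ∈ orders ν, ∫⁻ t in Ioo 0 T, starNormSq N χ p.2 (timeLap^[p.1] u t)) ^ (1 / 2 : ℝ)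

/-- The norm `‖(y, v)‖_ν^(2)` of pairs of functions. -/
def vecNorm2 (N T : ℝ) (χ : ℝ → ℝ) (ν : ℕ) (w : (ℝ → ℝ → ℝ) × (ℝ → ℝ → ℝ)) : ℝ≥0∞ :=
  (norm2 N T χ ν w.1 ^ 2 + norm2 N T χ ν w.2 ^ 2) ^ (1 / 2 : ℝ)

/-! ### Function classes and extensions -/

/-- `u ∈ C^∞([0,T] × [0,1])`. -/
def IsSmooth (T : ℝ) (u : ℝ → ℝ → ℝ) : Prop :=
  ContDiffOn ℝ ∞ (fun p : ℝ × ℝ => u p.1 p.2) (Icc 0 T ×ˢ Icc 0 1)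

/-- `u ∈ C^∞([0,T] × [0,1[)` and `u(t,x) = 0` for `2/3 ≤ x`. -/
def IsLocal (T : ℝ) (u : ℝ → ℝ → ℝ) : Prop :=
  ContDiffOn ℝ ∞ (fun p : ℝ × ℝ => u p.1 p.2) (Icc 0 T ×ˢ Ico 0 1) ∧
    ∀ t ∈ Icc 0 T, ∀ x ∈ Ico (0 : ℝ) 1, 2 / 3 ≤ x → u t x = 0

/-- `U ∈ C_0^∞(]-2T,2T[ × [0,1[)`. -/
def IsTest (T : ℝ) (U : ℝ → ℝ → ℝ) : Prop :=
  ContDiffOn ℝ ∞ (fun p : ℝ × ℝ => U p.1 p.2) (Ioo (-(2 * T)) (2 * T) ×ˢ Ico 0 1) ∧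
    ∃ K : Set (ℝ × ℝ), IsCompact K ∧ K ⊆ Ioo (-(2 * T)) (2 * T) ×ˢ Ico 0 1 ∧
      ∀ p ∈ Ioo (-(2 * T)) (2 * T) ×ˢ Ico (0 : ℝ) 1, p ∉ K → U p.1 p.2 = 0

/-- `E` is a linear extension `u ↦ ũ` of the functions `u ∈ C^∞([0,T] × [0,1[)` of the coordinate
`x` (if `μ = 0`) or `1 - x` (if `μ = 1`) that vanish for values `≥ 2/3` of the coordinate, to
functions `ũ ∈ C_0^∞(]-2T,2T[ × [0,1[)` with `‖ũ‖_ν^♯ ≃ ‖u‖_ν^(2)` for all `ν`. -/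
structure IsExtension (N T : ℝ) (χ : ℝ → ℝ) (μ : Fin 2)
    (E : (ℝ → ℝ → ℝ) → (ℝ → ℝ → ℝ)) : Prop where
  test : ∀ u, IsLocal T u → IsTest T (E u)
  extends_ : ∀ u, IsLocal T u → ∀ t ∈ Icc 0 T, ∀ x ∈ Ico (0 : ℝ) 1, E u t x = u t x
  map_add : ∀ u v, IsLocal T u → IsLocal T v → E (u + v) = E u + E v
  map_smul : ∀ (c : ℝ) u, IsLocal T u → E (c • u) = c • E u
  equiv : ∀ ν : ℕ, ∃ C : ℝ≥0, ∀ u, IsLocal T u →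
    sharpNorm (param N μ) T ν (E u) ≤ C * norm2 N T χ ν (fun t x => u t (chart μ x)) ∧
    norm2 N T χ ν (fun t x => u t (chart μ x)) ≤ C * sharpNorm (param N μ) T ν (E u)

/-- The smoothing operator `S(θ) u = S_[0](θ) u^[0] + S_[1](θ) u^[1]`, for the extensions `E 0` and
`E 1`. -/
def smoothing (N T : ℝ) (χ : ℝ → ℝ) (E : Fin 2 → (ℝ → ℝ → ℝ) → (ℝ → ℝ → ℝ)) (θ : ℝ)
    (u : ℝ → ℝ → ℝ) (t x : ℝ) : ℝ :=
  ∑ μ : Fin 2, truncation (param N μ) T θ (E μ fun r => piece χ μ (u r)) t (chart μ x)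

/-- The operator `S(θ)` acting on pairs `(y, v)`. -/
def vecSmoothing (N T : ℝ) (χ : ℝ → ℝ) (E : Fin 2 → (ℝ → ℝ → ℝ) → (ℝ → ℝ → ℝ)) (θ : ℝ)
    (w : (ℝ → ℝ → ℝ) × (ℝ → ℝ → ℝ)) : (ℝ → ℝ → ℝ) × (ℝ → ℝ → ℝ) :=
  (smoothing N T χ E θ w.1, smoothing N T χ E θ w.2)

end

end Smoothing

/-! The products `φ_a(t) ψ_b(x)` diagonalize both `-∂_t²` and the degenerate operator `x d²/dx² +
(M/2) d/dx`. A test function vanishes near every Dirichlet edge, so integrating by parts produces no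
boundary terms at any order. Parseval then turns the squared `♯`-norm into `∑ symbol ν (λ_a²) (μ_b²)
c_ab²` (`sharp_sum`), where `λ_a` is the time eigenvalue, `μ_b` the space eigenvalue, and `symbol ν
x y` is comparable to `(1 + x + y)^ν`. Both eigenvalues grow exactly like the square of their index.
On the retained indices `λ_a, μ_b ≲ θ`, while on the discarded ones at least one of them is `≳ θ`.
Comparing the symbols of orders `ν` and `ν + k` (`symbol_low`, `symbol_high`) gives the estimates
for the truncations.

Completeness of the eigenfunctions is obtained by elementary means. The eigenfunction number `n`
(counted from 0) has at most `n` interior zeros. By Jacobi's inequality, a function vanishing at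
those zeros has Rayleigh quotient at least `m n`. Linear algebra carries this bound over to every
function orthogonal to the first `n` eigenfunctions (`NodalSystem.rayleigh`), so the Parseval
remainder is at most energy divided by `m n`, which tends to 0. For the Bessel system, Sturm
comparison of `√r J_p(r)` with sines gives the spacing of the zeros, hence the growth of the
eigenvalues, and shows that the recursive enumeration of the zeros omits none. Here `M ≥ 5` gives `p
≥ 3/2 > 1/2`.

For the smoothing operators, `u` is split by the partition of unity, each piece is extended in time
and truncated, and the results are added. On `[0,T]` the extensions restore the pieces and the
pieces add up to `u`, so `u - S u` is the sum of the two truncation errors. It remains to compare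
norms in the two charts. A term passes from one chart to the other only on a region away from the
degenerate point of its own operator. There the operator is elliptic, and every other second-order
operator is controlled by its powers (`InteriorOp.comb_bound`).

Extensions exist by Seeley's reflection `∑ a_k v(-2^k t)` in time. It acts on `t` alone, so it
commutes with the space operator, and its `L²` bounds can be proved for each fixed `x`. -/

open Set MeasureTheory Filter Topology
open scoped NNReal ENNReal ContDiff

namespace Smoothing

/-! ### Rayleigh quotients and completeness, algebraically -/

section Algebra

variable {V : Type*} [AddCommGroup V] [Module ℝ V]

/-- Two symmetric forms, `E` (energy) and `B` (scalar product), with a `B`-orthonormal sequence of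
eigenvectors, such that the `n`-th eigenvector has `n` nodes: energy is bounded below by `m n` on
vectors that vanish at the nodes. -/
structure NodalSystem (E B : V →ₗ[ℝ] V →ₗ[ℝ] ℝ) (e : ℕ → V) (m : ℕ → ℝ)
    (z : (n : ℕ) → Fin n → V →ₗ[ℝ] ℝ) : Prop where
  symmB : ∀ f g, B f g = B g f
  symmE : ∀ f g, E f g = E g f
  nonneg : ∀ f, 0 ≤ B f f
  eigen : ∀ f k, E f (e k) = m k * B f (e k)
  orth : ∀ j k, B (e j) (e k) = if j = k then 1 else 0
  mono : StrictMono m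
  pos : ∀ k, 0 < m k
  nodal : ∀ n h, (∀ j, z n j h = 0) → m n * B h h ≤ E h h

namespace NodalSystem

variable {E B : V →ₗ[ℝ] V →ₗ[ℝ] ℝ} {e : ℕ → V} {m : ℕ → ℝ} {z : (n : ℕ) → Fin n → V →ₗ[ℝ] ℝ}

theorem B_comb (S : NodalSystem E B e m z) (s : Finset ℕ) (α : ℕ → ℝ) (k : ℕ) :
    B (∑ j ∈ s, α j • e j) (e k) = if k ∈ s then α k else 0 := by
  simp [S.orth, map_sum]

theorem B_comb_comb (S : NodalSystem E B e m z) (s : Finset ℕ) (α β : ℕ → ℝ) :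
    B (∑ j ∈ s, α j • e j) (∑ j ∈ s, β j • e j) = ∑ j ∈ s, α j * β j := by
  rw [map_sum (B _)]
  refine Finset.sum_congr rfl fun k hk => ?_
  rw [map_smul, S.B_comb, if_pos hk, smul_eq_mul, mul_comm]

theorem E_comb_comb (S : NodalSystem E B e m z) (s : Finset ℕ) (α : ℕ → ℝ) :
    E (∑ j ∈ s, α j • e j) (∑ j ∈ s, α j • e j) = ∑ j ∈ s, m j * α j ^ 2 := by
  rw [map_sum (E _)]
  refine Finset.sum_congr rfl fun k hk => ?_
  rw [map_smul, S.eigen, S.B_comb, if_pos hk, smul_eq_mul]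
  ring

/-- Subtract from `f` a combination `c` of the first `n` eigenvectors that agrees with `f` at the
nodes. Then `f - c` satisfies the nodal bound, and orthogonality removes the cross terms, so `m n (B
f f + B c c) ≤ E f f + E c c`. Since `c` involves only eigenvalues below `m n`, its own terms can be
discarded. -/
theorem rayleigh (S : NodalSystem E B e m z) (n : ℕ) (f : V)
    (hf : ∀ k < n, B f (e k) = 0) : m n * B f f ≤ E f f := by
  classical
  let c : (Fin n → ℝ) → V := fun α => ∑ k : Fin n, α k • e k
  let A : (Fin n → ℝ) →ₗ[ℝ] (Fin n → ℝ) :=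
    LinearMap.pi fun j => ∑ k : Fin n, (z n j (e k)) • LinearMap.proj k
  have hA : ∀ α j, A α j = z n j (c α) := by
    intro α j
    simp [A, c, map_sum, mul_comm]
  have hc : ∀ α : Fin n → ℝ, ∃ β : ℕ → ℝ, (∀ k : Fin n, β k = α k) ∧
      c α = ∑ k ∈ Finset.range n, β k • e k := by
    intro α
    refine ⟨fun k => if h : k < n then α ⟨k, h⟩ else 0, fun k => by simp, ?_⟩
    rw [Finset.sum_range]
    simp [c]
  -- A combination vanishing at all nodes has Rayleigh quotient at least `m n` by the nodal bound,
  -- yet only eigenvalues smaller than `m n` occur in it, so it is zero. As the numbers of nodes and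
  -- of eigenvectors agree, injectivity gives interpolation of any nodal values.
  have hinj : Function.Injective A := by
    rw [← LinearMap.ker_eq_bot, LinearMap.ker_eq_bot']
    intro α hα
    obtain ⟨β, hβ, hcβ⟩ := hc α
    have h1 := S.nodal n (c α) fun j => by rw [← hA, hα]; rfl
    rw [hcβ, S.B_comb_comb, S.E_comb_comb, Finset.mul_sum] at h1
    have h2 : ∀ k ∈ Finset.range n, 0 ≤ m n * (β k * β k) - m k * β k ^ 2 := by
      intro k hk
      have := S.mono (Finset.mem_range.1 hk)
      nlinarith [sq_nonneg (β k)]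
    have h3 : ∑ k ∈ Finset.range n, (m n * (β k * β k) - m k * β k ^ 2) = 0 := by
      apply le_antisymm _ (Finset.sum_nonneg h2)
      rw [Finset.sum_sub_distrib]; linarith
    have h4 := (Finset.sum_eq_zero_iff_of_nonneg h2).1 h3
    ext k
    have h5 := h4 k (Finset.mem_range.2 k.2)
    have h6 := S.mono k.2
    rw [hβ] at h5
    have h7 : (m n - m k) * α k ^ 2 = 0 := by linarith
    rcases mul_eq_zero.1 h7 with h | h
    · linarith
    · simpa using h
  have hsurj : Function.Surjective A := LinearMap.injective_iff_surjective.1 hinj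
  obtain ⟨α, hα⟩ := hsurj fun j => z n j f
  obtain ⟨β, -, hcβ⟩ := hc α
  have h1 := S.nodal n (f - c α) fun j => by
    rw [map_sub, ← hA, hα]; simp
  have hB0 : B f (c α) = 0 := by
    rw [hcβ, map_sum]
    refine Finset.sum_eq_zero fun k hk => ?_
    rw [map_smul, hf k (Finset.mem_range.1 hk), smul_zero]
  have hE0 : E f (c α) = 0 := by
    rw [hcβ, map_sum]
    refine Finset.sum_eq_zero fun k hk => ?_
    rw [map_smul, S.eigen, hf k (Finset.mem_range.1 hk), mul_zero, smul_zero]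
  have hB1 : B (f - c α) (f - c α) = B f f + B (c α) (c α) := by
    simp [S.symmB (c α) f, hB0]
  have hE1 : E (f - c α) (f - c α) = E f f + E (c α) (c α) := by
    simp [S.symmE (c α) f, hE0]
  have h2 : E (c α) (c α) ≤ m n * B (c α) (c α) := by
    rw [hcβ, S.B_comb_comb, S.E_comb_comb, Finset.mul_sum]
    refine Finset.sum_le_sum fun k hk => ?_
    have := S.mono (Finset.mem_range.1 hk)
    nlinarith [sq_nonneg (β k)]
  rw [hB1, hE1] at h1
  linarith

/-- `rayleigh` is applied to `f` minus its projection. The energy of the projection is nonnegative,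
so it may be dropped on the right. -/
theorem remainder (S : NodalSystem E B e m z) (n : ℕ) (f : V) :
    m n * (B f f - ∑ k ∈ Finset.range n, B f (e k) ^ 2) ≤ E f f := by
  set c : V := ∑ k ∈ Finset.range n, B f (e k) • e k with hc
  have h1 := S.rayleigh n (f - c) fun k hk => by
    rw [map_sub, LinearMap.sub_apply, hc, S.B_comb, if_pos (Finset.mem_range.2 hk), sub_self]
  have hB0 : B f c = ∑ k ∈ Finset.range n, B f (e k) ^ 2 := by
    simp [hc, sq]
  have hE0 : E f c = ∑ k ∈ Finset.range n, m k * B f (e k) ^ 2 := by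
    rw [hc, map_sum]
    refine Finset.sum_congr rfl fun k _ => ?_
    rw [map_smul, S.eigen, smul_eq_mul]; ring
  have hB1 : B c c = ∑ k ∈ Finset.range n, B f (e k) ^ 2 := by
    rw [hc, S.B_comb_comb]; simp [sq]
  have hE1 : E c c = ∑ k ∈ Finset.range n, m k * B f (e k) ^ 2 := by
    rw [hc, S.E_comb_comb]
  have hpos : 0 ≤ ∑ k ∈ Finset.range n, m k * B f (e k) ^ 2 :=
    Finset.sum_nonneg fun k _ => mul_nonneg (S.pos k).le (sq_nonneg _)
  simp only [map_sub, LinearMap.sub_apply, S.symmB c f, S.symmE c f, hB0, hE0, hB1, hE1] at h1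
  linarith

/-- The partial sums lie between `B f f - E f f / m n`, by `remainder`, and `B f f`, by Bessel's
inequality. -/
theorem hasSum (S : NodalSystem E B e m z) (hm : Tendsto m atTop atTop) (f : V) :
    HasSum (fun k => B f (e k) ^ 2) (B f f) := by
  rw [hasSum_iff_tendsto_nat_of_nonneg fun k => sq_nonneg _]
  have hlow : ∀ n, B f f - E f f / m n ≤ ∑ k ∈ Finset.range n, B f (e k) ^ 2 := by
    intro n
    have := S.remainder n f
    rw [sub_le_comm, le_div_iff₀ (S.pos n)]
    linarith
  have hup : ∀ n, ∑ k ∈ Finset.range n, B f (e k) ^ 2 ≤ B f f := by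
    intro n
    have h := S.nonneg (f - ∑ k ∈ Finset.range n, B f (e k) • e k)
    have hB0 : B f (∑ k ∈ Finset.range n, B f (e k) • e k)
        = ∑ k ∈ Finset.range n, B f (e k) ^ 2 := by
      simp [sq]
    have hB1 := S.B_comb_comb (Finset.range n) (fun k => B f (e k)) fun k => B f (e k)
    simp only [← sq] at hB1
    simp only [map_sub, LinearMap.sub_apply, S.symmB (∑ k ∈ Finset.range n, B f (e k) • e k) f,
      hB0, hB1] at h
    linarith
  refine tendsto_of_tendsto_of_tendsto_of_le_of_le ?_ tendsto_const_nhds hlow hup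
  simpa using tendsto_const_nhds.sub (tendsto_const_nhds.div_atTop hm)

end NodalSystem

end Algebra

/-! ### Sturm–Liouville systems on an interval -/

/-- Normalized eigenfunctions `e n` (with derivatives `d n` and nodes `z n`) of
`f ↦ -(p f')' / w` on `]a, b[`, with the boundary conditions `f b = 0` and `p a * f a = 0`. -/
structure SturmSystem (a b : ℝ) (p w : ℝ → ℝ) (e d : ℕ → ℝ → ℝ) (m : ℕ → ℝ)
    (z : (n : ℕ) → Fin n → ℝ) : Prop where
  lt : a < b
  contp : ContinuousOn p (Icc a b)
  contw : ContinuousOn w (Icc a b)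
  p_pos : ∀ x ∈ Ioo a b, 0 < p x
  w_pos : ∀ x ∈ Ioo a b, 0 < w x
  deriv : ∀ n x, HasDerivAt (e n) (d n x) x
  contd : ∀ n, Continuous (d n)
  eigen : ∀ n, ∀ x ∈ Ioo a b, HasDerivAt (fun y => p y * d n y) (-(m n * (w x * e n x))) x
  right : ∀ n, e n b = 0
  left : ∀ n, p a * e n a = 0
  left' : ∀ n, e n a = 0 → p a ≠ 0
  simple : ∀ n, ∀ x ∈ Icc a b, e n x = 0 → d n x ≠ 0
  mem_nodes : ∀ n j, z n j ∈ Ioo a b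
  nodes : ∀ n, ∀ x ∈ Ioo a b, e n x = 0 → ∃ j, x = z n j
  unit : ∀ n, ∫ x in a..b, e n x * e n x * w x = 1
  mono : StrictMono m
  pos : ∀ n, 0 < m n

/-- The `C¹` functions on `[a, b]` with the boundary conditions `f b = 0` and `p a * f a = 0`. -/
def sturmDomain (a b : ℝ) (p : ℝ → ℝ) : Submodule ℝ (ℝ → ℝ) where
  carrier := {f | ContDiffOn ℝ 1 f (Icc a b) ∧ f b = 0 ∧ p a * f a = 0}
  add_mem' := by
    rintro f g ⟨h1, h2, h3⟩ ⟨k1, k2, k3⟩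
    exact ⟨h1.add k1, by simp [h2, k2], by simp [mul_add, h3, k3]⟩
  zero_mem' := ⟨contDiffOn_const, rfl, by simp⟩
  smul_mem' := by
    rintro c f ⟨h1, h2, h3⟩
    exact ⟨h1.const_smul c, by simp [h2], by simp [mul_left_comm _ c, h3]⟩

namespace SturmSystem

variable {a b : ℝ} {p w : ℝ → ℝ} {e d : ℕ → ℝ → ℝ} {m : ℕ → ℝ} {z : (n : ℕ) → Fin n → ℝ}

theorem hasDerivWithinAt_of_mem {f : ℝ → ℝ} (hf : ContDiffOn ℝ 1 f (Icc a b)) :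
    ∀ x ∈ Icc a b, HasDerivWithinAt f (derivWithin f (Icc a b) x) (Icc a b) x :=
  fun x hx => ((hf.differentiableOn one_ne_zero) x hx).hasDerivWithinAt

theorem continuousOn_derivWithin_of_mem (hab : a < b) {f : ℝ → ℝ}
    (hf : ContDiffOn ℝ 1 f (Icc a b)) : ContinuousOn (derivWithin f (Icc a b)) (Icc a b) :=
  hf.continuousOn_derivWithin (uniqueDiffOn_Icc hab) le_rfl

theorem intervalIntegrable_of_Icc (hab : a < b) {f : ℝ → ℝ} (hf : ContinuousOn f (Icc a b)) :
    IntervalIntegrable f volume a b :=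
  ContinuousOn.intervalIntegrable (by rwa [uIcc_of_le hab.le])

/-- The scalar product with weight `w`. -/
noncomputable def formB (S : SturmSystem a b p w e d m z) :
    sturmDomain a b p →ₗ[ℝ] sturmDomain a b p →ₗ[ℝ] ℝ :=
  LinearMap.mk₂ ℝ (fun f g => ∫ x in a..b, f.1 x * g.1 x * w x)
    (by
      intro f f' g
      have hf := f.2.1.continuousOn
      have hf' := f'.2.1.continuousOn
      have hg := g.2.1.continuousOn
      have hw := S.contw
      rw [← intervalIntegral.integral_add]
      · simp [add_mul]
      · exact intervalIntegrable_of_Icc S.lt (by fun_prop)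
      · exact intervalIntegrable_of_Icc S.lt (by fun_prop))
    (by
      intro c f g
      simp [← intervalIntegral.integral_const_mul, mul_assoc])
    (by
      intro g f f'
      have hf := f.2.1.continuousOn
      have hf' := f'.2.1.continuousOn
      have hg := g.2.1.continuousOn
      have hw := S.contw
      rw [← intervalIntegral.integral_add]
      · simp [add_mul, mul_add]
      · exact intervalIntegrable_of_Icc S.lt (by fun_prop)
      · exact intervalIntegrable_of_Icc S.lt (by fun_prop))
    (by
      intro c f g
      simp [← intervalIntegral.integral_const_mul, mul_assoc, mul_left_comm])

/-- The energy. -/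
noncomputable def formE (S : SturmSystem a b p w e d m z) :
    sturmDomain a b p →ₗ[ℝ] sturmDomain a b p →ₗ[ℝ] ℝ :=
  LinearMap.mk₂ ℝ (fun f g => ∫ x in a..b,
      p x * (derivWithin f.1 (Icc a b) x * derivWithin g.1 (Icc a b) x))
    (by
      intro f f' g
      have hf := continuousOn_derivWithin_of_mem S.lt f.2.1
      have hf' := continuousOn_derivWithin_of_mem S.lt f'.2.1
      have hg := continuousOn_derivWithin_of_mem S.lt g.2.1
      have hp := S.contp
      rw [← intervalIntegral.integral_add]
      · refine intervalIntegral.integral_congr fun x hx => ?_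
        rw [uIcc_of_le S.lt.le] at hx
        have := derivWithin_add (hasDerivWithinAt_of_mem f.2.1 x hx).differentiableWithinAt
          (hasDerivWithinAt_of_mem f'.2.1 x hx).differentiableWithinAt
        simp only [Submodule.coe_add, this]
        ring
      · exact intervalIntegrable_of_Icc S.lt (by fun_prop)
      · exact intervalIntegrable_of_Icc S.lt (by fun_prop))
    (by
      intro c f g
      rw [smul_eq_mul, ← intervalIntegral.integral_const_mul]
      refine intervalIntegral.integral_congr fun x hx => ?_
      rw [uIcc_of_le S.lt.le] at hx
      have := derivWithin_const_smul c
        (hasDerivWithinAt_of_mem f.2.1 x hx).differentiableWithinAt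
      simp only [Submodule.coe_smul, this, smul_eq_mul]
      ring)
    (by
      intro g f f'
      have hf := continuousOn_derivWithin_of_mem S.lt f.2.1
      have hf' := continuousOn_derivWithin_of_mem S.lt f'.2.1
      have hg := continuousOn_derivWithin_of_mem S.lt g.2.1
      have hp := S.contp
      rw [← intervalIntegral.integral_add]
      · refine intervalIntegral.integral_congr fun x hx => ?_
        rw [uIcc_of_le S.lt.le] at hx
        have := derivWithin_add (hasDerivWithinAt_of_mem f.2.1 x hx).differentiableWithinAt
          (hasDerivWithinAt_of_mem f'.2.1 x hx).differentiableWithinAt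
        simp only [Submodule.coe_add, this]
        ring
      · exact intervalIntegrable_of_Icc S.lt (by fun_prop)
      · exact intervalIntegrable_of_Icc S.lt (by fun_prop))
    (by
      intro c g f
      rw [smul_eq_mul, ← intervalIntegral.integral_const_mul]
      refine intervalIntegral.integral_congr fun x hx => ?_
      rw [uIcc_of_le S.lt.le] at hx
      have := derivWithin_const_smul c
        (hasDerivWithinAt_of_mem f.2.1 x hx).differentiableWithinAt
      simp only [Submodule.coe_smul, this, smul_eq_mul]
      ring)

theorem formB_apply (S : SturmSystem a b p w e d m z) (f g : sturmDomain a b p) :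
    S.formB f g = ∫ x in a..b, f.1 x * g.1 x * w x := rfl

theorem formE_apply (S : SturmSystem a b p w e d m z) (f g : sturmDomain a b p) :
    S.formE f g = ∫ x in a..b,
      p x * (derivWithin f.1 (Icc a b) x * derivWithin g.1 (Icc a b) x) := rfl

theorem conte (S : SturmSystem a b p w e d m z) (n : ℕ) : Continuous (e n) :=
  continuous_iff_continuousAt.2 fun x => (S.deriv n x).continuousAt

theorem contDiff (S : SturmSystem a b p w e d m z) (n : ℕ) : ContDiff ℝ 1 (e n) := by
  rw [contDiff_one_iff_deriv]
  refine ⟨fun x => (S.deriv n x).differentiableAt, ?_⟩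
  rw [funext fun x => (S.deriv n x).deriv]
  exact S.contd n

theorem mem (S : SturmSystem a b p w e d m z) (n : ℕ) : e n ∈ sturmDomain a b p :=
  ⟨(S.contDiff n).contDiffOn, S.right n, S.left n⟩

/-- The eigenfunctions as elements of the domain. -/
def vec (S : SturmSystem a b p w e d m z) (n : ℕ) : sturmDomain a b p := ⟨e n, S.mem n⟩

theorem derivWithin_eq (S : SturmSystem a b p w e d m z) (n : ℕ) {x : ℝ} (hx : x ∈ Icc a b) :
    derivWithin (e n) (Icc a b) x = d n x :=
  (S.deriv n x).hasDerivWithinAt.derivWithin (uniqueDiffOn_Icc S.lt x hx)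

/-- Integration by parts: the boundary term `p e' f` vanishes at `b` because `f b = 0` and at `a`
because `p a * f a = 0`. -/
theorem formE_vec (S : SturmSystem a b p w e d m z) (f : sturmDomain a b p) (k : ℕ) :
    S.formE f (S.vec k) = m k * S.formB f (S.vec k) := by
  rw [formE_apply, formB_apply, ← sub_eq_zero, ← intervalIntegral.integral_const_mul,
    ← intervalIntegral.integral_sub]
  · have hf := f.2.1.continuousOn
    have hf' := continuousOn_derivWithin_of_mem S.lt f.2.1
    have hd := (S.contd k).continuousOn (s := Icc a b)
    have he := (S.conte k).continuousOn (s := Icc a b)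
    have hp := S.contp
    have hw := S.contw
    have key := intervalIntegral.integral_eq_sub_of_hasDerivAt_of_le S.lt.le
      (f := fun x => p x * d k x * f.1 x)
      (f' := fun x => -(m k * (w x * e k x)) * f.1 x + p x * d k x * derivWithin f.1 (Icc a b) x)
      (by fun_prop)
      (fun x hx => (S.eigen k x hx).mul
        ((hasDerivWithinAt_of_mem f.2.1 x (Ioo_subset_Icc_self hx)).hasDerivAt
          (Icc_mem_nhds hx.1 hx.2)))
      (intervalIntegrable_of_Icc S.lt (by fun_prop))
    rw [f.2.2.1, show p a * d k a * f.1 a = d k a * (p a * f.1 a) by ring, f.2.2.2] at key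
    rw [mul_zero, mul_zero, sub_zero] at key
    rw [← key]
    refine intervalIntegral.integral_congr fun x hx => ?_
    rw [uIcc_of_le S.lt.le] at hx
    simp only [vec, S.derivWithin_eq k hx]
    ring
  · have := continuousOn_derivWithin_of_mem S.lt f.2.1
    have := continuousOn_derivWithin_of_mem S.lt (S.vec k).2.1
    have := S.contp
    exact intervalIntegrable_of_Icc S.lt (by fun_prop)
  · have := f.2.1.continuousOn
    have := (S.vec k).2.1.continuousOn
    have := S.contw
    exact intervalIntegrable_of_Icc S.lt (by fun_prop)

/-- Orthogonality follows from the symmetry of the energy and the distinctness of the eigenvalues.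
-/
theorem formB_vec (S : SturmSystem a b p w e d m z) (j k : ℕ) :
    S.formB (S.vec j) (S.vec k) = if j = k then 1 else 0 := by
  split_ifs with h
  · subst h
    exact S.unit j
  · have h1 := S.formE_vec (S.vec j) k
    have h2 := S.formE_vec (S.vec k) j
    have h3 : S.formE (S.vec j) (S.vec k) = S.formE (S.vec k) (S.vec j) := by
      simp only [formE_apply, mul_comm]
    have h4 : S.formB (S.vec j) (S.vec k) = S.formB (S.vec k) (S.vec j) := by
      simp only [formB_apply, mul_comm]
    rw [h3, h2, ← h4] at h1
    have h5 : (m j - m k) * S.formB (S.vec j) (S.vec k) = 0 := by linarith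
    exact (mul_eq_zero.1 h5).resolve_left (sub_ne_zero.2 (S.mono.injective.ne h))

/-- Jacobi's inequality: if `h` vanishes at the nodes of `e n`, then `∫ p h'² ≥ m n ∫ w h²`. -/
theorem jacobi (S : SturmSystem a b p w e d m z) (n : ℕ) (h : sturmDomain a b p)
    (hz : ∀ j, h.1 (z n j) = 0) : m n * S.formB h h ≤ S.formE h h := by
  obtain ⟨h, hh⟩ := h
  simp only at hz
  set h' := derivWithin h (Icc a b) with h'_def
  have hd : ∀ x ∈ Icc a b, HasDerivWithinAt h (h' x) (Icc a b) x :=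
    hasDerivWithinAt_of_mem hh.1
  have hc : ContinuousOn h (Icc a b) := hh.1.continuousOn
  have hc' : ContinuousOn h' (Icc a b) := continuousOn_derivWithin_of_mem S.lt hh.1
  have hp := S.contp
  have hw := S.contw
  have hdc := (S.contd n).continuousOn (s := Icc a b)
  have hec := (S.conte n).continuousOn (s := Icc a b)
  have hzero : ∀ x ∈ Icc a b, e n x = 0 → h x = 0 := by
    intro x hx hex
    rcases hx.1.eq_or_lt with rfl | hax
    · exact (mul_eq_zero.1 hh.2.2).resolve_left (S.left' n hex)
    rcases hx.2.eq_or_lt with rfl | hxb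
    · exact hh.2.1
    obtain ⟨j, rfl⟩ := S.nodes n x ⟨hax, hxb⟩ hex
    exact hz j
  -- Picone's device: away from the zeros of `e`, `F' = p h'² - m w h² - p (h' - e' h / e)²`, so
  -- integrating `F'` gives the claim once `F` is known to be continuous with zero boundary values.
  set F : ℝ → ℝ := fun x => p x * d n x * h x ^ 2 / e n x with hF
  have alg : ∀ P H E r : ℝ, r ≠ 0 → P * H ^ 2 / E = P * (r⁻¹ * H) * H / (r⁻¹ * E) := by
    intro P H E r hr
    rcases eq_or_ne E 0 with rfl | hE
    · simp
    · field_simp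
  -- At a zero of `e` also `h` vanishes, and the zero is simple. Dividing numerator and denominator
  -- by `y - x` shows that `F` tends to 0, which is the value that division by zero assigns.
  have hFc : ContinuousOn F (Icc a b) := by
    intro x hx
    by_cases hex : e n x = 0
    · have hhx := hzero x hx hex
      have hFx : F x = 0 := by simp [hF, hex]
      rw [← continuousWithinAt_sdiff_self, ContinuousWithinAt, hFx]
      have t1 := hasDerivWithinAt_iff_tendsto_slope.1 (hd x hx)
      have t2 := hasDerivWithinAt_iff_tendsto_slope.1 ((S.deriv n x).hasDerivWithinAt (s := Icc a b))
      have t3 : Tendsto (fun y => p y * d n y) (𝓝[Icc a b \ {x}] x) (𝓝 (p x * d n x)) :=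
        ((hp.mul hdc) x hx).mono_left (nhdsWithin_mono _ sdiff_subset)
      have t4 : Tendsto h (𝓝[Icc a b \ {x}] x) (𝓝 0) := by
        rw [← hhx]; exact (hc x hx).mono_left (nhdsWithin_mono _ sdiff_subset)
      have t5 := ((t3.mul t1).mul t4).div t2 (S.simple n x hx hex)
      rw [mul_zero, zero_div] at t5
      refine t5.congr' ?_
      filter_upwards [self_mem_nhdsWithin] with y hy
      have hyx : y - x ≠ 0 := sub_ne_zero.2 fun h => hy.2 h
      simp only [slope, vsub_eq_sub, hhx, hex, sub_zero, smul_eq_mul, Pi.div_apply, hF]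
      exact (alg _ _ _ _ hyx).symm
    · exact ((((hp x hx).mul (hdc x hx)).mul ((hc x hx).pow 2)).div (hec x hx) hex)
  have hder : ∀ x ∈ Ioo a b, ∃ c, HasDerivAt F c x ∧
      c ≤ p x * (h' x * h' x) - m n * (h x * h x * w x) := by
    intro x hx
    have hx' := Ioo_subset_Icc_self hx
    have hdx := (hd x hx').hasDerivAt (Icc_mem_nhds hx.1 hx.2)
    have hpd := S.eigen n x hx
    by_cases hex : e n x = 0
    · have hhx := hzero x hx' hex
      -- At a common zero `F y / (y - x)` tends to `p e' h' h' / e' = p h'²`, so the derivative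
      -- exists there too and the term with `m n` is zero.
      refine ⟨p x * (h' x * h' x), ?_, by simp [hhx]⟩
      rw [hasDerivAt_iff_tendsto_slope]
      have t1 := hasDerivAt_iff_tendsto_slope.1 hdx
      have t2 := hasDerivAt_iff_tendsto_slope.1 (S.deriv n x)
      have t3 : Tendsto (fun y => p y * d n y) (𝓝[≠] x) (𝓝 (p x * d n x)) :=
        hpd.continuousAt.tendsto.mono_left nhdsWithin_le_nhds
      have t5 := ((t3.mul t1).mul t1).div t2 (S.simple n x hx' hex)
      have : p x * d n x * h' x * h' x / d n x = p x * (h' x * h' x) := by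
        have := S.simple n x hx' hex
        field_simp
      rw [this] at t5
      refine t5.congr' ?_
      filter_upwards [self_mem_nhdsWithin] with y hy
      have hyx : y - x ≠ 0 := sub_ne_zero.2 hy
      simp only [slope, vsub_eq_sub, hhx, hex, sub_zero, smul_eq_mul, Pi.div_apply, hF]
      rw [alg _ _ _ _ hyx]
      simp
      ring
    · refine ⟨_, (hpd.mul (hdx.pow 2)).div (S.deriv n x) hex, ?_⟩
      have hpx := S.p_pos x hx
      have : p x * (h' x * h' x) - m n * (h x * h x * w x) -
          ((-(m n * (w x * e n x)) * (h ^ 2) x + p x * d n x * (↑2 * h x ^ (2 - 1) * h' x)) * e n x -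
            p x * d n x * (h ^ 2) x * d n x) / e n x ^ 2
          = p x * (h' x - d n x * h x / e n x) ^ 2 := by
        simp only [Pi.pow_apply]
        field_simp
        push_cast
        ring
      have h2 : 0 ≤ p x * (h' x - d n x * h x / e n x) ^ 2 := by positivity
      rw [← this] at h2
      exact sub_nonneg.1 h2
  choose! c hc1 hc2 using hder
  have key := intervalIntegral.sub_le_integral_of_hasDeriv_right_of_le S.lt.le hFc
    (fun x hx => (hc1 x hx).hasDerivWithinAt)
    (φ := fun x => p x * (h' x * h' x) - m n * (h x * h x * w x))
    (ContinuousOn.integrableOn_Icc (by fun_prop)) hc2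
  have hFb : F b = 0 := by simp [hF, S.right n]
  have hFa : F a = 0 := by
    have : p a * d n a * h a ^ 2 = (p a * h a) * (d n a * h a) := by ring
    simp only [hF, this, hh.2.2, zero_mul, zero_div]
  rw [hFa, hFb, sub_zero, intervalIntegral.integral_sub
    (intervalIntegrable_of_Icc S.lt (by fun_prop)) (intervalIntegrable_of_Icc S.lt (by fun_prop)),
    intervalIntegral.integral_const_mul] at key
  simp only [formB_apply, formE_apply]
  linarith

theorem nodal (S : SturmSystem a b p w e d m z) :
    NodalSystem S.formE S.formB S.vec m
      (fun n j => (LinearMap.proj (z n j)).comp (sturmDomain a b p).subtype) where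
  symmB f g := by
    rw [formB_apply, formB_apply]
    exact intervalIntegral.integral_congr fun x _ => by ring
  symmE f g := by
    rw [formE_apply, formE_apply]
    exact intervalIntegral.integral_congr fun x _ => by ring
  nonneg f := by
    rw [formB_apply, intervalIntegral.integral_of_le S.lt.le,
      integral_Ioc_eq_integral_Ioo]
    exact setIntegral_nonneg measurableSet_Ioo fun x hx =>
      mul_nonneg (mul_self_nonneg _) (S.w_pos x hx).le
  eigen := S.formE_vec
  orth := S.formB_vec
  mono := S.mono
  pos := S.pos
  nodal n h hz := S.jacobi n h fun j => hz j

/-- Parseval's identity. -/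
theorem parseval (S : SturmSystem a b p w e d m z) (hm : Tendsto m atTop atTop) {f : ℝ → ℝ}
    (hf : f ∈ sturmDomain a b p) :
    HasSum (fun k => (∫ x in a..b, f x * e k x * w x) ^ 2) (∫ x in a..b, f x * f x * w x) :=
  S.nodal.hasSum hm ⟨f, hf⟩

theorem integral_orth (S : SturmSystem a b p w e d m z) (j k : ℕ) :
    ∫ x in a..b, e j x * e k x * w x = if j = k then 1 else 0 := S.formB_vec j k

/-- Green's identity for `f` and `e k`: the boundary terms `p (f' e - e' f)` vanish at both ends.
The weighted equation is needed only in the open interval, which accommodates a degenerate left end.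
-/
theorem integral_operator (S : SturmSystem a b p w e d m z) (k : ℕ) {f f' g : ℝ → ℝ}
    (hf : ContinuousOn f (Icc a b)) (hf' : ContinuousOn f' (Icc a b))
    (hg : ContinuousOn g (Icc a b)) (h1 : ∀ x ∈ Ioo a b, HasDerivAt f (f' x) x)
    (h2 : ∀ x ∈ Ioo a b, HasDerivAt (fun y => p y * f' y) (w x * g x) x)
    (hb : f b = 0) (ha : p a * f a = 0) :
    ∫ x in a..b, g x * e k x * w x = -(m k) * ∫ x in a..b, f x * e k x * w x := by
  have hd := (S.contd k).continuousOn (s := Icc a b)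
  have he := (S.conte k).continuousOn (s := Icc a b)
  have hp := S.contp
  have hw := S.contw
  have key := intervalIntegral.integral_eq_sub_of_hasDerivAt_of_le S.lt.le
    (f := fun x => p x * f' x * e k x - p x * d k x * f x)
    (f' := fun x => (w x * g x * e k x + p x * f' x * d k x) -
      (-(m k * (w x * e k x)) * f x + p x * d k x * f' x))
    (by fun_prop)
    (fun x hx => ((h2 x hx).mul (S.deriv k x)).sub ((S.eigen k x hx).mul (h1 x hx)))
    (intervalIntegrable_of_Icc S.lt (by fun_prop))
  rw [S.right k, hb, show p a * f' a * e k a - p a * d k a * f a =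
    f' a * (p a * e k a) - d k a * (p a * f a) by ring, S.left k, ha] at key
  rw [← intervalIntegral.integral_const_mul, ← sub_eq_zero, ← intervalIntegral.integral_sub
    (intervalIntegrable_of_Icc S.lt (by fun_prop)) (intervalIntegrable_of_Icc S.lt (by fun_prop))]
  rw [mul_zero, mul_zero, mul_zero, mul_zero, sub_zero, sub_zero] at key
  rw [← key]
  exact intervalIntegral.integral_congr fun x _ => by ring

end SturmSystem

/-! ### The functions `besselPsi` -/

theorem gamma_add_nat_pos {p : ℝ} (hp : 0 ≤ p) (k : ℕ) : 0 < Real.Gamma (k + p + 1) :=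
  Real.Gamma_pos_of_pos (by positivity)

theorem gamma_le_gamma_add_nat {p : ℝ} (hp : 0 ≤ p) (k : ℕ) :
    Real.Gamma (p + 1) ≤ Real.Gamma (k + p + 1) := by
  induction k with
  | zero => simp
  | succ k ih =>
    refine ih.trans ?_
    have h : ((k + 1 : ℕ) : ℝ) + p + 1 = (k + p + 1) + 1 := by push_cast; ring
    have hk : (0 : ℝ) ≤ k := k.cast_nonneg
    rw [h, Real.Gamma_add_one (s := k + p + 1) (by linarith)]
    exact le_mul_of_one_le_left (gamma_add_nat_pos hp k).le (by linarith)

theorem besselPsi_term_bound {p : ℝ} (hp : 0 ≤ p) {R z : ℝ} (hz : |z| ≤ R) (k : ℕ) :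
    ‖(-1) ^ k * z ^ k / ((k.factorial : ℝ) * Real.Gamma (k + p + 1))‖
      ≤ R ^ k / k.factorial * (Real.Gamma (p + 1))⁻¹ := by
  have h0 : 0 < Real.Gamma (p + 1) := by simpa using gamma_add_nat_pos hp 0
  have h1 := gamma_le_gamma_add_nat hp k
  rw [norm_div, norm_mul, norm_pow, norm_pow, norm_neg, norm_one, one_pow, one_mul, norm_mul,
    Real.norm_eq_abs, Real.norm_eq_abs, Real.norm_eq_abs, Nat.abs_cast,
    abs_of_pos (gamma_add_nat_pos hp k), ← div_div, ← div_eq_mul_inv]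
  have hR := (abs_nonneg z).trans hz
  gcongr

theorem besselPsi_hasSum {p : ℝ} (hp : 0 ≤ p) (z : ℝ) :
    HasSum (fun k : ℕ => (-1) ^ k * z ^ k / ((k.factorial : ℝ) * Real.Gamma (k + p + 1)))
      (besselPsi p z) :=
  (Summable.of_norm_bounded ((Real.summable_pow_div_factorial |z|).mul_right _)
    (besselPsi_term_bound hp le_rfl)).hasSum

/-- Termwise differentiation: after the shift `k ↦ k + 1` the Gamma factor becomes that of the
parameter `p + 1`. -/
theorem besselPsi_hasDerivAt {p : ℝ} (hp : 0 ≤ p) (z : ℝ) :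
    HasDerivAt (besselPsi p) (-besselPsi (p + 1) z) z := by
  set R := |z| + 1 with hR
  have hRpos : 1 ≤ R := by rw [hR]; linarith [abs_nonneg z]
  have hz : z ∈ Metric.ball (0 : ℝ) R := by simp [hR]
  have h0 : 0 < Real.Gamma (p + 1) := by simpa using gamma_add_nat_pos hp 0
  have key := hasDerivAt_tsum_of_isPreconnected
    (g := fun (k : ℕ) y => (-1) ^ k * y ^ k / ((k.factorial : ℝ) * Real.Gamma (k + p + 1)))
    (g' := fun (k : ℕ) y => (-1) ^ k * (k * y ^ (k - 1)) /
      ((k.factorial : ℝ) * Real.Gamma (k + p + 1)))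
    (u := fun k => (2 * R) ^ k / k.factorial * (Real.Gamma (p + 1))⁻¹)
    ((Real.summable_pow_div_factorial (2 * R)).mul_right _) Metric.isOpen_ball
    (convex_ball (0 : ℝ) R).isPreconnected
    (fun k y _ => ((hasDerivAt_pow k y).const_mul _).div_const _)
    (fun k y hy => ?_) hz (besselPsi_hasSum hp z).summable hz
  · refine key.congr_deriv ?_
    rw [Summable.tsum_eq_zero_add]
    · simp only [CharP.cast_eq_zero, zero_mul, mul_zero, zero_div, zero_add]
      rw [besselPsi, ← tsum_neg]
      refine tsum_congr fun k => ?_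
      have h1 := gamma_add_nat_pos (p := p + 1) (by linarith) k
      have h2 : ((k + 1 : ℕ) : ℝ) + p + 1 = k + (p + 1) + 1 := by push_cast; ring
      rw [h2, Nat.factorial_succ, Nat.add_sub_cancel]
      push_cast
      field_simp
      ring
    · have := (besselPsi_hasSum (p := p + 1) (by linarith) z).summable.neg
      rw [← summable_nat_add_iff 1]
      refine this.congr fun k => ?_
      have h1 := gamma_add_nat_pos (p := p + 1) (by linarith) k
      have h2 : ((k + 1 : ℕ) : ℝ) + p + 1 = k + (p + 1) + 1 := by push_cast; ring
      simp only [h2, Nat.factorial_succ, Nat.add_sub_cancel]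
      push_cast
      field_simp
      ring
  · have hy' : |y| ≤ R := by simpa using (Metric.mem_ball.1 hy).le
    have h1 := gamma_le_gamma_add_nat hp k
    rw [norm_div, norm_mul, norm_pow, norm_neg, norm_one, one_pow, one_mul, norm_mul, norm_mul,
      norm_pow, Real.norm_eq_abs, Real.norm_eq_abs, Real.norm_eq_abs, Real.norm_eq_abs,
      Nat.abs_cast, Nat.abs_cast, abs_of_pos (gamma_add_nat_pos hp k), ← div_div, ← div_eq_mul_inv]
    -- From `k ≤ 2^k` and `R ≥ 1`; the radius `|z| + 1` was chosen with the latter in view.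
    have h3 : (k : ℝ) * |y| ^ (k - 1) ≤ (2 * R) ^ k := by
      rw [mul_pow]
      have : (k : ℝ) ≤ 2 ^ k := by exact_mod_cast Nat.lt_two_pow_self.le
      have h4 : |y| ^ (k - 1) ≤ R ^ k :=
        (pow_le_pow_left₀ (abs_nonneg y) hy' _).trans (pow_le_pow_right₀ hRpos (Nat.sub_le _ _))
      gcongr
    gcongr

theorem besselPsi_continuous {p : ℝ} (hp : 0 ≤ p) : Continuous (besselPsi p) :=
  continuous_iff_continuousAt.2 fun z => (besselPsi_hasDerivAt hp z).continuousAt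

theorem besselPsi_contDiff {p : ℝ} (hp : 0 ≤ p) : ContDiff ℝ ∞ (besselPsi p) := by
  rw [contDiff_infty]
  intro n
  induction n generalizing p with
  | zero => exact contDiff_zero.2 (besselPsi_continuous hp)
  | succ n ih =>
    rw [Nat.cast_add, Nat.cast_one, contDiff_succ_iff_deriv]
    refine ⟨fun z => (besselPsi_hasDerivAt hp z).differentiableAt, by simp, ?_⟩
    rw [funext fun z => (besselPsi_hasDerivAt hp z).deriv]
    exact (ih (by linarith)).neg

/-- Since `Ψ_p' = -Ψ_{p+1}`, this is `z Ψ'' + (p + 1) Ψ' + Ψ = 0`. The coefficients are compared by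
means of `Γ(s + 1) = s Γ(s)`. The auxiliary series `b` has zero constant term, so it can be shifted
by one index. -/
theorem besselPsi_ode {p : ℝ} (hp : 0 ≤ p) (z : ℝ) :
    z * besselPsi (p + 1 + 1) z - (p + 1) * besselPsi (p + 1) z + besselPsi p z = 0 := by
  have h0 := besselPsi_hasSum hp z
  have h1 := (besselPsi_hasSum (p := p + 1) (by linarith) z).mul_left (p + 1)
  have h2 := (besselPsi_hasSum (p := p + 1 + 1) (by linarith) z).mul_left z
  set b : ℕ → ℝ := fun k => (p + 1) * ((-1) ^ k * z ^ k / ((k.factorial : ℝ) *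
    Real.Gamma (k + (p + 1) + 1))) - (-1) ^ k * z ^ k / ((k.factorial : ℝ) *
    Real.Gamma (k + p + 1)) with hb
  have h3 : HasSum b (z * besselPsi (p + 1 + 1) z) := by
    have hb0 : b 0 = 0 := by
      have := gamma_add_nat_pos hp 0
      simp only [hb, pow_zero, Nat.factorial_zero, Nat.cast_zero, zero_add, Nat.cast_one, one_mul]
        at this ⊢
      rw [Real.Gamma_add_one (by positivity)]
      field_simp
      simp
    rw [← hasSum_nat_add_iff' 1]
    simp only [Finset.range_one, Finset.sum_singleton, hb0, sub_zero]
    refine (congrArg (fun f => HasSum f _) (funext fun k => ?_)).mpr h2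
    have g1 := gamma_add_nat_pos (p := p + 1) (by linarith) k
    have e1 : ((k + 1 : ℕ) : ℝ) + (p + 1) + 1 = (k + (p + 1) + 1) + 1 := by push_cast; ring
    have e2 : ((k + 1 : ℕ) : ℝ) + p + 1 = k + (p + 1) + 1 := by push_cast; ring
    have e3 : (k : ℝ) + (p + 1 + 1) + 1 = (k + (p + 1) + 1) + 1 := by ring
    have e4 : (k : ℝ) + (p + 1) + 1 ≠ 0 := by positivity
    simp only [hb, e1, e2, e3]
    rw [Real.Gamma_add_one e4, Nat.factorial_succ]
    push_cast
    field_simp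
    ring
  have h4 := (h3.sub h1).add h0
  refine h4.unique ?_
  refine (congrArg (fun f => HasSum f _) (funext fun k => ?_)).mpr hasSum_zero
  simp only [hb]
  ring

theorem besselPsi_zero {p : ℝ} (hp : 0 ≤ p) : 0 < besselPsi p 0 := by
  have h : besselPsi p 0 = 1 / Real.Gamma (p + 1) := by
    rw [besselPsi, tsum_eq_single 0 (fun k hk => by simp [hk])]
    simp
  rw [h]
  have := gamma_add_nat_pos hp 0
  simp only [Nat.cast_zero, zero_add] at this
  positivity

/-- The differential equation in divergence form, as a Sturm–Liouville system requires it. -/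
theorem besselPsi_weighted {p : ℝ} (hp : 0 ≤ p) (μ : ℝ) {x : ℝ} (hx : 0 < x) :
    HasDerivAt (fun y => y ^ (p + 1) * (-(μ * besselPsi (p + 1) (μ * y))))
      (-(μ * (x ^ p * besselPsi p (μ * x)))) x := by
  have h1 := Real.hasDerivAt_rpow_const (x := x) (p := p + 1) (Or.inl hx.ne')
  have h2 := (besselPsi_hasDerivAt (p := p + 1) (by linarith) (μ * x)).comp x
    ((hasDerivAt_id x).const_mul μ)
  have h3 := h1.fun_mul (h2.const_mul μ).fun_neg
  refine h3.congr_deriv ?_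
  have ode := besselPsi_ode hp (μ * x)
  have h4 : x ^ (p + 1) = x ^ p * x := Real.rpow_add_one hx.ne' p
  have h5 : besselPsi p (μ * x) = (p + 1) * besselPsi (p + 1) (μ * x) -
    μ * x * besselPsi (p + 1 + 1) (μ * x) := by linarith
  simp only [Function.comp, h4, h5, add_sub_cancel_right, mul_one]
  ring

/-- An energy argument replaces uniqueness for the singular equation. `H` is nonnegative and
nondecreasing, with `H' = (2p + 1) y^(2p) Ψ²`. If `H z = 0`, then `Ψ` vanishes on all of `]0, z]`,
contrary to `Ψ(0) > 0`. -/
theorem besselPsi_simple {p : ℝ} (hp : 0 ≤ p) {z : ℝ} (hz : 0 < z) (h : besselPsi p z = 0) :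
    besselPsi (p + 1) z ≠ 0 := by
  intro h'
  set H : ℝ → ℝ := fun y => (y ^ (p + 1) * besselPsi (p + 1) y) ^ 2 +
    y ^ (2 * p + 1) * besselPsi p y ^ 2 with hH
  have c1 := besselPsi_continuous (p := p + 1) (by linarith)
  have c0 := besselPsi_continuous hp
  have hc : ContinuousOn H (Ici 0) := by
    have r1 : Continuous fun y : ℝ => y ^ (p + 1) := Real.continuous_rpow_const (by linarith)
    have r2 : Continuous fun y : ℝ => y ^ (2 * p + 1) := Real.continuous_rpow_const (by linarith)
    exact Continuous.continuousOn (by fun_prop)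
  have hd : ∀ y : ℝ, 0 < y → HasDerivAt H ((2 * p + 1) * y ^ (2 * p) * besselPsi p y ^ 2) y := by
    intro y hy
    have h1 := (besselPsi_weighted hp 1 hy).neg
    simp only [one_mul] at h1
    have h2 := Real.hasDerivAt_rpow_const (x := y) (p := 2 * p + 1) (Or.inl hy.ne')
    have h3 := (h1.pow 2).add (h2.mul ((besselPsi_hasDerivAt hp y).pow 2))
    refine (h3.congr_of_eventuallyEq (Eventually.of_forall fun x => ?_)).congr_deriv ?_
    · simp [hH]
    · have e1 : y ^ (p + 1) = y ^ p * y := Real.rpow_add_one hy.ne' p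
      have e2 : y ^ (2 * p + 1) = y ^ p * y ^ p * y := by
        rw [Real.rpow_add_one hy.ne', two_mul, Real.rpow_add hy]
      have e3 : y ^ (2 * p) = y ^ p * y ^ p := by rw [two_mul, Real.rpow_add hy]
      simp only [Pi.neg_apply, Pi.pow_apply, e1, e2, e3, add_sub_cancel_right]
      push_cast
      ring
  have hm : MonotoneOn H (Ici 0) := by
    refine monotoneOn_of_deriv_nonneg (convex_Ici 0) hc ?_ ?_
    · rw [interior_Ici]
      exact fun y hy => (hd y hy).differentiableAt.differentiableWithinAt
    · rw [interior_Ici]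
      intro y hy
      rw [(hd y hy).deriv]
      have : (0 : ℝ) < y := hy
      positivity
  have hHz : H z = 0 := by simp [hH, h, h']
  have hzero : ∀ y ∈ Ioc 0 z, besselPsi p y = 0 := by
    intro y hy
    have h1 := hm (mem_Ici.2 hy.1.le) (mem_Ici.2 hz.le) hy.2
    rw [hHz] at h1
    have h2 : 0 < y ^ (2 * p + 1) := Real.rpow_pos_of_pos hy.1 _
    have h3 : y ^ (2 * p + 1) * besselPsi p y ^ 2 ≤ 0 := by
      have : 0 ≤ (y ^ (p + 1) * besselPsi (p + 1) y) ^ 2 := sq_nonneg _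
      simp only [hH] at h1
      linarith
    have h4 : besselPsi p y ^ 2 ≤ 0 := nonpos_of_mul_nonpos_right h3 h2
    exact pow_eq_zero_iff two_ne_zero |>.1 (le_antisymm h4 (sq_nonneg _))
  have h0 := besselPsi_zero hp
  have hev : ∀ᶠ y in 𝓝[>] (0 : ℝ), 0 < besselPsi p y :=
    (c0.continuousAt.eventually (lt_mem_nhds h0)).filter_mono nhdsWithin_le_nhds
  obtain ⟨y, hy1, hy2⟩ := (hev.and (Ioc_mem_nhdsGT hz)).exists
  rw [hzero y hy2] at hy1
  exact lt_irrefl _ hy1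

/-! ### Zeros of solutions of `u'' + Q u = 0` -/

/-- Sturm comparison with `sin (r - α)`. If `β - α < π`, the Wronskian `W` is strictly increasing
from 0, which forces `u'(β) > 0`; but a positive function that falls to 0 at `β` cannot have
positive slope there. -/
theorem sturm_gap {u u1 Q : ℝ → ℝ} {α β : ℝ} (hαβ : α < β)
    (h1 : ∀ r ∈ Icc α β, HasDerivAt u (u1 r) r)
    (h2 : ∀ r ∈ Icc α β, HasDerivAt u1 (-(Q r * u r)) r) (hQ : ∀ r ∈ Icc α β, Q r < 1)
    (hα : u α = 0) (hβ : u β = 0) (hu : ∀ r ∈ Ioo α β, 0 < u r) : Real.pi ≤ β - α := by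
  by_contra! hlt
  set W : ℝ → ℝ := fun r => u1 r * Real.sin (r - α) - u r * Real.cos (r - α)
  have hW : ∀ r ∈ Icc α β, HasDerivAt W ((1 - Q r) * u r * Real.sin (r - α)) r := by
    intro r hr
    have hs : HasDerivAt (fun r => r - α) 1 r := (hasDerivAt_id r).sub_const α
    refine (((h2 r hr).mul hs.sin).sub ((h1 r hr).mul hs.cos)).congr_deriv ?_
    ring
  have hmono : StrictMonoOn W (Icc α β) := by
    refine strictMonoOn_of_deriv_pos (convex_Icc α β)
      (fun r hr => (hW r hr).continuousAt.continuousWithinAt) ?_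
    rw [interior_Icc]
    intro r hr
    have hr' := Ioo_subset_Icc_self hr
    rw [(hW r hr').deriv]
    have s : 0 < Real.sin (r - α) :=
      Real.sin_pos_of_pos_of_lt_pi (by linarith [hr.1]) (by linarith [hr.2])
    have := hu r hr
    have : 0 < 1 - Q r := by linarith [hQ r hr']
    positivity
  have h3 := hmono (left_mem_Icc.2 hαβ.le) (right_mem_Icc.2 hαβ.le) hαβ
  have s : 0 < Real.sin (β - α) := Real.sin_pos_of_pos_of_lt_pi (by linarith) hlt
  simp only [W, hα, hβ, sub_self, Real.sin_zero, mul_zero, zero_mul, sub_zero] at h3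
  have h4 : 0 < u1 β := pos_of_mul_pos_left h3 s.le
  have h5 := (hasDerivAt_iff_tendsto_slope.1 (h1 β (right_mem_Icc.2 hαβ.le))).mono_left
    (nhdsWithin_mono β (fun y (hy : y ∈ Iio β) => (ne_of_lt hy : y ≠ β)))
  obtain ⟨y, hy1, hy2⟩ := ((h5.eventually (lt_mem_nhds h4)).and (Ioo_mem_nhdsLT hαβ)).exists
  rw [slope_def_field, hβ, sub_zero] at hy1
  have := hu y hy2
  have h6 : u y / (y - β) < 0 := div_neg_of_pos_of_neg this (by linarith [hy2.2])
  linarith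

/-- Sturm comparison with `sin ((r - α) / 2)`, which solves the equation with `Q = 1/4` and has
half-period `2π`. The Wronskian would increase, yet it equals `u/2 > 0` at the left end and `-u/2 <
0` at the right end. -/
theorem sturm_exists {u u1 Q : ℝ → ℝ} {α : ℝ}
    (h1 : ∀ r ∈ Icc α (α + 2 * Real.pi), HasDerivAt u (u1 r) r)
    (h2 : ∀ r ∈ Icc α (α + 2 * Real.pi), HasDerivAt u1 (-(Q r * u r)) r)
    (hQ : ∀ r ∈ Icc α (α + 2 * Real.pi), 1 / 4 < Q r)
    (hu : ∀ r ∈ Icc α (α + 2 * Real.pi), 0 < u r) : False := by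
  have hπ := Real.pi_pos
  have hle : α < α + 2 * Real.pi := by linarith
  set W : ℝ → ℝ := fun r => u r * (Real.cos ((r - α) / 2) / 2) - u1 r * Real.sin ((r - α) / 2)
  have hW : ∀ r ∈ Icc α (α + 2 * Real.pi),
      HasDerivAt W ((Q r - 1 / 4) * u r * Real.sin ((r - α) / 2)) r := by
    intro r hr
    have hs : HasDerivAt (fun r => (r - α) / 2) (1 / 2) r :=
      ((hasDerivAt_id r).sub_const α).div_const 2
    refine (((h1 r hr).mul (hs.cos.div_const 2)).sub ((h2 r hr).mul hs.sin)).congr_deriv ?_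
    ring
  have hmono : StrictMonoOn W (Icc α (α + 2 * Real.pi)) := by
    refine strictMonoOn_of_deriv_pos (convex_Icc _ _)
      (fun r hr => (hW r hr).continuousAt.continuousWithinAt) ?_
    rw [interior_Icc]
    intro r hr
    have hr' := Ioo_subset_Icc_self hr
    rw [(hW r hr').deriv]
    have s : 0 < Real.sin ((r - α) / 2) :=
      Real.sin_pos_of_pos_of_lt_pi (by linarith [hr.1]) (by linarith [hr.2])
    have := hu r hr'
    have : 0 < Q r - 1 / 4 := by linarith [hQ r hr']
    positivity
  have h3 := hmono (left_mem_Icc.2 hle.le) (right_mem_Icc.2 hle.le) hle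
  have e : (α + 2 * Real.pi - α) / 2 = Real.pi := by ring
  simp only [W, sub_self, zero_div, Real.cos_zero, Real.sin_zero, e, Real.cos_pi, Real.sin_pi,
    mul_zero, sub_zero] at h3
  linarith [hu _ (left_mem_Icc.2 hle.le), hu _ (right_mem_Icc.2 hle.le)]

/-! ### Zeros of Bessel functions -/

/-- The entire factor of `J_p`, as a function of `r`. -/
noncomputable def besselG (p r : ℝ) : ℝ := besselPsi p ((r / 2) ^ 2)

theorem besselJ_eq_zero_iff {p r : ℝ} (hr : 0 < r) : besselJ p r = 0 ↔ besselG p r = 0 := by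
  have : (r / 2) ^ p ≠ 0 := (Real.rpow_pos_of_pos (by positivity) p).ne'
  simp [besselJ, besselG, this]

theorem besselG_hasDerivAt {p : ℝ} (hp : 0 ≤ p) (r : ℝ) :
    HasDerivAt (besselG p) (-(r / 2) * besselG (p + 1) r) r := by
  have h : HasDerivAt (fun r : ℝ => (r / 2) ^ 2) (r / 2) r := by
    refine (((hasDerivAt_id r).div_const 2).fun_pow 2).congr_deriv ?_
    simp only [id]
    push_cast
    ring
  refine ((besselPsi_hasDerivAt hp _).comp r h).congr_deriv ?_
  rw [besselG]
  ring

theorem besselG_continuous {p : ℝ} (hp : 0 ≤ p) : Continuous (besselG p) :=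
  continuous_iff_continuousAt.2 fun r => (besselG_hasDerivAt hp r).continuousAt

theorem besselG_zero {p : ℝ} (hp : 0 ≤ p) : 0 < besselG p 0 := by
  simpa [besselG] using besselPsi_zero hp

theorem besselG_ode {p : ℝ} (hp : 0 ≤ p) (r : ℝ) :
    (r / 2) ^ 2 * besselG (p + 1 + 1) r - (p + 1) * besselG (p + 1) r + besselG p r = 0 :=
  besselPsi_ode hp _

/-- The solution `√r J_p(r)` of `u'' + (1 - (p² - 1/4) / r²) u = 0`, up to a factor. -/
noncomputable def besselU (p r : ℝ) : ℝ := r ^ (p + 1 / 2) * besselG p r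

/-- The derivative of `besselU`. -/
noncomputable def besselU' (p r : ℝ) : ℝ :=
  (p + 1 / 2) * r ^ (p - 1 / 2) * besselG p r - r ^ (p + 3 / 2) / 2 * besselG (p + 1) r

theorem rpow_shift {r : ℝ} (hr : 0 < r) (p : ℝ) :
    r ^ (p + 3 / 2) = r ^ (p - 3 / 2) * r ^ 3 ∧ r ^ (p + 1 / 2) = r ^ (p - 3 / 2) * r ^ 2 ∧
      r ^ (p - 1 / 2) = r ^ (p - 3 / 2) * r := by
  refine ⟨?_, ?_, ?_⟩
  · rw [← Real.rpow_natCast, ← Real.rpow_add hr]; norm_num; ring_nf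
  · rw [← Real.rpow_natCast, ← Real.rpow_add hr]; norm_num; ring_nf
  · rw [← Real.rpow_add_one hr.ne']; ring_nf

theorem besselU_hasDerivAt {p : ℝ} (hp : 0 ≤ p) {r : ℝ} (hr : 0 < r) :
    HasDerivAt (besselU p) (besselU' p r) r := by
  have h1 := Real.hasDerivAt_rpow_const (x := r) (p := p + 1 / 2) (Or.inl hr.ne')
  refine (h1.mul (besselG_hasDerivAt hp r)).congr_deriv ?_
  obtain ⟨e1, e2, e3⟩ := rpow_shift hr p
  rw [besselU', show p + 1 / 2 - 1 = p - 1 / 2 by ring, e1, e2, e3]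
  ring

theorem besselU'_hasDerivAt {p : ℝ} (hp : 0 ≤ p) {r : ℝ} (hr : 0 < r) :
    HasDerivAt (besselU' p) (-((1 - (p ^ 2 - 1 / 4) / r ^ 2) * besselU p r)) r := by
  have h1 := (Real.hasDerivAt_rpow_const (x := r) (p := p - 1 / 2) (Or.inl hr.ne')).const_mul
    (p + 1 / 2)
  have h2 := (Real.hasDerivAt_rpow_const (x := r) (p := p + 3 / 2) (Or.inl hr.ne')).div_const 2
  refine ((h1.mul (besselG_hasDerivAt hp r)).sub
    (h2.mul (besselG_hasDerivAt (p := p + 1) (by linarith) r))).congr_deriv ?_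
  obtain ⟨e1, e2, e3⟩ := rpow_shift hr p
  have ode := besselG_ode hp r
  have h3 : besselG p r = (p + 1) * besselG (p + 1) r - (r / 2) ^ 2 * besselG (p + 1 + 1) r := by
    linarith
  rw [besselU, h3, show p - 1 / 2 - 1 = p - 3 / 2 by ring, show p + 3 / 2 - 1 = p + 1 / 2 by ring,
    e1, e2, e3]
  field_simp
  ring

theorem besselU_eq_zero_iff {p r : ℝ} (hr : 0 < r) : besselU p r = 0 ↔ besselG p r = 0 := by
  have : r ^ (p + 1 / 2) ≠ 0 := (Real.rpow_pos_of_pos hr _).ne'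
  rw [besselU, mul_eq_zero, or_iff_right this]

theorem sign_const {f : ℝ → ℝ} {s : Set ℝ} (hs : s.OrdConnected) (hf : ContinuousOn f s)
    (h0 : ∀ r ∈ s, f r ≠ 0) : (∀ r ∈ s, 0 < f r) ∨ ∀ r ∈ s, 0 < -f r := by
  by_contra! h
  obtain ⟨⟨x, hx, hfx⟩, y, hy, hfy⟩ := h
  have h1 := hs.isPreconnected.intermediate_value hx hy hf
  obtain ⟨r, hr, hr0⟩ := h1 ⟨hfx, by linarith⟩
  exact h0 r hr hr0

/-- For `p > 1/2` the potential `1 - (p² - 1/4) / r²` is below 1, so `sturm_gap` applies to `√r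
J_p(r)` or its negative. This spacing yields the lower bound for the zeros. -/
theorem besselG_gap {p : ℝ} (hp : 1 / 2 < p) {α β : ℝ} (hα : 0 < α) (hαβ : α < β)
    (h1 : besselG p α = 0) (h2 : besselG p β = 0) (h3 : ∀ r ∈ Ioo α β, besselG p r ≠ 0) :
    Real.pi ≤ β - α := by
  have hp0 : 0 ≤ p := by linarith
  have hpos : ∀ r ∈ Icc α β, 0 < r := fun r hr => hα.trans_le hr.1
  have hQ : ∀ r ∈ Icc α β, 1 - (p ^ 2 - 1 / 4) / r ^ 2 < 1 := by
    intro r hr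
    have := hpos r hr
    have : 0 < (p ^ 2 - 1 / 4) / r ^ 2 := div_pos (by nlinarith) (by positivity)
    linarith
  have d1 : ∀ r ∈ Icc α β, HasDerivAt (besselU p) (besselU' p r) r :=
    fun r hr => besselU_hasDerivAt hp0 (hpos r hr)
  have d2 : ∀ r ∈ Icc α β, HasDerivAt (besselU' p)
      (-((1 - (p ^ 2 - 1 / 4) / r ^ 2) * besselU p r)) r :=
    fun r hr => besselU'_hasDerivAt hp0 (hpos r hr)
  have z1 := (besselU_eq_zero_iff hα).2 h1
  have z2 := (besselU_eq_zero_iff (hα.trans hαβ)).2 h2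
  rcases sign_const (f := besselU p) (s := Ioo α β) ordConnected_Ioo
    (fun r hr => (d1 r (Ioo_subset_Icc_self hr)).continuousAt.continuousWithinAt)
    (fun r hr h => h3 r hr ((besselU_eq_zero_iff (hα.trans hr.1)).1 h)) with hs | hs
  · exact sturm_gap hαβ d1 d2 hQ z1 z2 hs
  · refine sturm_gap hαβ (fun r hr => (d1 r hr).neg)
      (fun r hr => ((d2 r hr).neg).congr_deriv ?_) hQ (by simp [z1]) (by simp [z2]) hs
    simp

/-- Beyond `2p + 1` the potential exceeds `1/4`, so `√r J_p(r)` cannot keep its sign over a length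
of `2π`. This yields the upper bound for the zeros. -/
theorem besselG_exists_zero {p : ℝ} (hp : 0 ≤ p) {α : ℝ} (hα : 2 * p + 1 ≤ α) :
    ∃ r ∈ Icc α (α + 2 * Real.pi), besselG p r = 0 := by
  by_contra! h
  have hpos : ∀ r ∈ Icc α (α + 2 * Real.pi), 0 < r := fun r hr => by linarith [hr.1]
  have hQ : ∀ r ∈ Icc α (α + 2 * Real.pi), 1 / 4 < 1 - (p ^ 2 - 1 / 4) / r ^ 2 := by
    intro r hr
    have h0 := hpos r hr
    have h2 : (p ^ 2 - 1 / 4) / r ^ 2 < 3 / 4 := by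
      rw [div_lt_iff₀ (by positivity)]
      have := hr.1
      nlinarith
    linarith
  have d1 : ∀ r ∈ Icc α (α + 2 * Real.pi), HasDerivAt (besselU p) (besselU' p r) r :=
    fun r hr => besselU_hasDerivAt hp (hpos r hr)
  have d2 : ∀ r ∈ Icc α (α + 2 * Real.pi), HasDerivAt (besselU' p)
      (-((1 - (p ^ 2 - 1 / 4) / r ^ 2) * besselU p r)) r :=
    fun r hr => besselU'_hasDerivAt hp (hpos r hr)
  rcases sign_const (f := besselU p) ordConnected_Icc
    (fun r hr => (d1 r hr).continuousAt.continuousWithinAt)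
    (fun r hr h' => h r hr ((besselU_eq_zero_iff (hpos r hr)).1 h')) with hs | hs
  · exact sturm_exists d1 d2 hQ hs
  · refine sturm_exists (fun r hr => (d1 r hr).neg)
      (fun r hr => ((d2 r hr).neg).congr_deriv ?_) hQ hs
    simp

theorem besselG_isolated {p : ℝ} (hp : 0 ≤ p) {α : ℝ} (hα : 0 ≤ α) :
    ∃ δ > 0, ∀ r ∈ Ioo α (α + δ), besselG p r ≠ 0 := by
  have key : ∀ᶠ r in 𝓝[>] α, besselG p r ≠ 0 := by
    by_cases h : besselG p α = 0
    · have h0 : α ≠ 0 := by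
        rintro rfl
        exact (besselG_zero hp).ne' h
      have hpos : 0 < α := lt_of_le_of_ne hα h0.symm
      have h1 := besselPsi_simple hp (z := (α / 2) ^ 2) (by positivity) h
      have h2 : -(α / 2) * besselG (p + 1) α ≠ 0 :=
        mul_ne_zero (by linarith) h1
      have h3 := (besselG_hasDerivAt hp α).eventually_ne (c := 0) h2
      exact h3.filter_mono (nhdsWithin_mono α fun y (hy : α < y) => hy.ne')
    · exact ((besselG_continuous hp).continuousAt.eventually_ne h).filter_mono nhdsWithin_le_nhds
  obtain ⟨u, hu, hsub⟩ := mem_nhdsGT_iff_exists_Ioo_subset.1 key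
  exact ⟨u - α, sub_pos.2 hu, fun r hr => hsub ⟨hr.1, by linarith [hr.2]⟩⟩

/-- The infimum that defines the next zero is a genuine minimum: further zeros exist, the zero set
is closed, and zeros do not accumulate at `α` from the right. -/
theorem besselG_next {p : ℝ} (hp : 0 ≤ p) {α : ℝ} (hα : 0 ≤ α) :
    α < sInf {r : ℝ | α < r ∧ besselJ p r = 0} ∧
      besselG p (sInf {r : ℝ | α < r ∧ besselJ p r = 0}) = 0 ∧
      ∀ r, α < r → besselG p r = 0 → sInf {r : ℝ | α < r ∧ besselJ p r = 0} ≤ r := by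
  have hS : {r : ℝ | α < r ∧ besselJ p r = 0} = {r : ℝ | α < r ∧ besselG p r = 0} := by
    ext r
    exact and_congr_right fun h => besselJ_eq_zero_iff (hα.trans_lt h)
  rw [hS]
  set S := {r : ℝ | α < r ∧ besselG p r = 0} with hSdef
  have hbdd : BddBelow S := ⟨α, fun r hr => hr.1.le⟩
  have hne : S.Nonempty := by
    obtain ⟨r, hr, hr0⟩ := besselG_exists_zero hp (le_max_left (2 * p + 1) (α + 1))
    exact ⟨r, by linarith [hr.1, le_max_right (2 * p + 1) (α + 1)], hr0⟩
  obtain ⟨δ, hδ, hiso⟩ := besselG_isolated hp hα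
  refine ⟨?_, ?_, fun r h1 h2 => csInf_le hbdd ⟨h1, h2⟩⟩
  · refine (lt_add_of_pos_right α hδ).trans_le (le_csInf hne fun r hr => ?_)
    by_contra! hlt
    exact hiso r ⟨hr.1, hlt⟩ hr.2
  · have hcl : IsClosed {r : ℝ | besselG p r = 0} :=
      isClosed_eq (besselG_continuous hp) continuous_const
    exact closure_minimal (fun r (hr : r ∈ S) => hr.2) hcl (csInf_mem_closure hne hbdd)

theorem besselZero_nonneg {p : ℝ} (hp : 0 ≤ p) (b : ℕ) : 0 ≤ besselZero p b := by
  induction b with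
  | zero => exact le_rfl
  | succ b ih => exact ih.trans (besselG_next hp ih).1.le

theorem besselZero_lt_succ {p : ℝ} (hp : 0 ≤ p) (b : ℕ) : besselZero p b < besselZero p (b + 1) :=
  (besselG_next hp (besselZero_nonneg hp b)).1

theorem besselZero_strictMono {p : ℝ} (hp : 0 ≤ p) : StrictMono (besselZero p) :=
  strictMono_nat_of_lt_succ (besselZero_lt_succ hp)

theorem besselG_besselZero {p : ℝ} (hp : 0 ≤ p) (b : ℕ) : besselG p (besselZero p (b + 1)) = 0 :=
  (besselG_next hp (besselZero_nonneg hp b)).2.1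

theorem besselZero_succ_le {p : ℝ} (hp : 0 ≤ p) (b : ℕ) {r : ℝ} (h1 : besselZero p b < r)
    (h2 : besselG p r = 0) : besselZero p (b + 1) ≤ r :=
  (besselG_next hp (besselZero_nonneg hp b)).2.2 r h1 h2

theorem besselZero_pos {p : ℝ} (hp : 0 ≤ p) (b : ℕ) : 0 < besselZero p (b + 1) :=
  (besselZero_nonneg hp b).trans_lt (besselZero_lt_succ hp b)

theorem besselZero_gap {p : ℝ} (hp : 1 / 2 < p) (b : ℕ) :
    besselZero p (b + 1) + Real.pi ≤ besselZero p (b + 1 + 1) := by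
  have hp0 : 0 ≤ p := by linarith
  have := besselG_gap hp (besselZero_pos hp0 b) (besselZero_lt_succ hp0 (b + 1))
    (besselG_besselZero hp0 b) (besselG_besselZero hp0 (b + 1)) fun r hr h =>
      absurd (besselZero_succ_le hp0 (b + 1) hr.1 h) (not_le.2 hr.2)
  linarith

theorem besselZero_lower {p : ℝ} (hp : 1 / 2 < p) :
    ∃ c > 0, ∀ b : ℕ, c * b ≤ besselZero p b := by
  have hp0 : 0 ≤ p := by linarith
  refine ⟨min (besselZero p 1) Real.pi, lt_min (besselZero_pos hp0 0) Real.pi_pos, fun b => ?_⟩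
  cases b with
  | zero => simp [besselZero]
  | succ b =>
    induction b with
    | zero => simp
    | succ b ih =>
      have := besselZero_gap hp b
      have h2 := min_le_right (besselZero p 1) Real.pi
      push_cast at ih ⊢
      linarith

theorem besselZero_upper {p : ℝ} (hp : 0 ≤ p) :
    ∃ C > 0, ∀ b : ℕ, 1 ≤ b → besselZero p b ≤ C * b := by
  have hπ := Real.pi_pos
  have key : ∀ b : ℕ, besselZero p b ≤ (2 * p + 1) + (1 + 2 * Real.pi) * b := by
    intro b
    induction b with
    | zero => simp only [besselZero, Nat.cast_zero, mul_zero, add_zero]; linarith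
    | succ b ih =>
      set α := (2 * p + 1) + (1 + 2 * Real.pi) * b + 1 with hα
      have hb : 0 ≤ (1 + 2 * Real.pi) * b := by positivity
      obtain ⟨r, hr, hr0⟩ := besselG_exists_zero hp (α := α) (by linarith)
      have := besselZero_succ_le hp b (r := r) (by linarith [hr.1]) hr0
      have h2 := hr.2
      push_cast
      linarith
  refine ⟨(2 * p + 1) + (1 + 2 * Real.pi), by positivity, fun b hb => (key b).trans ?_⟩
  have hb' : (1 : ℝ) ≤ b := by exact_mod_cast hb
  nlinarith

/-- The enumerated zeros are unbounded, so there is a least index whose zero is at least `r`;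
minimality of the next zero then gives equality. This is what bounds the number of nodes of an
eigenfunction. -/
theorem besselZero_surj {p : ℝ} (hp : 1 / 2 < p) {r : ℝ} (hr : 0 < r) (h : besselG p r = 0) :
    ∃ b, r = besselZero p (b + 1) := by
  have hp0 : 0 ≤ p := by linarith
  obtain ⟨c, hc, hlow⟩ := besselZero_lower hp
  have hex : ∃ n, r ≤ besselZero p n := by
    obtain ⟨n, hn⟩ := exists_nat_ge (r / c)
    refine ⟨n, ?_⟩
    rw [div_le_iff₀ hc] at hn
    linarith [hlow n]
  classical
  have hspec := Nat.find_spec hex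
  rcases hn : Nat.find hex with _ | b
  · rw [hn] at hspec
    simp only [besselZero] at hspec
    linarith
  · rw [hn] at hspec
    have hlt : besselZero p b < r := by
      have := Nat.find_min hex (m := b) (by omega)
      exact not_le.1 this
    exact ⟨b, le_antisymm hspec (besselZero_succ_le hp0 b hlt h)⟩

/-! ### The Fourier–Bessel system -/

theorem eigMu_strictMono {M : ℝ} (hM : 2 ≤ M) : StrictMono (eigMu M) := by
  intro a b hab
  have hp : 0 ≤ M / 2 - 1 := by linarith
  have := besselZero_strictMono hp hab
  have h0 := besselZero_nonneg hp a
  unfold eigMu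
  gcongr

theorem eigMu_pos {M : ℝ} (hM : 2 ≤ M) (b : ℕ) : 0 < eigMu M (b + 1) := by
  have := besselZero_pos (p := M / 2 - 1) (by linarith) b
  unfold eigMu
  positivity

theorem eigMu_lower {M : ℝ} (hM : 5 ≤ M) : ∃ c > 0, ∀ b : ℕ, c * (b : ℝ) ^ 2 ≤ eigMu M b := by
  obtain ⟨c, hc, h⟩ := besselZero_lower (p := M / 2 - 1) (by linarith)
  refine ⟨c ^ 2 / 4, by positivity, fun b => ?_⟩
  have h1 : (c * b) ^ 2 ≤ besselZero (M / 2 - 1) b ^ 2 := by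
    have := h b
    gcongr
  rw [eigMu, div_pow]
  nlinarith

theorem eigMu_upper {M : ℝ} (hM : 5 ≤ M) :
    ∃ C > 0, ∀ b : ℕ, 1 ≤ b → eigMu M b ≤ C * (b : ℝ) ^ 2 := by
  obtain ⟨C, hC, h⟩ := besselZero_upper (p := M / 2 - 1) (by linarith)
  refine ⟨C ^ 2 / 4, by positivity, fun b hb => ?_⟩
  have h1 : besselZero (M / 2 - 1) b ^ 2 ≤ (C * b) ^ 2 := by
    have := h b hb
    have h0 := besselZero_nonneg (p := M / 2 - 1) (by linarith) b
    gcongr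
  rw [eigMu, div_pow]
  nlinarith

theorem besselPsi_eigMu {M : ℝ} (hM : 2 ≤ M) (b : ℕ) :
    besselPsi (M / 2 - 1) (eigMu M (b + 1)) = 0 :=
  besselG_besselZero (p := M / 2 - 1) (by linarith) b

theorem besselPsi_zero_eq {M : ℝ} (hM : 5 ≤ M) {y : ℝ} (hy : 0 < y)
    (h : besselPsi (M / 2 - 1) y = 0) : ∃ b, y = eigMu M (b + 1) := by
  have e : (2 * √y / 2) ^ 2 = y := by
    rw [mul_div_cancel_left₀ _ two_ne_zero, Real.sq_sqrt hy.le]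
  obtain ⟨b, hb⟩ := besselZero_surj (p := M / 2 - 1) (r := 2 * √y) (by linarith)
    (by have := Real.sqrt_pos.2 hy; positivity) (by rw [besselG, e, h])
  exact ⟨b, by rw [eigMu, ← hb, e]⟩

/-- The norm of `besselPsi` at the eigenvalue. -/
noncomputable def psiNorm (M : ℝ) (b : ℕ) : ℝ :=
  √(∫ s in (0 : ℝ)..1, besselPsi (M / 2 - 1) (eigMu M b * s) ^ 2 * s ^ (M / 2 - 1))

theorem psi_eq (M : ℝ) (b : ℕ) (x : ℝ) :
    psi M b x = besselPsi (M / 2 - 1) (eigMu M b * x) / psiNorm M b := rfl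

theorem psiNorm_integral_pos {M : ℝ} (hM : 5 ≤ M) (b : ℕ) :
    0 < ∫ s in (0 : ℝ)..1, besselPsi (M / 2 - 1) (eigMu M b * s) ^ 2 * s ^ (M / 2 - 1) := by
  have hp : 0 ≤ M / 2 - 1 := by linarith
  have c0 := besselPsi_continuous hp
  have cr : Continuous fun y : ℝ => y ^ (M / 2 - 1) := Real.continuous_rpow_const hp
  have hev : ∀ᶠ y in 𝓝[>] (0 : ℝ), 0 < besselPsi (M / 2 - 1) (eigMu M b * y) := by
    have hc : Continuous fun y => besselPsi (M / 2 - 1) (eigMu M b * y) := by fun_prop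
    refine (hc.continuousAt.eventually (lt_mem_nhds ?_)).filter_mono nhdsWithin_le_nhds
    simpa using besselPsi_zero hp
  obtain ⟨y, hy1, hy2⟩ := (hev.and (Ioo_mem_nhdsGT one_pos)).exists
  refine intervalIntegral.integral_pos one_pos (Continuous.continuousOn (by fun_prop))
    (fun x hx => mul_nonneg (sq_nonneg _) (Real.rpow_nonneg hx.1.le _)) ⟨y, ⟨hy2.1.le, hy2.2.le⟩, ?_⟩
  have := Real.rpow_pos_of_pos hy2.1 (M / 2 - 1)
  positivity

theorem psiNorm_pos {M : ℝ} (hM : 5 ≤ M) (b : ℕ) : 0 < psiNorm M b :=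
  Real.sqrt_pos.2 (psiNorm_integral_pos hM b)

/-- The derivative of `psi M b`. -/
noncomputable def psi' (M : ℝ) (b : ℕ) (x : ℝ) : ℝ :=
  -(eigMu M b * besselPsi (M / 2 - 1 + 1) (eigMu M b * x)) / psiNorm M b

theorem psi_contDiff {M : ℝ} (hM : 2 ≤ M) (b : ℕ) : ContDiff ℝ ∞ (psi M b) := by
  have := besselPsi_contDiff (p := M / 2 - 1) (by linarith)
  unfold psi
  exact (this.comp (contDiff_const.mul contDiff_id)).div_const _

/-- Zeros of `Ψ(μ_{n+1} x)` in `]0,1[` are the points `μ_{j+1} / μ_{n+1}` with `j < n`, by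
completeness of the list of Bessel zeros. At the left end `p(x) = x^(M/2)` vanishes, so the boundary
condition there is void. Correspondingly, the eigenfunctions are nonzero at 0. -/
theorem psi_system {M : ℝ} (hM : 5 ≤ M) :
    SturmSystem 0 1 (fun x => x ^ (M / 2)) (fun x => x ^ (M / 2 - 1)) (fun n => psi M (n + 1))
      (fun n => psi' M (n + 1)) (fun n => eigMu M (n + 1))
      (fun n j => eigMu M (j + 1) / eigMu M (n + 1)) := by
  have hp : 0 ≤ M / 2 - 1 := by linarith
  have hp' : 0 ≤ M / 2 - 1 + 1 := by linarith
  have hM2 : (2 : ℝ) ≤ M := by linarith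
  refine
  { lt := one_pos
    contp := (Real.continuous_rpow_const (by linarith)).continuousOn
    contw := (Real.continuous_rpow_const hp).continuousOn
    p_pos := fun x hx => Real.rpow_pos_of_pos hx.1 _
    w_pos := fun x hx => Real.rpow_pos_of_pos hx.1 _
    deriv := fun n x => ?_
    contd := fun n => ?_
    eigen := fun n x hx => ?_
    right := fun n => ?_
    left := fun n => ?_
    left' := fun n h => ?_
    simple := fun n x hx h => ?_
    mem_nodes := fun n j => ?_
    nodes := fun n x hx h => ?_
    unit := fun n => ?_
    mono := fun a b hab => eigMu_strictMono hM2 (by omega)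
    pos := fun n => eigMu_pos hM2 n }
  · refine (((besselPsi_hasDerivAt hp (eigMu M (n + 1) * x)).comp x
      ((hasDerivAt_id x).const_mul (eigMu M (n + 1)))).div_const
      (psiNorm M (n + 1))).congr_deriv ?_
    rw [psi']
    ring
  · have := besselPsi_continuous hp'
    unfold psi'
    fun_prop
  · have h := (besselPsi_weighted hp (eigMu M (n + 1)) hx.1).div_const (psiNorm M (n + 1))
    rw [sub_add_cancel] at h
    refine (h.congr_of_eventuallyEq (Eventually.of_forall fun y => ?_)).congr_deriv ?_
    · simp only [psi', sub_add_cancel, mul_div_assoc]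
    · rw [psi_eq]; ring
  · rw [psi_eq, mul_one, besselPsi_eigMu hM2, zero_div]
  · rw [Real.zero_rpow (by linarith), zero_mul]
  · rw [psi_eq, mul_zero] at h
    exact absurd h (div_pos (besselPsi_zero hp) (psiNorm_pos hM _)).ne'
  · have hN := (psiNorm_pos hM (n + 1)).ne'
    have h0 : besselPsi (M / 2 - 1) (eigMu M (n + 1) * x) = 0 := by
      rw [psi_eq, div_eq_zero_iff] at h
      exact h.resolve_right hN
    have hx0 : 0 < x := by
      rcases hx.1.eq_or_lt with rfl | h'
      · rw [mul_zero] at h0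
        exact absurd h0 (besselPsi_zero hp).ne'
      · exact h'
    have hm := eigMu_pos hM2 n
    have := besselPsi_simple hp (mul_pos hm hx0) h0
    rw [psi']
    exact div_ne_zero (neg_ne_zero.2 (mul_ne_zero hm.ne' this)) hN
  · have h1 := eigMu_pos hM2 j
    have h2 := eigMu_pos hM2 n
    have h3 : eigMu M (j + 1) < eigMu M (n + 1) := eigMu_strictMono hM2 (by have := j.2; omega)
    exact ⟨by positivity, (div_lt_one h2).2 h3⟩
  · have hN := (psiNorm_pos hM (n + 1)).ne'
    have hm := eigMu_pos hM2 n
    have h0 : besselPsi (M / 2 - 1) (eigMu M (n + 1) * x) = 0 := by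
      rw [psi_eq, div_eq_zero_iff] at h
      exact h.resolve_right hN
    obtain ⟨b, hb⟩ := besselPsi_zero_eq hM (mul_pos hm hx.1) h0
    have hlt : eigMu M (b + 1) < eigMu M (n + 1) := by
      rw [← hb]
      exact mul_lt_of_lt_one_right hm hx.2
    have := (eigMu_strictMono hM2).lt_iff_lt.1 hlt
    refine ⟨⟨b, by omega⟩, ?_⟩
    simp only [← hb]
    field_simp
  · have hI := psiNorm_integral_pos hM (n + 1)
    have hsq : psiNorm M (n + 1) ^ 2 = _ := Real.sq_sqrt hI.le
    have : ∀ x, psi M (n + 1) x * psi M (n + 1) x * x ^ (M / 2 - 1) =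
        (psiNorm M (n + 1) ^ 2)⁻¹ *
          (besselPsi (M / 2 - 1) (eigMu M (n + 1) * x) ^ 2 * x ^ (M / 2 - 1)) := by
      intro x
      rw [psi_eq]
      field_simp
    simp only [this]
    rw [intervalIntegral.integral_const_mul, hsq]
    exact inv_mul_cancel₀ hI.ne'

theorem eigMu_tendsto {M : ℝ} (hM : 5 ≤ M) :
    Tendsto (fun n : ℕ => eigMu M (n + 1)) atTop atTop := by
  obtain ⟨c, hc, h⟩ := eigMu_lower hM
  have h1 : Tendsto (fun b : ℕ => c * (b : ℝ) ^ 2) atTop atTop :=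
    ((tendsto_pow_atTop two_ne_zero).comp tendsto_natCast_atTop_atTop).const_mul_atTop hc
  exact (tendsto_atTop_mono h h1).comp (tendsto_add_atTop_nat 1)

/-! ### The sine system -/

/-- The derivative of `phi T a`. -/
noncomputable def phi' (T : ℝ) (a : ℕ) (t : ℝ) : ℝ :=
  1 / √(2 * T) * (Real.cos (a * Real.pi * (t + 2 * T) / (4 * T)) * (a * Real.pi / (4 * T)))

theorem phi_hasDerivAt (T : ℝ) (a : ℕ) (t : ℝ) : HasDerivAt (phi T a) (phi' T a t) t := by
  have h : HasDerivAt (fun t => a * Real.pi * (t + 2 * T) / (4 * T)) (a * Real.pi / (4 * T)) t := by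
    have := (((hasDerivAt_id t).add_const (2 * T)).const_mul (a * Real.pi)).div_const (4 * T)
    simpa using this
  exact (h.sin).const_mul _

theorem phi'_hasDerivAt (T : ℝ) (a : ℕ) (t : ℝ) :
    HasDerivAt (phi' T a) (-((a * Real.pi / (4 * T)) ^ 2 * phi T a t)) t := by
  have h : HasDerivAt (fun t => a * Real.pi * (t + 2 * T) / (4 * T)) (a * Real.pi / (4 * T)) t := by
    have := (((hasDerivAt_id t).add_const (2 * T)).const_mul (a * Real.pi)).div_const (4 * T)
    simpa using this
  refine (((h.cos).mul_const (a * Real.pi / (4 * T))).const_mul (1 / √(2 * T))).congr_deriv ?_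
  rw [phi]
  ring

/-- Here `p = w = 1`, and the left condition is a true Dirichlet condition. The nodes divide `]-2T,
2T[` into `n + 1` equal parts. -/
theorem phi_system {T : ℝ} (hT : 0 < T) :
    SturmSystem (-(2 * T)) (2 * T) (fun _ => 1) (fun _ => 1) (fun n => phi T (n + 1))
      (fun n => phi' T (n + 1)) (fun n => (((n + 1 : ℕ) : ℝ) * Real.pi / (4 * T)) ^ 2)
      (fun n j => 4 * T * (j + 1) / (n + 1) - 2 * T) := by
  have hπ := Real.pi_pos
  have hs : 0 < 1 / √(2 * T) := by have := Real.sqrt_pos.2 (show 0 < 2 * T by linarith); positivity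
  have hsin : ∀ n t, phi T n t = 0 → Real.sin (n * Real.pi * (t + 2 * T) / (4 * T)) = 0 :=
    fun n t h => (mul_eq_zero.1 h).resolve_left hs.ne'
  refine
  { lt := by linarith
    contp := continuousOn_const
    contw := continuousOn_const
    p_pos := fun x hx => one_pos
    w_pos := fun x hx => one_pos
    deriv := fun n x => phi_hasDerivAt T _ x
    contd := fun n => ?_
    eigen := fun n x hx => ?_
    right := fun n => ?_
    left := fun n => ?_
    left' := fun n h => one_ne_zero
    simple := fun n x hx h => ?_
    mem_nodes := fun n j => ?_
    nodes := fun n x hx h => ?_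
    unit := fun n => ?_
    mono := fun a b hab => ?_
    pos := fun n => by positivity }
  · unfold phi'; fun_prop
  · simpa using phi'_hasDerivAt T (n + 1) x
  · have : ((n + 1 : ℕ) : ℝ) * Real.pi * (2 * T + 2 * T) / (4 * T) = (n + 1 : ℕ) * Real.pi := by
      field_simp; ring
    rw [phi, this, Real.sin_nat_mul_pi, mul_zero]
  · simp [phi]
  · have h1 := hsin _ _ h
    rw [phi']
    have h2 : Real.cos (((n + 1 : ℕ) : ℝ) * Real.pi * (x + 2 * T) / (4 * T)) ≠ 0 := by
      intro h3
      have := Real.sin_sq_add_cos_sq (((n + 1 : ℕ) : ℝ) * Real.pi * (x + 2 * T) / (4 * T))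
      rw [h1, h3] at this
      norm_num at this
    have h3 : ((n + 1 : ℕ) : ℝ) * Real.pi / (4 * T) ≠ 0 := by positivity
    exact mul_ne_zero hs.ne' (mul_ne_zero h2 h3)
  · have hj : ((j : ℕ) : ℝ) + 1 < n + 1 := by exact_mod_cast Nat.succ_lt_succ j.2
    have h1 : 0 < 4 * T * ((j : ℕ) + 1) / ((n : ℝ) + 1) := by positivity
    have h2 : 4 * T * ((j : ℕ) + 1) / ((n : ℝ) + 1) < 4 * T := by
      rw [div_lt_iff₀ (by positivity)]
      exact mul_lt_mul_of_pos_left hj (by linarith)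
    exact ⟨by linarith, by linarith⟩
  · obtain ⟨k, hk⟩ := Real.sin_eq_zero_iff.1 (hsin _ _ h)
    have hk' : (k : ℝ) * (4 * T) = (n + 1) * (x + 2 * T) := by
      push_cast at hk
      field_simp at hk
      linarith
    have hk0 : 0 < k := by
      have : (0 : ℝ) < k := by
        by_contra! hneg
        have h1 : 0 < ((n : ℝ) + 1) * (x + 2 * T) := mul_pos (by positivity) (by linarith [hx.1])
        nlinarith
      exact_mod_cast this
    have hkn : k < n + 1 := by
      have : (k : ℝ) < n + 1 := by
        have h1 : ((n : ℝ) + 1) * (x + 2 * T) < (n + 1) * (4 * T) :=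
          mul_lt_mul_of_pos_left (by linarith [hx.2]) (by positivity)
        rw [← hk'] at h1
        exact lt_of_mul_lt_mul_right h1 (by linarith)
      exact_mod_cast this
    -- The sine vanishes at multiples `k π` with `0 < k < n + 1`, whereas nodes are numbered from 0.
    obtain ⟨j, rfl⟩ : ∃ j : ℕ, k = j + 1 := ⟨(k - 1).toNat, by omega⟩
    refine ⟨⟨j, by omega⟩, ?_⟩
    push_cast at hk'
    simp only
    field_simp
    linarith
  · have h1 : ∀ t, phi T (n + 1) t * phi T (n + 1) t * 1 =
        (1 / (2 * T)) * (1 / 2 - Real.cos (2 * (((n + 1 : ℕ) : ℝ) * Real.pi * (t + 2 * T) / (4 * T)))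
          / 2) := by
      intro t
      have h2 : 1 / (2 * T) = (1 / √(2 * T)) ^ 2 := by
        rw [div_pow, Real.sq_sqrt (by linarith), one_pow]
      rw [phi, ← Real.sin_sq_eq_half_sub, h2]
      ring
    have hd : ∀ t, HasDerivAt (fun t => (1 / (2 * T)) * (t / 2 -
        Real.sin (2 * (((n + 1 : ℕ) : ℝ) * Real.pi * (t + 2 * T) / (4 * T))) /
          (2 * (2 * (((n + 1 : ℕ) : ℝ) * Real.pi / (4 * T))))))
        (phi T (n + 1) t * phi T (n + 1) t * 1) t := by
      intro t
      have h : HasDerivAt (fun t => 2 * (((n + 1 : ℕ) : ℝ) * Real.pi * (t + 2 * T) / (4 * T)))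
          (2 * (((n + 1 : ℕ) : ℝ) * Real.pi / (4 * T))) t := by
        have := ((((hasDerivAt_id t).add_const (2 * T)).const_mul
          (((n + 1 : ℕ) : ℝ) * Real.pi)).div_const (4 * T)).const_mul 2
        simpa using this
      rw [h1]
      refine ((((hasDerivAt_id t).div_const 2).sub (h.sin.div_const _)).const_mul _).congr_deriv ?_
      have : ((n + 1 : ℕ) : ℝ) ≠ 0 := by positivity
      field_simp
    have hc : Continuous (phi T (n + 1)) := by unfold phi; fun_prop
    rw [intervalIntegral.integral_eq_sub_of_hasDerivAt (fun t _ => hd t)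
      (Continuous.intervalIntegrable (by fun_prop) _ _)]
    have e1 : 2 * (((n + 1 : ℕ) : ℝ) * Real.pi * (2 * T + 2 * T) / (4 * T)) =
        ((2 * (n + 1) : ℕ) : ℝ) * Real.pi := by
      push_cast; field_simp; ring
    rw [e1, Real.sin_nat_mul_pi, neg_add_cancel]
    simp
    field_simp
    ring
  · have : (a : ℝ) < b := by exact_mod_cast hab
    simp only
    push_cast
    gcongr

theorem timeEig_tendsto {T : ℝ} (hT : 0 < T) :
    Tendsto (fun n : ℕ => (((n + 1 : ℕ) : ℝ) * Real.pi / (4 * T)) ^ 2) atTop atTop := by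
  have hπ := Real.pi_pos
  refine (tendsto_pow_atTop two_ne_zero).comp ?_
  refine Tendsto.atTop_div_const (by linarith) (Tendsto.atTop_mul_const hπ ?_)
  exact tendsto_natCast_atTop_atTop.comp (tendsto_add_atTop_nat 1)

/-! ### Smooth functions of two variables and their partial derivatives -/

/-- `G` is smooth on the set `s` as a function of two variables. -/
def SmoothOn (s : Set (ℝ × ℝ)) (G : ℝ → ℝ → ℝ) : Prop :=
  ContDiffOn ℝ ∞ (fun p : ℝ × ℝ => G p.1 p.2) s

/-- The partial derivative in the first variable, within `A`. -/
noncomputable def pdt (A : Set ℝ) (G : ℝ → ℝ → ℝ) (t x : ℝ) : ℝ :=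
  derivWithin (fun r => G r x) A t

/-- The partial derivative in the second variable, within `B`. -/
noncomputable def pdx (B : Set ℝ) (G : ℝ → ℝ → ℝ) (t x : ℝ) : ℝ := derivWithin (G t) B x

namespace SmoothOn

variable {A B : Set ℝ} {G : ℝ → ℝ → ℝ}

theorem hasDerivWithinAt_fst (h : SmoothOn (A ×ˢ B) G) {t x : ℝ} (ht : t ∈ A) (hx : x ∈ B) :
    HasDerivWithinAt (fun r => G r x)
      (fderivWithin ℝ (fun p : ℝ × ℝ => G p.1 p.2) (A ×ˢ B) (t, x) (1, 0)) A t := by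
  have h1 := ((h.differentiableOn (by simp)) (t, x) ⟨ht, hx⟩).hasFDerivWithinAt
  have h2 : HasDerivWithinAt (fun r : ℝ => (r, x)) ((1 : ℝ), (0 : ℝ)) A t :=
    (hasDerivWithinAt_id t A).prodMk (hasDerivWithinAt_const t A x)
  exact h1.comp_hasDerivWithinAt t h2 (show MapsTo (fun r : ℝ => (r, x)) A (A ×ˢ B) from
    fun r hr => ⟨hr, hx⟩)

theorem hasDerivWithinAt_snd (h : SmoothOn (A ×ˢ B) G) {t x : ℝ} (ht : t ∈ A) (hx : x ∈ B) :
    HasDerivWithinAt (G t)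
      (fderivWithin ℝ (fun p : ℝ × ℝ => G p.1 p.2) (A ×ˢ B) (t, x) (0, 1)) B x := by
  have h1 := ((h.differentiableOn (by simp)) (t, x) ⟨ht, hx⟩).hasFDerivWithinAt
  have h2 : HasDerivWithinAt (fun r : ℝ => (t, r)) ((0 : ℝ), (1 : ℝ)) B x :=
    (hasDerivWithinAt_const x B t).prodMk (hasDerivWithinAt_id x B)
  exact h1.comp_hasDerivWithinAt x h2 (show MapsTo (fun r : ℝ => (t, r)) B (A ×ˢ B) from
    fun r hr => ⟨ht, hr⟩)

theorem pdt_eq (h : SmoothOn (A ×ˢ B) G) (hA : UniqueDiffOn ℝ A) {t x : ℝ} (ht : t ∈ A)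
    (hx : x ∈ B) : pdt A G t x =
      fderivWithin ℝ (fun p : ℝ × ℝ => G p.1 p.2) (A ×ˢ B) (t, x) (1, 0) :=
  (h.hasDerivWithinAt_fst ht hx).derivWithin (hA t ht)

theorem pdx_eq (h : SmoothOn (A ×ˢ B) G) (hB : UniqueDiffOn ℝ B) {t x : ℝ} (ht : t ∈ A)
    (hx : x ∈ B) : pdx B G t x =
      fderivWithin ℝ (fun p : ℝ × ℝ => G p.1 p.2) (A ×ˢ B) (t, x) (0, 1) :=
  (h.hasDerivWithinAt_snd ht hx).derivWithin (hB x hx)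

theorem hasDerivWithinAt_pdt (h : SmoothOn (A ×ˢ B) G) (hA : UniqueDiffOn ℝ A) {t x : ℝ}
    (ht : t ∈ A) (hx : x ∈ B) : HasDerivWithinAt (fun r => G r x) (pdt A G t x) A t := by
  rw [h.pdt_eq hA ht hx]
  exact h.hasDerivWithinAt_fst ht hx

theorem hasDerivWithinAt_pdx (h : SmoothOn (A ×ˢ B) G) (hB : UniqueDiffOn ℝ B) {t x : ℝ}
    (ht : t ∈ A) (hx : x ∈ B) : HasDerivWithinAt (G t) (pdx B G t x) B x := by
  rw [h.pdx_eq hB ht hx]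
  exact h.hasDerivWithinAt_snd ht hx

theorem pdt (h : SmoothOn (A ×ˢ B) G) (hA : UniqueDiffOn ℝ A) (hB : UniqueDiffOn ℝ B) :
    SmoothOn (A ×ˢ B) (pdt A G) := by
  have h1 : ContDiffOn ℝ ∞ (fderivWithin ℝ (fun p : ℝ × ℝ => G p.1 p.2) (A ×ˢ B)) (A ×ˢ B) :=
    h.fderivWithin (hA.prod hB) (by simp)
  exact (h1.clm_apply contDiffOn_const).congr fun p hp => h.pdt_eq hA hp.1 hp.2

theorem pdx (h : SmoothOn (A ×ˢ B) G) (hA : UniqueDiffOn ℝ A) (hB : UniqueDiffOn ℝ B) :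
    SmoothOn (A ×ˢ B) (pdx B G) := by
  have h1 : ContDiffOn ℝ ∞ (fderivWithin ℝ (fun p : ℝ × ℝ => G p.1 p.2) (A ×ˢ B)) (A ×ˢ B) :=
    h.fderivWithin (hA.prod hB) (by simp)
  exact (h1.clm_apply contDiffOn_const).congr fun p hp => h.pdx_eq hB hp.1 hp.2

theorem add {s : Set (ℝ × ℝ)} {H : ℝ → ℝ → ℝ} (h : SmoothOn s G) (h' : SmoothOn s H) :
    SmoothOn s (fun t x => G t x + H t x) := ContDiffOn.add h h'

theorem sub {s : Set (ℝ × ℝ)} {H : ℝ → ℝ → ℝ} (h : SmoothOn s G) (h' : SmoothOn s H) :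
    SmoothOn s (fun t x => G t x - H t x) := ContDiffOn.sub h h'

theorem mul {s : Set (ℝ × ℝ)} {H : ℝ → ℝ → ℝ} (h : SmoothOn s G) (h' : SmoothOn s H) :
    SmoothOn s (fun t x => G t x * H t x) := ContDiffOn.mul h h'

theorem neg {s : Set (ℝ × ℝ)} (h : SmoothOn s G) :
    SmoothOn s (fun t x => -G t x) := ContDiffOn.neg h

theorem const_mul {s : Set (ℝ × ℝ)} (h : SmoothOn s G) (c : ℝ) :
    SmoothOn s (fun t x => c * G t x) := contDiffOn_const.mul h

theorem of_fst {s : Set (ℝ × ℝ)} {f : ℝ → ℝ} {A : Set ℝ} (hf : ContDiffOn ℝ ∞ f A)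
    (hs : ∀ p ∈ s, p.1 ∈ A) : SmoothOn s (fun t _ => f t) :=
  hf.comp contDiffOn_fst hs

theorem of_snd {s : Set (ℝ × ℝ)} {f : ℝ → ℝ} {A : Set ℝ} (hf : ContDiffOn ℝ ∞ f A)
    (hs : ∀ p ∈ s, p.2 ∈ A) : SmoothOn s (fun _ x => f x) :=
  hf.comp contDiffOn_snd hs

theorem sum {s : Set (ℝ × ℝ)} {ι : Type*} {F : Finset ι} {H : ι → ℝ → ℝ → ℝ}
    (h : ∀ i ∈ F, SmoothOn s (H i)) : SmoothOn s (fun t x => ∑ i ∈ F, H i t x) :=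
  ContDiffOn.sum h

theorem congr {s : Set (ℝ × ℝ)} {H : ℝ → ℝ → ℝ} (h : SmoothOn s G)
    (h' : ∀ p ∈ s, H p.1 p.2 = G p.1 p.2) : SmoothOn s H := ContDiffOn.congr h h'

theorem mono {s s' : Set (ℝ × ℝ)} (h : SmoothOn s G) (h' : s' ⊆ s) : SmoothOn s' G :=
  ContDiffOn.mono h h'

theorem slice_fst (h : SmoothOn (A ×ˢ B) G) {x : ℝ} (hx : x ∈ B) :
    ContDiffOn ℝ ∞ (fun r => G r x) A :=
  ContDiffOn.comp (g := fun p : ℝ × ℝ => G p.1 p.2) (f := fun r : ℝ => (r, x)) h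
    (contDiffOn_id.prodMk contDiffOn_const) fun _ hr => ⟨hr, hx⟩

theorem slice_snd (h : SmoothOn (A ×ˢ B) G) {t : ℝ} (ht : t ∈ A) : ContDiffOn ℝ ∞ (G t) B :=
  ContDiffOn.comp (g := fun p : ℝ × ℝ => G p.1 p.2) (f := fun r : ℝ => (t, r)) h
    (contDiffOn_const.prodMk contDiffOn_id) fun _ hr => ⟨ht, hr⟩

end SmoothOn

theorem lap_eq {M : ℝ} {O : Set ℝ} (hO : IsOpen O) {f f1 f2 : ℝ → ℝ}
    (h1 : ∀ x ∈ O, HasDerivAt f (f1 x) x) (h2 : ∀ x ∈ O, HasDerivAt f1 (f2 x) x) {x : ℝ}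
    (hx : x ∈ O) : lap M f x = x * f2 x + M / 2 * f1 x := by
  have h3 : deriv f =ᶠ[𝓝 x] f1 :=
    Filter.mem_of_superset (hO.mem_nhds hx) fun y hy => (h1 y hy).deriv
  rw [lap, h3.deriv_eq, (h2 x hx).deriv, (h1 x hx).deriv]

theorem deriv2_eq {O : Set ℝ} (hO : IsOpen O) {f f1 f2 : ℝ → ℝ}
    (h1 : ∀ x ∈ O, HasDerivAt f (f1 x) x) (h2 : ∀ x ∈ O, HasDerivAt f1 (f2 x) x) {x : ℝ}
    (hx : x ∈ O) : deriv (deriv f) x = f2 x := by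
  have h3 : deriv f =ᶠ[𝓝 x] f1 :=
    Filter.mem_of_superset (hO.mem_nhds hx) fun y hy => (h1 y hy).deriv
  rw [h3.deriv_eq, (h2 x hx).deriv]

/-! ### Test functions -/

/-- The strip on which extended test functions are smooth. -/
abbrev strip : Set (ℝ × ℝ) := univ ×ˢ Icc 0 1

/-- Test functions, extended by zero. -/
def TestOn (T : ℝ) (G : ℝ → ℝ → ℝ) : Prop :=
  SmoothOn strip G ∧ ∃ K : Set (ℝ × ℝ), IsCompact K ∧
    K ⊆ Ioo (-(2 * T)) (2 * T) ×ˢ Ico 0 1 ∧ ∀ p ∈ strip, p ∉ K → G p.1 p.2 = 0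

/-- The support may touch the edge `x = 0`, but it stays away from the other three edges. Hence the
extension by zero is smooth on the closed strip for all `t`, and one-sided derivatives at `x = 0`
are available. -/
theorem exists_testOn {T : ℝ} {U : ℝ → ℝ → ℝ} (hU : IsTest T U) :
    ∃ G, TestOn T G ∧ ∀ t ∈ Ioo (-(2 * T)) (2 * T), ∀ x ∈ Ico (0 : ℝ) 1, U t x = G t x := by
  classical
  obtain ⟨hs, K, hK, hKR, h0⟩ := hU
  set R : Set (ℝ × ℝ) := Ioo (-(2 * T)) (2 * T) ×ˢ Ico 0 1 with hR
  set G : ℝ → ℝ → ℝ := fun t x => if (t, x) ∈ R then U t x else 0 with hG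
  have hGR : ∀ p ∈ R, G p.1 p.2 = U p.1 p.2 := fun p hp => if_pos hp
  have hG0 : ∀ p, p ∈ strip → p ∉ K → G p.1 p.2 = 0 := by
    intro p _ hp
    by_cases h : p ∈ R
    · rw [hGR p h, h0 p h hp]
    · exact if_neg h
  refine ⟨G, ⟨fun p hp => ?_, K, hK, hKR, hG0⟩, fun t ht x hx => (hGR (t, x) ⟨ht, hx⟩).symm⟩
  by_cases h : p ∈ R
  · have hnhds : R ∈ 𝓝[strip] p := by
      have hopen : Ioo (-(2 * T)) (2 * T) ×ˢ Iio (1 : ℝ) ∈ 𝓝 p :=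
        (isOpen_Ioo.prod isOpen_Iio).mem_nhds ⟨h.1, h.2.2⟩
      refine Filter.mem_of_superset (inter_mem_nhdsWithin strip hopen) ?_
      rintro q ⟨hq1, hq2⟩
      exact ⟨hq2.1, hq1.2.1, hq2.2⟩
    exact (((hs p h).congr hGR (hGR p h)).mono_of_mem_nhdsWithin hnhds)
  · have hp' : p ∉ K := fun h' => h (hKR h')
    have hnhds : Kᶜ ∈ 𝓝 p := hK.isClosed.isOpen_compl.mem_nhds hp'
    have hev : (fun p : ℝ × ℝ => G p.1 p.2) =ᶠ[𝓝[strip] p] fun _ => 0 :=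
      Filter.mem_of_superset (inter_mem_nhdsWithin strip hnhds) fun q hq => hG0 q hq.1 hq.2
    exact contDiffWithinAt_const.congr_of_eventuallyEq hev (hG0 p hp hp')

/-- The operator `x d²/dx² + (M/2) d/dx`, up to the boundary. -/
noncomputable def lapStrip (M : ℝ) (G : ℝ → ℝ → ℝ) (t x : ℝ) : ℝ :=
  x * pdx (Icc 0 1) (pdx (Icc 0 1) G) t x +
    M / 2 * pdx (Icc 0 1) G t x

namespace TestOn

variable {T : ℝ} {G : ℝ → ℝ → ℝ}

theorem uniqueDiffOn_I : UniqueDiffOn ℝ (Icc (0 : ℝ) 1) := uniqueDiffOn_Icc one_pos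

/-- The complement of the support is open, so derivatives vanish there as well. Thus one compact set
serves for both first partial derivatives and test functions are stable under differentiation. -/
theorem zero_of_eventually (h : TestOn T G) : ∃ K : Set (ℝ × ℝ), IsCompact K ∧
    K ⊆ Ioo (-(2 * T)) (2 * T) ×ˢ Ico 0 1 ∧
    ∀ p ∈ strip, p ∉ K → fderivWithin ℝ (fun p : ℝ × ℝ => G p.1 p.2) strip p = 0 := by
  obtain ⟨_, K, hK, hKR, h0⟩ := h
  refine ⟨K, hK, hKR, fun p hp hpK => ?_⟩
  have hnhds : Kᶜ ∈ 𝓝 p := hK.isClosed.isOpen_compl.mem_nhds hpK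
  have hev : (fun p : ℝ × ℝ => G p.1 p.2) =ᶠ[𝓝[strip] p] fun _ => 0 :=
    Filter.mem_of_superset (inter_mem_nhdsWithin strip hnhds) fun q hq => h0 q hq.1 hq.2
  rw [hev.fderivWithin_eq (h0 p hp hpK)]
  simp

theorem pdt (h : TestOn T G) : TestOn T (pdt univ G) := by
  refine ⟨h.1.pdt uniqueDiffOn_univ uniqueDiffOn_I, ?_⟩
  obtain ⟨K, hK, hKR, h0⟩ := h.zero_of_eventually
  refine ⟨K, hK, hKR, fun p hp hpK => ?_⟩
  rw [h.1.pdt_eq uniqueDiffOn_univ hp.1 hp.2, h0 p hp hpK]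
  rfl

theorem pdx (h : TestOn T G) : TestOn T (pdx (Icc 0 1) G) := by
  refine ⟨h.1.pdx uniqueDiffOn_univ uniqueDiffOn_I, ?_⟩
  obtain ⟨K, hK, hKR, h0⟩ := h.zero_of_eventually
  refine ⟨K, hK, hKR, fun p hp hpK => ?_⟩
  rw [h.1.pdx_eq uniqueDiffOn_I hp.1 hp.2, h0 p hp hpK]
  rfl

theorem neg (h : TestOn T G) : TestOn T (fun t x => -G t x) := by
  obtain ⟨h1, K, hK, hKR, h0⟩ := h
  exact ⟨h1.neg, K, hK, hKR, fun p hp hpK => by simp [h0 p hp hpK]⟩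

theorem lap (h : TestOn T G) (M : ℝ) : TestOn T (lapStrip M G) := by
  obtain ⟨h1, K1, hK1, hKR1, h01⟩ := h.pdx
  obtain ⟨h2, K2, hK2, hKR2, h02⟩ := h.pdx.pdx
  refine ⟨((SmoothOn.of_snd contDiffOn_id fun p hp => mem_univ _).mul h2).add (h1.const_mul _),
    K1 ∪ K2, hK1.union hK2, union_subset hKR1 hKR2, fun p hp hpK => ?_⟩
  rw [mem_union, not_or] at hpK
  simp [lapStrip, h01 p hp hpK.1, h02 p hp hpK.2]

theorem right (h : TestOn T G) (t : ℝ) : G t 1 = 0 := by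
  obtain ⟨_, K, _, hKR, h0⟩ := h
  exact h0 (t, 1) ⟨mem_univ _, by simp⟩ fun hp => lt_irrefl _ (hKR hp).2.2

theorem top (h : TestOn T G) {x : ℝ} (hx : x ∈ Icc (0 : ℝ) 1) : G (2 * T) x = 0 := by
  obtain ⟨_, K, _, hKR, h0⟩ := h
  exact h0 (2 * T, x) ⟨mem_univ _, hx⟩ fun hp => lt_irrefl _ (hKR hp).1.2

theorem bot (h : TestOn T G) {x : ℝ} (hx : x ∈ Icc (0 : ℝ) 1) : G (-(2 * T)) x = 0 := by
  obtain ⟨_, K, _, hKR, h0⟩ := h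
  exact h0 (-(2 * T), x) ⟨mem_univ _, hx⟩ fun hp => lt_irrefl _ (hKR hp).1.1

end TestOn

theorem SmoothOn.hasDerivAt_t {G : ℝ → ℝ → ℝ} (h : SmoothOn strip G) (t : ℝ) {x : ℝ}
    (hx : x ∈ Icc (0 : ℝ) 1) : HasDerivAt (fun r => G r x) (Smoothing.pdt univ G t x) t := by
  rw [← hasDerivWithinAt_univ]
  exact h.hasDerivWithinAt_pdt uniqueDiffOn_univ (mem_univ t) hx

theorem SmoothOn.hasDerivAt_x {G : ℝ → ℝ → ℝ} (h : SmoothOn strip G) (t : ℝ) {x : ℝ}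
    (hx : x ∈ Ioo (0 : ℝ) 1) :
    HasDerivAt (G t) (Smoothing.pdx (Icc 0 1) G t x) x :=
  (h.hasDerivWithinAt_pdx TestOn.uniqueDiffOn_I (mem_univ t) (Ioo_subset_Icc_self hx)).hasDerivAt
    (Icc_mem_nhds hx.1 hx.2)

/-! ### Coefficients with respect to the Fourier–Bessel system -/

/-- The coefficient of `G t` with respect to `psi M b`. -/
noncomputable def xCoeff (M : ℝ) (b : ℕ) (G : ℝ → ℝ → ℝ) (t : ℝ) : ℝ :=
  ∫ x in (0 : ℝ)..1, G t x * psi M b x * x ^ (M / 2 - 1)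

/-- The factor `1` is the weight of the sine system, kept so that the Sturm–Liouville results apply
literally to `xCoeff`. -/
theorem coeff_eq (M T : ℝ) (G : ℝ → ℝ → ℝ) (a b : ℕ) :
    coeff M T G a b = ∫ t in (-(2 * T))..(2 * T), xCoeff M b G t * phi T a t * 1 := by
  unfold coeff xCoeff
  refine intervalIntegral.integral_congr fun t _ => ?_
  simp only [mul_one]
  rw [← intervalIntegral.integral_mul_const]
  refine intervalIntegral.integral_congr fun x _ => ?_
  ring

theorem continuous_psi {M : ℝ} (hM : 5 ≤ M) (b : ℕ) : Continuous (psi M b) :=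
  (psi_contDiff (by linarith) b).continuous

theorem continuous_rpow_weight {M : ℝ} (hM : 5 ≤ M) : Continuous fun x : ℝ => x ^ (M / 2 - 1) :=
  Real.continuous_rpow_const (by linarith)

theorem SmoothOn.continuousOn_slice {G : ℝ → ℝ → ℝ} (h : SmoothOn strip G) (t : ℝ) :
    ContinuousOn (G t) (Icc 0 1) := (h.slice_snd (mem_univ t)).continuousOn

theorem xCoeff_hasDerivAt {M : ℝ} (hM : 5 ≤ M) (b : ℕ) {G : ℝ → ℝ → ℝ} (h : SmoothOn strip G)
    (t : ℝ) : HasDerivAt (xCoeff M b G) (xCoeff M b (pdt univ G) t) t := by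
  have h' := h.pdt uniqueDiffOn_univ TestOn.uniqueDiffOn_I
  have hψ := continuous_psi hM b
  have hw := continuous_rpow_weight hM
  have hcont : ∀ {H : ℝ → ℝ → ℝ}, SmoothOn strip H → ∀ r : ℝ,
      ContinuousOn (fun x => H r x * psi M b x * x ^ (M / 2 - 1)) (Icc 0 1) := fun hH r =>
    ((hH.continuousOn_slice r).mul hψ.continuousOn).mul hw.continuousOn
  have hcpt : IsCompact (Icc (t - 1) (t + 1) ×ˢ Icc (0 : ℝ) 1) := isCompact_Icc.prod isCompact_Icc
  have hc2 : ContinuousOn (fun p : ℝ × ℝ => pdt univ G p.1 p.2 * psi M b p.2 * p.2 ^ (M / 2 - 1))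
      (Icc (t - 1) (t + 1) ×ˢ Icc (0 : ℝ) 1) := by
    have h1 : ContinuousOn (fun p : ℝ × ℝ => pdt univ G p.1 p.2)
        (Icc (t - 1) (t + 1) ×ˢ Icc (0 : ℝ) 1) :=
      ContinuousOn.mono (ContDiffOn.continuousOn h') (prod_mono (subset_univ _) le_rfl)
    exact (h1.mul (hψ.comp continuous_snd).continuousOn).mul (hw.comp continuous_snd).continuousOn
  obtain ⟨C, hC⟩ := hcpt.exists_bound_of_continuousOn hc2
  have key := intervalIntegral.hasDerivAt_integral_of_dominated_loc_of_deriv_le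
    (μ := volume) (a := (0 : ℝ)) (b := 1) (s := Icc (t - 1) (t + 1)) (x₀ := t)
    (F := fun r x => G r x * psi M b x * x ^ (M / 2 - 1))
    (F' := fun r x => pdt univ G r x * psi M b x * x ^ (M / 2 - 1)) (bound := fun _ => C)
    (Icc_mem_nhds (by linarith) (by linarith))
    (Eventually.of_forall fun r => ?_) ?_ ?_ ?_ ?_ ?_
  · exact key.2
  · rw [uIoc_of_le zero_le_one]
    exact ((hcont h r).mono Ioc_subset_Icc_self).aestronglyMeasurable measurableSet_Ioc
  · exact SturmSystem.intervalIntegrable_of_Icc one_pos (hcont h t)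
  · rw [uIoc_of_le zero_le_one]
    exact ((hcont h' t).mono Ioc_subset_Icc_self).aestronglyMeasurable measurableSet_Ioc
  · refine Eventually.of_forall fun x hx r hr => ?_
    rw [uIoc_of_le zero_le_one] at hx
    exact hC (r, x) ⟨hr, Ioc_subset_Icc_self hx⟩
  · exact intervalIntegrable_const
  · refine Eventually.of_forall fun x hx r hr => ?_
    rw [uIoc_of_le zero_le_one] at hx
    exact ((h.hasDerivAt_t r (Ioc_subset_Icc_self hx)).mul_const _).mul_const _

theorem xCoeff_continuous {M : ℝ} (hM : 5 ≤ M) (b : ℕ) {G : ℝ → ℝ → ℝ} (h : SmoothOn strip G) :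
    Continuous (xCoeff M b G) :=
  continuous_iff_continuousAt.2 fun t => (xCoeff_hasDerivAt hM b h t).continuousAt

theorem xCoeff_contDiff {M : ℝ} (hM : 5 ≤ M) (b : ℕ) {G : ℝ → ℝ → ℝ} (h : SmoothOn strip G) :
    ContDiff ℝ 1 (xCoeff M b G) := by
  rw [contDiff_one_iff_deriv]
  refine ⟨fun t => (xCoeff_hasDerivAt hM b h t).differentiableAt, ?_⟩
  rw [funext fun t => (xCoeff_hasDerivAt hM b h t).deriv]
  exact xCoeff_continuous hM b (h.pdt uniqueDiffOn_univ TestOn.uniqueDiffOn_I)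

/-- Smooth functions on the strip with Dirichlet conditions. -/
structure Dirichlet (T : ℝ) (G : ℝ → ℝ → ℝ) : Prop where
  smooth : SmoothOn strip G
  right : ∀ t, G t 1 = 0
  top : ∀ x ∈ Icc (0 : ℝ) 1, G (2 * T) x = 0
  bot : ∀ x ∈ Icc (0 : ℝ) 1, G (-(2 * T)) x = 0

theorem TestOn.dirichlet {T : ℝ} {G : ℝ → ℝ → ℝ} (h : TestOn T G) : Dirichlet T G :=
  ⟨h.1, h.right, fun _ hx => h.top hx, fun _ hx => h.bot hx⟩

theorem Dirichlet.xCoeff_zero {T : ℝ} {G : ℝ → ℝ → ℝ} (h : Dirichlet T G) (M : ℝ) (b : ℕ) :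
    xCoeff M b G (2 * T) = 0 ∧ xCoeff M b G (-(2 * T)) = 0 := by
  constructor
  · unfold xCoeff
    refine (intervalIntegral.integral_congr (g := fun _ => 0) fun x hx => ?_).trans (by simp)
    rw [uIcc_of_le zero_le_one] at hx
    simp [h.top x hx]
  · unfold xCoeff
    refine (intervalIntegral.integral_congr (g := fun _ => 0) fun x hx => ?_).trans (by simp)
    rw [uIcc_of_le zero_le_one] at hx
    simp [h.bot x hx]

theorem Dirichlet.coeff_time {T M : ℝ} (hT : 0 < T) (hM : 5 ≤ M) {G : ℝ → ℝ → ℝ}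
    (h : Dirichlet T G) (a b : ℕ) :
    coeff M T (fun t x => -pdt univ (pdt univ G) t x) (a + 1) b =
      (((a + 1 : ℕ) : ℝ) * Real.pi / (4 * T)) ^ 2 * coeff M T G (a + 1) b := by
  have h1 := h.smooth.pdt uniqueDiffOn_univ TestOn.uniqueDiffOn_I
  have h2 := h1.pdt uniqueDiffOn_univ TestOn.uniqueDiffOn_I
  have h3 := (phi_system hT).integral_operator a
    (xCoeff_continuous hM b h.smooth).continuousOn (xCoeff_continuous hM b h1).continuousOn
    (xCoeff_continuous hM b h2).continuousOn (fun t _ => xCoeff_hasDerivAt hM b h.smooth t)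
    (fun t _ => by simpa using xCoeff_hasDerivAt hM b h1 t) (h.xCoeff_zero M b).1
    (by simpa using (h.xCoeff_zero M b).2)
  have h4 : ∀ t, xCoeff M b (fun t x => -pdt univ (pdt univ G) t x) t =
      -xCoeff M b (pdt univ (pdt univ G)) t := by
    intro t
    unfold xCoeff
    rw [← intervalIntegral.integral_neg]
    simp only [neg_mul]
  rw [coeff_eq, coeff_eq]
  simp only [h4, neg_mul]
  rw [intervalIntegral.integral_neg, h3]
  ring

theorem Dirichlet.coeff_space {T M : ℝ} (hM : 5 ≤ M) {G : ℝ → ℝ → ℝ}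
    (h : Dirichlet T G) (a b : ℕ) :
    coeff M T (lapStrip M G) a (b + 1) = -eigMu M (b + 1) * coeff M T G a (b + 1) := by
  have h1 := h.smooth.pdx uniqueDiffOn_univ TestOn.uniqueDiffOn_I
  have h2 := h1.pdx uniqueDiffOn_univ TestOn.uniqueDiffOn_I
  have h3 : ∀ t, xCoeff M (b + 1) (lapStrip M G) t = -eigMu M (b + 1) * xCoeff M (b + 1) G t := by
    intro t
    refine (psi_system hM).integral_operator b (h.smooth.continuousOn_slice t)
      (h1.continuousOn_slice t) ?_ (fun x hx => h.smooth.hasDerivAt_x t hx) ?_ (h.right t) ?_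
    · exact (continuousOn_id.mul (h2.continuousOn_slice t)).add
        (continuousOn_const.mul (h1.continuousOn_slice t))
    · intro x hx
      have h4 := Real.hasDerivAt_rpow_const (x := x) (p := M / 2) (Or.inl hx.1.ne')
      refine (h4.mul (h1.hasDerivAt_x t hx)).congr_deriv ?_
      have h5 : x ^ (M / 2) = x ^ (M / 2 - 1) * x := by
        rw [← Real.rpow_add_one hx.1.ne', sub_add_cancel]
      rw [h5, lapStrip]
      ring
    · rw [Real.zero_rpow (by linarith), zero_mul]
  rw [coeff_eq, coeff_eq, ← intervalIntegral.integral_const_mul]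
  refine intervalIntegral.integral_congr fun t _ => ?_
  simp only [h3]
  ring

theorem l2Sq_eq_ofReal {M : ℝ} (hM : 5 ≤ M) {f : ℝ → ℝ} (hf : ContinuousOn f (Icc 0 1)) :
    l2Sq M f = ENNReal.ofReal (∫ x in (0 : ℝ)..1, f x * f x * x ^ (M / 2 - 1)) := by
  have hw := (continuous_rpow_weight hM).continuousOn (s := Icc (0 : ℝ) 1)
  rw [intervalIntegral.integral_of_le zero_le_one, integral_Ioc_eq_integral_Ioo,
    ofReal_integral_eq_lintegral_ofReal, l2Sq]
  · refine setLIntegral_congr_fun measurableSet_Ioo fun x hx => ?_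
    rw [ENNReal.ofReal_mul (mul_self_nonneg _), ← sq, Real.enorm_eq_ofReal_abs,
      ← ENNReal.ofReal_pow (abs_nonneg _), sq_abs]
  · exact ((hf.mul hf).mul hw).integrableOn_Icc.mono_set Ioo_subset_Icc_self
  · filter_upwards [ae_restrict_mem measurableSet_Ioo] with x hx
    exact mul_nonneg (mul_self_nonneg _) (Real.rpow_nonneg hx.1.le _)

theorem ofReal_hasSum {f : ℕ → ℝ} {s : ℝ} (h0 : ∀ n, 0 ≤ f n) (h : HasSum f s) :
    ENNReal.ofReal s = ∑' n, ENNReal.ofReal (f n) := by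
  rw [← h.tsum_eq]
  exact ENNReal.ofReal_tsum_of_nonneg h0 h.summable

/-- Parseval's identity for the double expansion. -/
theorem Dirichlet.parseval {T M : ℝ} (hT : 0 < T) (hM : 5 ≤ M) {G : ℝ → ℝ → ℝ}
    (h : Dirichlet T G) :
    ∫⁻ t in Ioo (-(2 * T)) (2 * T), l2Sq M (G t) =
      ∑' b : ℕ, ∑' a : ℕ, ENNReal.ofReal (coeff M T G (a + 1) (b + 1) ^ 2) := by
  -- Parseval in `x` for each `t`; the sum is then exchanged with the time integral, and Parseval in
  -- `t` is applied to each `xCoeff`, which inherits the Dirichlet conditions at `±2T`.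
  have h1 : ∀ t, l2Sq M (G t) = ∑' b : ℕ, ENNReal.ofReal (xCoeff M (b + 1) G t ^ 2) := by
    intro t
    rw [l2Sq_eq_ofReal hM (h.smooth.continuousOn_slice t)]
    refine ofReal_hasSum (fun n => sq_nonneg _) ((psi_system hM).parseval (eigMu_tendsto hM)
      ⟨(h.smooth.slice_snd (mem_univ t)).of_le (by simp), h.right t, ?_⟩)
    beta_reduce
    rw [Real.zero_rpow (by linarith), zero_mul]
  simp only [h1]
  rw [lintegral_tsum fun b => ((xCoeff_continuous hM (b + 1)
    h.smooth).measurable.pow_const 2).ennreal_ofReal.aemeasurable]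
  refine tsum_congr fun b => ?_
  have hc := xCoeff_continuous hM (b + 1) h.smooth
  have hle : -(2 * T) ≤ 2 * T := by linarith
  have h2 := (phi_system hT).parseval (timeEig_tendsto hT)
    (f := xCoeff M (b + 1) G)
    ⟨(xCoeff_contDiff hM (b + 1) h.smooth).contDiffOn, (h.xCoeff_zero M _).1,
      by simpa using (h.xCoeff_zero M _).2⟩
  simp only [← coeff_eq] at h2
  rw [← ofReal_hasSum (fun n => sq_nonneg _) h2, intervalIntegral.integral_of_le hle,
    integral_Ioc_eq_integral_Ioo, ofReal_integral_eq_lintegral_ofReal]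
  · simp only [sq, mul_one]
  · simp only [mul_one]
    exact (hc.mul hc).continuousOn.integrableOn_Icc.mono_set Ioo_subset_Icc_self
  · exact Eventually.of_forall fun t => by simpa using mul_self_nonneg _

/-! ### Finite combinations of eigenfunctions -/

/-- A finite combination of the products `φ_a(t) ψ_b(x)`. -/
noncomputable def comb (M T : ℝ) (A : Finset ℕ) (d : ℕ → ℕ → ℝ) (t x : ℝ) : ℝ :=
  ∑ a ∈ A, ∑ b ∈ A, d a b * phi T a t * psi M b x

/-- The eigenvalues of `-d²/dt²` on `]-2T, 2T[`. -/
noncomputable def timeEig (T : ℝ) (a : ℕ) : ℝ := (a * Real.pi / (4 * T)) ^ 2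

theorem phi_contDiff (T : ℝ) (a : ℕ) : ContDiff ℝ ∞ (phi T a) := by
  unfold phi
  fun_prop

theorem comb_smooth {M : ℝ} (hM : 5 ≤ M) (T : ℝ) (A : Finset ℕ) (d : ℕ → ℕ → ℝ)
    (s : Set (ℝ × ℝ)) : SmoothOn s (comb M T A d) :=
  SmoothOn.sum fun a _ => SmoothOn.sum fun b _ =>
    ((SmoothOn.of_fst (phi_contDiff T a).contDiffOn fun p _ => mem_univ p.1).const_mul _).mul
      (SmoothOn.of_snd (psi_contDiff (by linarith) b).contDiffOn fun p _ => mem_univ p.2)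

theorem comb_dirichlet {M T : ℝ} (hM : 5 ≤ M) (hT : 0 < T) {A : Finset ℕ} (hA : ∀ a ∈ A, 1 ≤ a)
    (d : ℕ → ℕ → ℝ) : Dirichlet T (comb M T A d) where
  smooth := comb_smooth hM T A d _
  right t := by
    refine Finset.sum_eq_zero fun a _ => Finset.sum_eq_zero fun b hb => ?_
    obtain ⟨n, rfl⟩ := Nat.exists_eq_add_of_le' (hA b hb)
    rw [(psi_system hM).right n, mul_zero]
  top x _ := by
    refine Finset.sum_eq_zero fun a ha => Finset.sum_eq_zero fun b _ => ?_
    obtain ⟨n, rfl⟩ := Nat.exists_eq_add_of_le' (hA a ha)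
    rw [(phi_system hT).right n, mul_zero, zero_mul]
  bot x _ := by
    refine Finset.sum_eq_zero fun a ha => Finset.sum_eq_zero fun b _ => ?_
    obtain ⟨n, rfl⟩ := Nat.exists_eq_add_of_le' (hA a ha)
    have := (phi_system hT).left n
    rw [one_mul] at this
    rw [this, mul_zero, zero_mul]

theorem xCoeff_comb {M : ℝ} (hM : 5 ≤ M) (T : ℝ) {A : Finset ℕ} (hA : ∀ a ∈ A, 1 ≤ a)
    (d : ℕ → ℕ → ℝ) (b : ℕ) (t : ℝ) : xCoeff M (b + 1) (comb M T A d) t =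
      ∑ a ∈ A, if b + 1 ∈ A then d a (b + 1) * phi T a t else 0 := by
  have hw := continuous_rpow_weight hM
  have h1 : ∀ x, comb M T A d t x * psi M (b + 1) x * x ^ (M / 2 - 1) =
      ∑ a ∈ A, ∑ b' ∈ A, d a b' * phi T a t * (psi M b' x * psi M (b + 1) x * x ^ (M / 2 - 1)) := by
    intro x
    rw [comb, Finset.sum_mul, Finset.sum_mul]
    refine Finset.sum_congr rfl fun a _ => ?_
    rw [Finset.sum_mul, Finset.sum_mul]
    exact Finset.sum_congr rfl fun b' _ => by ring
  have hint : ∀ b', IntervalIntegrable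
      (fun x => psi M b' x * psi M (b + 1) x * x ^ (M / 2 - 1)) volume 0 1 := fun b' =>
    (((continuous_psi hM b').mul (continuous_psi hM (b + 1))).mul hw).intervalIntegrable _ _
  have hint' : ∀ a, IntervalIntegrable (fun x => ∑ b' ∈ A, d a b' * phi T a t *
      (psi M b' x * psi M (b + 1) x * x ^ (M / 2 - 1))) volume 0 1 := fun a =>
    (continuous_finsetSum _ fun b' _ => (((continuous_psi hM b').mul
      (continuous_psi hM (b + 1))).mul hw).const_mul _).intervalIntegrable _ _
  unfold xCoeff
  simp only [h1]
  rw [intervalIntegral.integral_finsetSum fun a _ => hint' a]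
  refine Finset.sum_congr rfl fun a _ => ?_
  rw [intervalIntegral.integral_finsetSum fun b' _ => (hint b').const_mul _]
  have h2 : ∀ b' ∈ A, ∫ x in (0 : ℝ)..1, d a b' * phi T a t *
      (psi M b' x * psi M (b + 1) x * x ^ (M / 2 - 1)) =
      if b' = b + 1 then d a (b + 1) * phi T a t else 0 := by
    intro b' hb'
    obtain ⟨n, rfl⟩ := Nat.exists_eq_add_of_le' (hA b' hb')
    rw [intervalIntegral.integral_const_mul, (psi_system hM).integral_orth n b]
    simp only [Nat.add_right_cancel_iff]
    split_ifs with h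
    · rw [h, mul_one]
    · rw [mul_zero]
  rw [Finset.sum_congr rfl h2, Finset.sum_ite_eq']

theorem coeff_comb {M T : ℝ} (hM : 5 ≤ M) (hT : 0 < T) {A : Finset ℕ} (hA : ∀ a ∈ A, 1 ≤ a)
    (d : ℕ → ℕ → ℝ) (a b : ℕ) : coeff M T (comb M T A d) (a + 1) (b + 1) =
      if a + 1 ∈ A ∧ b + 1 ∈ A then d (a + 1) (b + 1) else 0 := by
  rw [coeff_eq]
  simp only [xCoeff_comb hM T hA]
  by_cases hb : b + 1 ∈ A
  · simp only [hb, if_true, and_true, Finset.sum_mul]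
    have hint : ∀ a', IntervalIntegrable
        (fun t => d a' (b + 1) * phi T a' t * phi T (a + 1) t * 1) volume (-(2 * T)) (2 * T) :=
      fun a' => ((((phi_contDiff T a').continuous.const_mul _).mul
        (phi_contDiff T (a + 1)).continuous).mul continuous_const).intervalIntegrable _ _
    rw [intervalIntegral.integral_finsetSum fun a' _ => hint a']
    have h2 : ∀ a' ∈ A, ∫ t in (-(2 * T))..(2 * T),
        d a' (b + 1) * phi T a' t * phi T (a + 1) t * 1 =
        if a' = a + 1 then d (a + 1) (b + 1) else 0 := by
      intro a' ha'
      obtain ⟨n, rfl⟩ := Nat.exists_eq_add_of_le' (hA a' ha')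
      have : ∀ t, d (n + 1) (b + 1) * phi T (n + 1) t * phi T (a + 1) t * 1 =
        d (n + 1) (b + 1) * (phi T (n + 1) t * phi T (a + 1) t * 1) := fun t => by ring
      simp only [this]
      rw [intervalIntegral.integral_const_mul, (phi_system hT).integral_orth n a]
      simp only [Nat.add_right_cancel_iff]
      split_ifs with h
      · rw [h, mul_one]
      · rw [mul_zero]
    rw [Finset.sum_congr rfl h2, Finset.sum_ite_eq']
  · simp [hb]

theorem xCoeff_sub {M : ℝ} (hM : 5 ≤ M) (b : ℕ) {G H : ℝ → ℝ → ℝ} (hG : SmoothOn strip G)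
    (hH : SmoothOn strip H) (t : ℝ) :
    xCoeff M b (fun t x => G t x - H t x) t = xCoeff M b G t - xCoeff M b H t := by
  have hw := (continuous_rpow_weight hM).continuousOn (s := Icc (0 : ℝ) 1)
  have hψ := (continuous_psi hM b).continuousOn (s := Icc (0 : ℝ) 1)
  unfold xCoeff
  rw [← intervalIntegral.integral_sub]
  · exact intervalIntegral.integral_congr fun x _ => by ring
  · exact SturmSystem.intervalIntegrable_of_Icc one_pos (((hG.continuousOn_slice t).mul hψ).mul hw)
  · exact SturmSystem.intervalIntegrable_of_Icc one_pos (((hH.continuousOn_slice t).mul hψ).mul hw)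

theorem coeff_sub {M : ℝ} (hM : 5 ≤ M) (T : ℝ) (a b : ℕ) {G H : ℝ → ℝ → ℝ}
    (hG : SmoothOn strip G) (hH : SmoothOn strip H) :
    coeff M T (fun t x => G t x - H t x) a b = coeff M T G a b - coeff M T H a b := by
  have hφ := (phi_contDiff T a).continuous
  simp only [coeff_eq, xCoeff_sub hM b hG hH]
  rw [← intervalIntegral.integral_sub]
  · exact intervalIntegral.integral_congr fun x _ => by ring
  · exact (((xCoeff_continuous hM b hG).mul hφ).mul continuous_const).intervalIntegrable _ _
  · exact (((xCoeff_continuous hM b hH).mul hφ).mul continuous_const).intervalIntegrable _ _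

theorem Dirichlet.sub {T : ℝ} {G H : ℝ → ℝ → ℝ} (hG : Dirichlet T G) (hH : Dirichlet T H) :
    Dirichlet T (fun t x => G t x - H t x) where
  smooth := hG.smooth.sub hH.smooth
  right t := by rw [hG.right, hH.right, sub_zero]
  top x hx := by rw [hG.top x hx, hH.top x hx, sub_zero]
  bot x hx := by rw [hG.bot x hx, hH.bot x hx, sub_zero]

/-- The second derivative of `psi M b`. -/
noncomputable def psi'' (M : ℝ) (b : ℕ) (x : ℝ) : ℝ :=
  eigMu M b ^ 2 * besselPsi (M / 2 - 1 + 1 + 1) (eigMu M b * x) / psiNorm M b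

theorem psi_hasDerivAt {M : ℝ} (hM : 5 ≤ M) (b : ℕ) (x : ℝ) :
    HasDerivAt (psi M b) (psi' M b x) x := by
  refine (((besselPsi_hasDerivAt (p := M / 2 - 1) (by linarith) (eigMu M b * x)).comp x
    ((hasDerivAt_id x).const_mul (eigMu M b))).div_const (psiNorm M b)).congr_deriv ?_
  rw [psi']
  ring

theorem psi'_hasDerivAt {M : ℝ} (hM : 5 ≤ M) (b : ℕ) (x : ℝ) :
    HasDerivAt (psi' M b) (psi'' M b x) x := by
  refine ((((besselPsi_hasDerivAt (p := M / 2 - 1 + 1) (by linarith) (eigMu M b * x)).comp x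
    ((hasDerivAt_id x).const_mul (eigMu M b))).const_mul (eigMu M b)).neg.div_const
    (psiNorm M b)).congr_deriv ?_
  rw [psi'']
  ring

theorem psi_ode {M : ℝ} (hM : 5 ≤ M) (b : ℕ) (x : ℝ) :
    x * psi'' M b x + M / 2 * psi' M b x = -eigMu M b * psi M b x := by
  have h := besselPsi_ode (p := M / 2 - 1) (by linarith) (eigMu M b * x)
  have h2 : besselPsi (M / 2 - 1) (eigMu M b * x) =
      (M / 2 - 1 + 1) * besselPsi (M / 2 - 1 + 1) (eigMu M b * x) -
        eigMu M b * x * besselPsi (M / 2 - 1 + 1 + 1) (eigMu M b * x) := by linarith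
  rw [psi_eq, h2, psi', psi'']
  ring

/-! ### Operators applied to test functions minus combinations of eigenfunctions -/

theorem comb_hasDerivAt_x (T : ℝ) (A : Finset ℕ) (d : ℕ → ℕ → ℝ) (t : ℝ)
    {f f' : ℕ → ℝ → ℝ} {x : ℝ} (hf : ∀ b, HasDerivAt (f b) (f' b x) x) :
    HasDerivAt (fun x => ∑ a ∈ A, ∑ b ∈ A, d a b * phi T a t * f b x)
      (∑ a ∈ A, ∑ b ∈ A, d a b * phi T a t * f' b x) x :=
  HasDerivAt.fun_sum fun _ _ => HasDerivAt.fun_sum fun b _ => (hf b).const_mul _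

/-- Test functions minus finite combinations of eigenfunctions form a class stable under both
operators. It contains `U`, its truncation (test part 0) and the truncation error, so one
calculation serves all three. The identity for `V` is required only for interior `x`, where `deriv`
is reliable. -/
theorem lap_step {M T : ℝ} (hM : 5 ≤ M) {A : Finset ℕ} {G V : ℝ → ℝ → ℝ} {d : ℕ → ℕ → ℝ}
    (hG : TestOn T G) (hV : ∀ t, ∀ x ∈ Ioo (0 : ℝ) 1, V t x = G t x - comb M T A d t x) (t : ℝ)
    {x : ℝ} (hx : x ∈ Ioo (0 : ℝ) 1) : lap M (V t) x =
      lapStrip M G t x - comb M T A (fun a b => -eigMu M b * d a b) t x := by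
  have h1 : ∀ y ∈ Ioo (0 : ℝ) 1, HasDerivAt (V t) (pdx (Icc 0 1) G t y -
      ∑ a ∈ A, ∑ b ∈ A, d a b * phi T a t * psi' M b y) y := by
    intro y hy
    refine ((hG.1.hasDerivAt_x t hy).sub (comb_hasDerivAt_x T A d t
      fun b => psi_hasDerivAt hM b y)).congr_of_eventuallyEq ?_
    filter_upwards [isOpen_Ioo.mem_nhds hy] with z hz using hV t z hz
  have h2 : ∀ y ∈ Ioo (0 : ℝ) 1, HasDerivAt (fun y => pdx (Icc 0 1) G t y -
      ∑ a ∈ A, ∑ b ∈ A, d a b * phi T a t * psi' M b y) (pdx (Icc 0 1) (pdx (Icc 0 1) G) t y -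
      ∑ a ∈ A, ∑ b ∈ A, d a b * phi T a t * psi'' M b y) y := fun y hy =>
    (hG.pdx.1.hasDerivAt_x t hy).sub (comb_hasDerivAt_x T A d t
      fun b => psi'_hasDerivAt hM b y)
  rw [lap_eq isOpen_Ioo h1 h2 hx]
  have h3 : comb M T A (fun a b => -eigMu M b * d a b) t x =
      x * (∑ a ∈ A, ∑ b ∈ A, d a b * phi T a t * psi'' M b x) +
      M / 2 * ∑ a ∈ A, ∑ b ∈ A, d a b * phi T a t * psi' M b x := by
    simp only [comb, Finset.mul_sum, ← Finset.sum_add_distrib]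
    refine Finset.sum_congr rfl fun a _ => Finset.sum_congr rfl fun b _ => ?_
    have := psi_ode hM b x
    linear_combination -(d a b * phi T a t) * this
  rw [h3, lapStrip]
  ring

theorem time_step {M T : ℝ} {A : Finset ℕ} {G V : ℝ → ℝ → ℝ} {d : ℕ → ℕ → ℝ}
    (hG : TestOn T G) (hV : ∀ t, ∀ x ∈ Ioo (0 : ℝ) 1, V t x = G t x - comb M T A d t x) (t : ℝ)
    {x : ℝ} (hx : x ∈ Ioo (0 : ℝ) 1) : timeLap V t x =
      -pdt univ (pdt univ G) t x - comb M T A (fun a b => timeEig T a * d a b) t x := by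
  have hx' := Ioo_subset_Icc_self hx
  have h1 : ∀ s ∈ (univ : Set ℝ), HasDerivAt (fun r => V r x) (pdt univ G s x -
      ∑ a ∈ A, ∑ b ∈ A, d a b * phi' T a s * psi M b x) s := by
    intro s _
    refine ((hG.1.hasDerivAt_t s hx').sub (HasDerivAt.fun_sum fun a _ => HasDerivAt.fun_sum
      fun b _ => ((phi_hasDerivAt T a s).const_mul (d a b)).mul_const (psi M b x))
      ).congr_of_eventuallyEq ?_
    exact Eventually.of_forall fun r => hV r x hx
  have h2 : ∀ s ∈ (univ : Set ℝ), HasDerivAt (fun s => pdt univ G s x -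
      ∑ a ∈ A, ∑ b ∈ A, d a b * phi' T a s * psi M b x) (pdt univ (pdt univ G) s x -
      ∑ a ∈ A, ∑ b ∈ A, d a b * (-(timeEig T a * phi T a s)) * psi M b x) s := fun s _ =>
    (hG.pdt.1.hasDerivAt_t s hx').sub (HasDerivAt.fun_sum fun a _ => HasDerivAt.fun_sum
      fun b _ => ((phi'_hasDerivAt T a s).const_mul (d a b)).mul_const (psi M b x))
  rw [timeLap, deriv2_eq isOpen_univ h1 h2 (mem_univ t)]
  have h3 : comb M T A (fun a b => timeEig T a * d a b) t x =
      -∑ a ∈ A, ∑ b ∈ A, d a b * (-(timeEig T a * phi T a t)) * psi M b x := by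
    simp only [comb, ← Finset.sum_neg_distrib]
    refine Finset.sum_congr rfl fun a _ => Finset.sum_congr rfl fun b _ => ?_
    ring
  rw [h3]
  ring

/-- The test part stays a test function at every step, so the coefficient rule with factor `-eigMu`
can be repeated indefinitely without boundary terms. -/
theorem lap_iterate {M T : ℝ} (hM : 5 ≤ M) {A : Finset ℕ} {G V : ℝ → ℝ → ℝ} {d : ℕ → ℕ → ℝ}
    (hG : TestOn T G) (hV : ∀ t, ∀ x ∈ Ioo (0 : ℝ) 1, V t x = G t x - comb M T A d t x) (κ : ℕ) :
    ∃ G', TestOn T G' ∧ (∀ t, ∀ x ∈ Ioo (0 : ℝ) 1, (lap M)^[κ] (V t) x =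
      G' t x - comb M T A (fun a b => (-eigMu M b) ^ κ * d a b) t x) ∧
      ∀ a b, coeff M T G' (a + 1) (b + 1) =
        (-eigMu M (b + 1)) ^ κ * coeff M T G (a + 1) (b + 1) := by
  induction κ with
  | zero => exact ⟨G, hG, by simpa using hV, by simp⟩
  | succ κ ih =>
    obtain ⟨G', hG', hV', hc⟩ := ih
    refine ⟨lapStrip M G', hG'.lap M, fun t x hx => ?_, fun a b => ?_⟩
    · rw [Function.iterate_succ_apply', lap_step hM hG' (V := fun t => (lap M)^[κ] (V t)) hV' t hx]
      simp only [pow_succ', mul_assoc]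
    · rw [hG'.dirichlet.coeff_space hM, hc, pow_succ', mul_assoc]

theorem time_iterate {M T : ℝ} (hT : 0 < T) (hM : 5 ≤ M) {A : Finset ℕ} {G V : ℝ → ℝ → ℝ}
    {d : ℕ → ℕ → ℝ} (hG : TestOn T G)
    (hV : ∀ t, ∀ x ∈ Ioo (0 : ℝ) 1, V t x = G t x - comb M T A d t x) (ι : ℕ) :
    ∃ G', TestOn T G' ∧ (∀ t, ∀ x ∈ Ioo (0 : ℝ) 1, timeLap^[ι] V t x =
      G' t x - comb M T A (fun a b => timeEig T a ^ ι * d a b) t x) ∧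
      ∀ a b, coeff M T G' (a + 1) (b + 1) =
        timeEig T (a + 1) ^ ι * coeff M T G (a + 1) (b + 1) := by
  induction ι with
  | zero => exact ⟨G, hG, by simpa using hV, by simp⟩
  | succ ι ih =>
    obtain ⟨G', hG', hV', hc⟩ := ih
    refine ⟨_, hG'.pdt.pdt.neg, fun t x hx => ?_, fun a b => ?_⟩
    · rw [Function.iterate_succ_apply', time_step hG' hV' t hx]
      simp only [pow_succ', mul_assoc]
    · rw [hG'.dirichlet.coeff_time hT hM, hc, pow_succ' (timeEig T (a + 1)), mul_assoc]
      rfl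

/-- The symbol of the squared norm `‖·‖_ν^♯`. -/
noncomputable def symbol (ν : ℕ) (x y : ℝ) : ℝ := ∑ p ∈ orders ν, x ^ p.1 * y ^ p.2

theorem l2Sq_congr {M : ℝ} {f g : ℝ → ℝ} (h : ∀ x ∈ Ioo (0 : ℝ) 1, f x = g x) :
    l2Sq M f = l2Sq M g :=
  setLIntegral_congr_fun measurableSet_Ioo fun x hx => by simp only [h x hx]

/-- Each iterated function is again a test function minus a combination, hence satisfies the
Dirichlet conditions, and Parseval applies to every summand of the norm. Summing over the orders
`(ι, κ)` assembles the symbol. -/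
theorem sharp_sum {M T : ℝ} (hT : 0 < T) (hM : 5 ≤ M) {A : Finset ℕ} (hA : ∀ a ∈ A, 1 ≤ a)
    {G V : ℝ → ℝ → ℝ} {d : ℕ → ℕ → ℝ} (hG : TestOn T G)
    (hV : ∀ t, ∀ x ∈ Ioo (0 : ℝ) 1, V t x = G t x - comb M T A d t x) (ν : ℕ) :
    ∑ p ∈ orders ν, ∫⁻ t in Ioo (-(2 * T)) (2 * T),
      l2Sq M (timeLap^[p.1] (fun r => (lap M)^[p.2] (V r)) t) =
    ∑' b : ℕ, ∑' a : ℕ, ENNReal.ofReal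
      (symbol ν (timeEig T (a + 1) ^ 2) (eigMu M (b + 1) ^ 2) *
        (coeff M T G (a + 1) (b + 1) -
          if a + 1 ∈ A ∧ b + 1 ∈ A then d (a + 1) (b + 1) else 0) ^ 2) := by
  have key : ∀ p ∈ orders ν, ∫⁻ t in Ioo (-(2 * T)) (2 * T),
      l2Sq M (timeLap^[p.1] (fun r => (lap M)^[p.2] (V r)) t) =
      ∑' b : ℕ, ∑' a : ℕ, ENNReal.ofReal
      ((timeEig T (a + 1) ^ 2) ^ p.1 * (eigMu M (b + 1) ^ 2) ^ p.2 *
        (coeff M T G (a + 1) (b + 1) -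
          if a + 1 ∈ A ∧ b + 1 ∈ A then d (a + 1) (b + 1) else 0) ^ 2) := by
    intro p _
    obtain ⟨G1, hG1, hV1, hc1⟩ := lap_iterate hM hG hV p.2
    obtain ⟨G2, hG2, hV2, hc2⟩ := time_iterate hT hM hG1 (V := fun r => (lap M)^[p.2] (V r)) hV1 p.1
    have hD := hG2.dirichlet.sub (comb_dirichlet hM hT hA
      (fun a b => timeEig T a ^ p.1 * ((-eigMu M b) ^ p.2 * d a b)))
    rw [← show _ = _ from setLIntegral_congr_fun measurableSet_Ioo fun t _ =>
      (l2Sq_congr fun x hx => (hV2 t x hx)).symm]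
    rw [hD.parseval hT hM]
    refine tsum_congr fun b => tsum_congr fun a => ?_
    rw [coeff_sub hM T _ _ hG2.1 (comb_smooth hM T _ _ _), coeff_comb hM hT hA, hc2, hc1]
    congr 1
    have e : (eigMu M (b + 1) ^ 2) ^ p.2 = ((-eigMu M (b + 1)) ^ p.2) ^ 2 := by
      rw [← pow_mul, ← pow_mul, mul_comm p.2 2, pow_mul, pow_mul, neg_sq]
    rw [e]
    split_ifs <;> ring
  rw [Finset.sum_congr rfl key, ← Summable.tsum_finsetSum fun _ _ => ENNReal.summable]
  refine tsum_congr fun b => ?_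
  rw [← Summable.tsum_finsetSum fun _ _ => ENNReal.summable]
  refine tsum_congr fun a => ?_
  rw [← ENNReal.ofReal_sum_of_nonneg fun p _ => by positivity, symbol, Finset.sum_mul]

/-! ### Comparison of the symbols -/

theorem mem_orders {ν : ℕ} {p : ℕ × ℕ} : p ∈ orders ν ↔ p.1 + p.2 ≤ ν := by
  simp only [orders, Finset.mem_filter, Finset.mem_product, Finset.mem_range]
  omega

theorem symbol_nonneg (ν : ℕ) {x y : ℝ} (hx : 0 ≤ x) (hy : 0 ≤ y) : 0 ≤ symbol ν x y :=
  Finset.sum_nonneg fun p _ => by positivity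

/-- Together with `le_symbol` this makes the symbol equivalent to `(1 + x + y)^ν`, for which
changing the order only means multiplying by a power. -/
theorem symbol_le (ν : ℕ) {x y : ℝ} (hx : 0 ≤ x) (hy : 0 ≤ y) :
    symbol ν x y ≤ (orders ν).card * (1 + x + y) ^ ν := by
  rw [symbol, ← nsmul_eq_mul]
  refine Finset.sum_le_card_nsmul _ _ _ fun p hp => ?_
  have h1 : x ^ p.1 ≤ (1 + x + y) ^ p.1 := pow_le_pow_left₀ hx (by linarith) _
  have h2 : y ^ p.2 ≤ (1 + x + y) ^ p.2 := pow_le_pow_left₀ hy (by linarith) _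
  calc x ^ p.1 * y ^ p.2 ≤ (1 + x + y) ^ p.1 * (1 + x + y) ^ p.2 := by gcongr
    _ = (1 + x + y) ^ (p.1 + p.2) := (pow_add _ _ _).symm
    _ ≤ (1 + x + y) ^ ν := pow_le_pow_right₀ (by linarith) (mem_orders.1 hp)

theorem le_symbol (ν : ℕ) {x y : ℝ} (hx : 0 ≤ x) (hy : 0 ≤ y) :
    (1 + x + y) ^ ν ≤ 3 ^ ν * symbol ν x y := by
  have hterm : ∀ p ∈ orders ν, x ^ p.1 * y ^ p.2 ≤ symbol ν x y := fun p hp =>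
    Finset.single_le_sum (f := fun p : ℕ × ℕ => x ^ p.1 * y ^ p.2) (fun q _ => by positivity) hp
  have h1 : (1 : ℝ) ≤ symbol ν x y := by
    simpa using hterm (0, 0) (mem_orders.2 (by simp))
  have h2 : x ^ ν ≤ symbol ν x y := by
    simpa using hterm (ν, 0) (mem_orders.2 (by simp))
  have h3 : y ^ ν ≤ symbol ν x y := by
    simpa using hterm (0, ν) (mem_orders.2 (by simp))
  have h4 : 1 + x + y ≤ 3 * max 1 (max x y) := by
    have := le_max_left 1 (max x y)
    have := (le_max_left x y).trans (le_max_right 1 (max x y))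
    have := (le_max_right x y).trans (le_max_right 1 (max x y))
    linarith
  have h5 : (max 1 (max x y)) ^ ν ≤ symbol ν x y := by
    rcases max_choice 1 (max x y) with h | h
    · rw [h, one_pow]; exact h1
    · rw [h]
      rcases max_choice x y with h' | h' <;> rw [h'] <;> assumption
  calc (1 + x + y) ^ ν ≤ (3 * max 1 (max x y)) ^ ν := by gcongr
    _ = 3 ^ ν * (max 1 (max x y)) ^ ν := mul_pow _ _ _
    _ ≤ 3 ^ ν * symbol ν x y := by gcongr

/-- The cap `⌊θ⌋₊` in `indices` excludes nothing, because `a ≤ a² ≤ θ` for `a ≥ 1`. -/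
theorem mem_indices {θ : ℝ} {a : ℕ} : a ∈ indices θ ↔ 1 ≤ a ∧ (a : ℝ) ^ 2 ≤ θ := by
  simp only [indices, Finset.mem_filter, Finset.mem_Icc]
  constructor
  · rintro ⟨⟨h1, -⟩, h2⟩
    exact ⟨h1, h2⟩
  · rintro ⟨h1, h2⟩
    refine ⟨⟨h1, Nat.le_floor ?_⟩, h2⟩
    have : (1 : ℝ) ≤ a := by exact_mod_cast h1
    nlinarith

/-- For retained indices both eigenvalues are `O(θ)`, so `1 + x + y ≤ D θ²` and each additional
order costs at most `D θ²`. -/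
theorem symbol_low {M T : ℝ} (hT : 0 < T) (hM : 5 ≤ M) (ν k : ℕ) :
    ∃ K : ℝ, 0 ≤ K ∧ ∀ θ : ℝ, ∀ a ∈ indices θ, ∀ b ∈ indices θ,
      symbol (ν + k) (timeEig T a ^ 2) (eigMu M b ^ 2) ≤
        K * (θ ^ k) ^ 2 * symbol ν (timeEig T a ^ 2) (eigMu M b ^ 2) := by
  obtain ⟨C, hC, hup⟩ := eigMu_upper hM
  set D : ℝ := 1 + ((Real.pi / (4 * T)) ^ 2) ^ 2 + C ^ 2 with hD
  refine ⟨(orders (ν + k)).card * D ^ k * 3 ^ ν, by positivity, fun θ a ha b hb => ?_⟩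
  rw [mem_indices] at ha hb
  set x := timeEig T a ^ 2 with hx
  set y := eigMu M b ^ 2 with hy
  have hx0 : 0 ≤ x := sq_nonneg _
  have hy0 : 0 ≤ y := sq_nonneg _
  -- Indices start at 1, so a retained index forces `θ ≥ 1`; this lets the summand 1 be absorbed in
  -- `D θ²`.
  have hθ1 : 1 ≤ θ := by
    have : (1 : ℝ) ≤ a := by exact_mod_cast ha.1
    nlinarith [ha.2]
  have h1 : x ≤ ((Real.pi / (4 * T)) ^ 2) ^ 2 * θ ^ 2 := by
    rw [hx, timeEig, mul_div_assoc, mul_pow, mul_pow, mul_comm]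
    have := ha.2
    gcongr
  have h2 : y ≤ C ^ 2 * θ ^ 2 := by
    rw [hy, ← mul_pow]
    have h3 := hup b hb.1
    have h4 : C * (b : ℝ) ^ 2 ≤ C * θ := by have := hb.2; gcongr
    have h5 : 0 ≤ eigMu M b := sq_nonneg _
    exact pow_le_pow_left₀ h5 (h3.trans h4) 2
  have h3 : 1 + x + y ≤ D * θ ^ 2 := by
    rw [hD]
    nlinarith
  calc symbol (ν + k) x y ≤ (orders (ν + k)).card * (1 + x + y) ^ (ν + k) := symbol_le _ hx0 hy0
    _ = (orders (ν + k)).card * ((1 + x + y) ^ k * (1 + x + y) ^ ν) := by rw [pow_add]; ring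
    _ ≤ (orders (ν + k)).card * ((D * θ ^ 2) ^ k * (3 ^ ν * symbol ν x y)) := by
      have := le_symbol ν hx0 hy0
      gcongr
    _ = _ := by rw [mul_pow, ← pow_mul, mul_comm 2 k, pow_mul]; ring

/-- A discarded pair has `a² > θ` or `b² > θ`, so one of the eigenvalues is at least a constant
times `θ`, and `θ² ≤ D (1 + x + y)`. -/
theorem symbol_high {M T : ℝ} (hT : 0 < T) (hM : 5 ≤ M) (ν k : ℕ) :
    ∃ K : ℝ, 0 ≤ K ∧ ∀ θ : ℝ, 0 ≤ θ → ∀ a b, 1 ≤ a → 1 ≤ b → ¬ (a ∈ indices θ ∧ b ∈ indices θ) →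
      (θ ^ k) ^ 2 * symbol ν (timeEig T a ^ 2) (eigMu M b ^ 2) ≤
        K * symbol (ν + k) (timeEig T a ^ 2) (eigMu M b ^ 2) := by
  obtain ⟨c, hc, hlow⟩ := eigMu_lower hM
  have hπ := Real.pi_pos
  set c1 : ℝ := ((Real.pi / (4 * T)) ^ 2) ^ 2 with hc1
  have hc1pos : 0 < c1 := by positivity
  set D : ℝ := c1⁻¹ + (c ^ 2)⁻¹ with hD
  have hDpos : 0 < D := by positivity
  refine ⟨(orders ν).card * D ^ k * 3 ^ (ν + k), by positivity, fun θ hθ a b ha hb hab => ?_⟩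
  rw [mem_indices, mem_indices] at hab
  set x := timeEig T a ^ 2 with hx
  set y := eigMu M b ^ 2 with hy
  have hx0 : 0 ≤ x := sq_nonneg _
  have hy0 : 0 ≤ y := sq_nonneg _
  have h3 : θ ^ 2 ≤ D * (1 + x + y) := by
    by_cases h : (a : ℝ) ^ 2 ≤ θ
    · have h4 : θ ≤ (b : ℝ) ^ 2 := by
        by_contra! h5
        exact hab ⟨⟨ha, h⟩, hb, h5.le⟩
      have h5 : c ^ 2 * θ ^ 2 ≤ y := by
        rw [hy, ← mul_pow]
        have : c * θ ≤ c * (b : ℝ) ^ 2 := by gcongr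
        exact pow_le_pow_left₀ (by positivity) (this.trans (hlow b)) 2
      have h6 : θ ^ 2 ≤ (c ^ 2)⁻¹ * y := by
        rw [inv_mul_eq_div, le_div_iff₀ (by positivity)]; linarith
      have h7 : (c ^ 2)⁻¹ * y ≤ D * (1 + x + y) := by
        have : (c ^ 2)⁻¹ ≤ D := by rw [hD]; linarith [inv_pos.2 hc1pos]
        gcongr
        linarith
      linarith
    · have h4 : θ ≤ (a : ℝ) ^ 2 := (not_le.1 h).le
      have h5 : c1 * θ ^ 2 ≤ x := by
        rw [hx, timeEig, mul_div_assoc, mul_pow, mul_pow, mul_comm]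
        gcongr
      have h6 : θ ^ 2 ≤ c1⁻¹ * x := by
        rw [inv_mul_eq_div, le_div_iff₀ (by positivity)]; linarith
      have h7 : c1⁻¹ * x ≤ D * (1 + x + y) := by
        have : c1⁻¹ ≤ D := by rw [hD]; linarith [inv_pos.2 (show 0 < c ^ 2 by positivity)]
        gcongr
        linarith
      linarith
  calc (θ ^ k) ^ 2 * symbol ν x y = (θ ^ 2) ^ k * symbol ν x y := by
        rw [← pow_mul, mul_comm k 2, pow_mul]
    _ ≤ (D * (1 + x + y)) ^ k * ((orders ν).card * (1 + x + y) ^ ν) := by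
      have := symbol_le ν hx0 hy0
      have := symbol_nonneg ν hx0 hy0
      gcongr
    _ = (orders ν).card * D ^ k * (1 + x + y) ^ (ν + k) := by rw [mul_pow, pow_add]; ring
    _ ≤ (orders ν).card * D ^ k * (3 ^ (ν + k) * symbol (ν + k) x y) := by
      have := le_symbol (ν + k) hx0 hy0
      gcongr
    _ = _ := by ring

/-! ### The estimates for the truncated expansions -/

theorem coeff_congr {M T : ℝ} (hT : 0 < T) {U G : ℝ → ℝ → ℝ}
    (h : ∀ t ∈ Ioo (-(2 * T)) (2 * T), ∀ x ∈ Ico (0 : ℝ) 1, U t x = G t x) (a b : ℕ) :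
    coeff M T U a b = coeff M T G a b := by
  have hle : -(2 * T) ≤ 2 * T := by linarith
  unfold coeff
  rw [intervalIntegral.integral_of_le hle, intervalIntegral.integral_of_le hle,
    integral_Ioc_eq_integral_Ioo, integral_Ioc_eq_integral_Ioo]
  refine setIntegral_congr_fun measurableSet_Ioo fun t ht => ?_
  rw [intervalIntegral.integral_of_le zero_le_one, intervalIntegral.integral_of_le zero_le_one,
    integral_Ioc_eq_integral_Ioo, integral_Ioc_eq_integral_Ioo]
  refine setIntegral_congr_fun measurableSet_Ioo fun x hx => ?_
  simp only [h t ht x (Ioo_subset_Ico_self hx)]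

theorem lap_congr {M : ℝ} {O : Set ℝ} (hO : IsOpen O) {f g : ℝ → ℝ} (h : ∀ x ∈ O, f x = g x)
    (κ : ℕ) : ∀ x ∈ O, (lap M)^[κ] f x = (lap M)^[κ] g x := by
  induction κ with
  | zero => exact h
  | succ κ ih =>
    intro x hx
    rw [Function.iterate_succ_apply', Function.iterate_succ_apply']
    have h1 : (lap M)^[κ] f =ᶠ[𝓝 x] (lap M)^[κ] g := Filter.mem_of_superset (hO.mem_nhds hx) ih
    rw [lap, lap, h1.deriv.deriv_eq, h1.deriv_eq]

theorem timeLap_congr {I O : Set ℝ} (hI : IsOpen I) {U V : ℝ → ℝ → ℝ}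
    (h : ∀ t ∈ I, ∀ x ∈ O, U t x = V t x) (ι : ℕ) :
    ∀ t ∈ I, ∀ x ∈ O, timeLap^[ι] U t x = timeLap^[ι] V t x := by
  induction ι with
  | zero => exact h
  | succ ι ih =>
    intro t ht x hx
    rw [Function.iterate_succ_apply', Function.iterate_succ_apply']
    have h1 : (fun r => timeLap^[ι] U r x) =ᶠ[𝓝 t] fun r => timeLap^[ι] V r x :=
      Filter.mem_of_superset (hI.mem_nhds ht) fun r hr => ih r hr x hx
    rw [timeLap, timeLap, h1.deriv.deriv_eq]

theorem sharpNorm_congr {M T : ℝ} {U V : ℝ → ℝ → ℝ}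
    (h : ∀ t ∈ Ioo (-(2 * T)) (2 * T), ∀ x ∈ Ioo (0 : ℝ) 1, U t x = V t x) (ν : ℕ) :
    sharpNorm M T ν U = sharpNorm M T ν V := by
  unfold sharpNorm
  congr 1
  refine Finset.sum_congr rfl fun p _ => ?_
  refine setLIntegral_congr_fun measurableSet_Ioo fun t ht => l2Sq_congr ?_
  exact timeLap_congr isOpen_Ioo (fun r hr => lap_congr isOpen_Ioo (h r hr) p.2) p.1 t ht

theorem rpow_half_le {X Y : ℝ≥0∞} {K r : ℝ} (hK : 0 ≤ K) (hr : 0 ≤ r)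
    (h : X ≤ ENNReal.ofReal (K * r ^ 2) * Y) :
    X ^ (1 / 2 : ℝ) ≤ ENNReal.ofReal (√K) * ENNReal.ofReal r * Y ^ (1 / 2 : ℝ) := by
  refine (ENNReal.rpow_le_rpow h (by norm_num)).trans_eq ?_
  rw [ENNReal.mul_rpow_of_nonneg _ _ (by norm_num),
    ENNReal.ofReal_rpow_of_nonneg (by positivity) (by norm_num), ← Real.sqrt_eq_rpow,
    Real.sqrt_mul hK, Real.sqrt_sq hr, ENNReal.ofReal_mul (Real.sqrt_nonneg _)]

theorem truncation_low {M T : ℝ} (hT : 0 < T) (hM : 5 ≤ M) (ν k : ℕ) :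
    ∃ C : ℝ≥0, ∀ θ : ℝ≥0, ∀ U : ℝ → ℝ → ℝ, IsTest T U →
      sharpNorm M T (ν + k) (truncation M T θ U) ≤
        C * (θ : ℝ≥0∞) ^ k * sharpNorm M T ν U := by
  obtain ⟨K, hK, hKs⟩ := symbol_low hT hM ν k
  refine ⟨(√K).toNNReal, fun θ U hU => ?_⟩
  obtain ⟨G, hG, hUG⟩ := exists_testOn hU
  have hA : ∀ a ∈ indices (θ : ℝ), 1 ≤ a := fun a ha => (mem_indices.1 ha).1
  -- The truncation is written as zero minus a combination with the negated coefficients, and `U`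
  -- itself as a test function minus the empty combination.
  have h0 : TestOn T (fun _ _ => 0) :=
    ⟨contDiffOn_const, ∅, isCompact_empty, empty_subset _, fun _ _ _ => rfl⟩
  have hG0 : ∀ t, ∀ x ∈ Ioo (0 : ℝ) 1, G t x = G t x - comb M T ∅ (fun _ _ => 0) t x := by
    simp [comb]
  have hS : ∀ t, ∀ x ∈ Ioo (0 : ℝ) 1, truncation M T θ U t x =
      (fun _ _ => (0 : ℝ)) t x - comb M T (indices θ) (fun a b => -coeff M T U a b) t x := by
    intro t x _
    simp only [truncation, comb, zero_sub, ← Finset.sum_neg_distrib, neg_mul, neg_neg]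
  rw [sharpNorm_congr (fun t ht x hx => hUG t ht x (Ioo_subset_Ico_self hx)) ν]
  unfold sharpNorm
  rw [sharp_sum hT hM hA h0 hS, sharp_sum hT hM (by simp) hG hG0]
  have hz : ∀ a b, coeff M T (fun _ _ => 0) a b = 0 := by simp [coeff]
  have key := rpow_half_le (r := (θ : ℝ) ^ k) hK (by positivity)
    (X := ∑' b : ℕ, ∑' a : ℕ, ENNReal.ofReal
      (symbol (ν + k) (timeEig T (a + 1) ^ 2) (eigMu M (b + 1) ^ 2) *
        (coeff M T (fun _ _ => 0) (a + 1) (b + 1) -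
          if a + 1 ∈ indices (θ : ℝ) ∧ b + 1 ∈ indices (θ : ℝ) then
            -coeff M T U (a + 1) (b + 1) else 0) ^ 2))
    (Y := ∑' b : ℕ, ∑' a : ℕ, ENNReal.ofReal
      (symbol ν (timeEig T (a + 1) ^ 2) (eigMu M (b + 1) ^ 2) *
        (coeff M T G (a + 1) (b + 1) -
          if a + 1 ∈ (∅ : Finset ℕ) ∧ b + 1 ∈ (∅ : Finset ℕ) then 0 else 0) ^ 2)) ?_
  · refine key.trans_eq ?_
    rw [ENNReal.ofReal_pow θ.coe_nonneg, ENNReal.ofReal_coe_nnreal, ENNReal.ofReal]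
  · rw [← ENNReal.tsum_mul_left]
    refine ENNReal.tsum_le_tsum fun b => ?_
    rw [← ENNReal.tsum_mul_left]
    refine ENNReal.tsum_le_tsum fun a => ?_
    rw [← ENNReal.ofReal_mul (by positivity), hz, coeff_congr hT hUG]
    refine ENNReal.ofReal_le_ofReal ?_
    have hs := symbol_nonneg ν (sq_nonneg (timeEig T (a + 1))) (sq_nonneg (eigMu M (b + 1)))
    split_ifs with h1 h2 h2
    · simp at h2
    · have := hKs θ (a + 1) h1.1 (b + 1) h1.2
      rw [zero_sub, neg_neg, sub_zero, ← mul_assoc]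
      gcongr
    · simp at h2
    · have : 0 ≤ K * ((θ : ℝ) ^ k) ^ 2 := by positivity
      simp only [sub_zero, ne_eq, OfNat.ofNat_ne_zero, not_false_eq_true, zero_pow, mul_zero]
      positivity

/-- The power of `θ` stands on the left, so that nothing is divided by 0 when `θ = 0`. Coefficients
of the error vanish on retained indices and equal those of `U` elsewhere. -/
theorem truncation_high {M T : ℝ} (hT : 0 < T) (hM : 5 ≤ M) (ν k : ℕ) :
    ∃ C : ℝ≥0, ∀ θ : ℝ≥0, ∀ U : ℝ → ℝ → ℝ, IsTest T U →
      (θ : ℝ≥0∞) ^ k * sharpNorm M T ν (U - truncation M T θ U) ≤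
        C * sharpNorm M T (ν + k) U := by
  obtain ⟨K, hK, hKs⟩ := symbol_high hT hM ν k
  refine ⟨(√K).toNNReal, fun θ U hU => ?_⟩
  obtain ⟨G, hG, hUG⟩ := exists_testOn hU
  have hA : ∀ a ∈ indices (θ : ℝ), 1 ≤ a := fun a ha => (mem_indices.1 ha).1
  have hG0 : ∀ t, ∀ x ∈ Ioo (0 : ℝ) 1, G t x = G t x - comb M T ∅ (fun _ _ => 0) t x := by
    simp [comb]
  have hS : ∀ t, ∀ x ∈ Ioo (0 : ℝ) 1, G t x - truncation M T θ U t x =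
      G t x - comb M T (indices θ) (fun a b => coeff M T U a b) t x := fun t x _ => rfl
  rw [sharpNorm_congr (fun t ht x hx => hUG t ht x (Ioo_subset_Ico_self hx)) (ν + k),
    sharpNorm_congr (V := fun t x => G t x - truncation M T θ U t x)
      (fun t ht x hx => by
        simp only [Pi.sub_apply, hUG t ht x (Ioo_subset_Ico_self hx)]) ν]
  unfold sharpNorm
  rw [sharp_sum hT hM hA hG hS, sharp_sum hT hM (by simp) hG hG0]
  set X := ∑' b : ℕ, ∑' a : ℕ, ENNReal.ofReal
      (symbol ν (timeEig T (a + 1) ^ 2) (eigMu M (b + 1) ^ 2) *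
        (coeff M T G (a + 1) (b + 1) -
          if a + 1 ∈ indices (θ : ℝ) ∧ b + 1 ∈ indices (θ : ℝ) then
            coeff M T U (a + 1) (b + 1) else 0) ^ 2) with hX
  set Y := ∑' b : ℕ, ∑' a : ℕ, ENNReal.ofReal
      (symbol (ν + k) (timeEig T (a + 1) ^ 2) (eigMu M (b + 1) ^ 2) *
        (coeff M T G (a + 1) (b + 1) -
          if a + 1 ∈ (∅ : Finset ℕ) ∧ b + 1 ∈ (∅ : Finset ℕ) then 0 else 0) ^ 2) with hY
  have hXY : ENNReal.ofReal (((θ : ℝ) ^ k) ^ 2) * X ≤ ENNReal.ofReal (K * 1 ^ 2) * Y := by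
    rw [hX, hY, ← ENNReal.tsum_mul_left, ← ENNReal.tsum_mul_left]
    refine ENNReal.tsum_le_tsum fun b => ?_
    rw [← ENNReal.tsum_mul_left, ← ENNReal.tsum_mul_left]
    refine ENNReal.tsum_le_tsum fun a => ?_
    rw [← ENNReal.ofReal_mul (by positivity), ← ENNReal.ofReal_mul (by positivity),
      coeff_congr hT hUG]
    refine ENNReal.ofReal_le_ofReal ?_
    have hs := symbol_nonneg (ν + k) (sq_nonneg (timeEig T (a + 1))) (sq_nonneg (eigMu M (b + 1)))
    split_ifs with h1 h2 h2
    · simp at h2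
    · rw [sub_self, zero_pow two_ne_zero, mul_zero, mul_zero]
      positivity
    · simp at h2
    · have := hKs θ θ.2 (a + 1) (b + 1) (by omega) (by omega) h1
      rw [sub_zero, one_pow, mul_one, ← mul_assoc, ← mul_assoc]
      gcongr
  have h3 := rpow_half_le hK zero_le_one hXY
  rw [ENNReal.mul_rpow_of_nonneg _ _ (by norm_num),
    ENNReal.ofReal_rpow_of_nonneg (by positivity) (by norm_num), ← Real.sqrt_eq_rpow,
    Real.sqrt_sq (by positivity), ENNReal.ofReal_pow θ.coe_nonneg, ENNReal.ofReal_coe_nnreal,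
    ENNReal.ofReal_one, mul_one] at h3
  exact h3

theorem sharpNorm_mono {M T : ℝ} {ν ν' : ℕ} (h : ν ≤ ν') (U : ℝ → ℝ → ℝ) :
    sharpNorm M T ν U ≤ sharpNorm M T ν' U := by
  refine ENNReal.rpow_le_rpow (Finset.sum_le_sum_of_subset fun p hp => ?_) (by norm_num)
  exact mem_orders.2 ((mem_orders.1 hp).trans h)

/-- The estimates for the truncated double expansions. -/
theorem truncation_estimates {M T : ℝ} (hT : 0 < T) (hM : 5 ≤ M) {ν ν' : ℕ} (hν : ν ≤ ν') :
    ∃ C : ℝ≥0, ∀ θ : ℝ≥0, ∀ U : ℝ → ℝ → ℝ, IsTest T U →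
      sharpNorm M T ν' (truncation M T θ U) ≤
        C * (θ : ℝ≥0∞) ^ ((ν' : ℤ) - (ν : ℤ)) * sharpNorm M T ν U ∧
      sharpNorm M T ν (U - truncation M T θ U) ≤
        C * (θ : ℝ≥0∞) ^ ((ν : ℤ) - (ν' : ℤ)) * sharpNorm M T ν' U := by
  obtain ⟨k, rfl⟩ := Nat.exists_eq_add_of_le hν
  obtain ⟨C1, h1⟩ := truncation_low hT hM ν k
  obtain ⟨C2, h2⟩ := truncation_high hT hM ν k
  obtain ⟨C3, h3⟩ := truncation_high hT hM ν 0
  -- The summand 1 keeps the constant nonzero, so that the constant times `⊤` is `⊤` when `θ = 0`.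
  refine ⟨C1 + C2 + C3 + 1, fun θ U hU => ⟨?_, ?_⟩⟩
  · have e : (((ν + k : ℕ) : ℤ) - (ν : ℤ)) = (k : ℤ) := by push_cast; ring
    rw [e, zpow_natCast]
    refine (h1 θ U hU).trans ?_
    gcongr
    rw [add_assoc, add_assoc]
    exact le_self_add
  · have e : ((ν : ℤ) - ((ν + k : ℕ) : ℤ)) = -(k : ℤ) := by push_cast; ring
    rw [e]
    -- For `θ = 0` and `k = 0` the power is 1 and the bound of order `ν` by order `ν` applies. For
    -- `k > 0` the power is `⊤`: the bound is trivial unless the right-hand norm is 0, and then the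
    -- lower norm, and with it the error, vanishes.
    rcases eq_or_ne θ 0 with rfl | hθ
    · rcases eq_or_ne k 0 with rfl | hk
      · have := h3 0 U hU
        rw [pow_zero, one_mul] at this
        simp only [Nat.cast_zero, neg_zero, zpow_zero, mul_one]
        refine this.trans ?_
        gcongr
        exact le_add_self.trans le_self_add
      · have hinf : ((0 : ℝ≥0) : ℝ≥0∞) ^ (-(k : ℤ)) = ⊤ := by
          rw [ENNReal.coe_zero, ENNReal.zpow_neg, zpow_natCast, zero_pow hk, ENNReal.inv_zero]
        rw [hinf]
        have hne : ((C1 + C2 + C3 + 1 : ℝ≥0) : ℝ≥0∞) ≠ 0 := by simp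
        rw [ENNReal.mul_top hne]
        rcases eq_or_ne (sharpNorm M T (ν + k) U) 0 with h0 | h0
        · have h4 := h3 0 U hU
          rw [pow_zero, one_mul] at h4
          have h5 : sharpNorm M T (ν + 0) U = 0 :=
            le_antisymm ((sharpNorm_mono (by omega) U).trans h0.le) zero_le
          rw [h5, mul_zero] at h4
          exact h4.trans zero_le
        · rw [ENNReal.top_mul h0]
          exact le_top
    · have h4 := h2 θ U hU
      have hθ' : (θ : ℝ≥0∞) ^ k ≠ 0 := pow_ne_zero _ (by simpa using hθ)
      have hθt : (θ : ℝ≥0∞) ^ k ≠ ⊤ := by simp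
      rw [ENNReal.zpow_neg, zpow_natCast]
      have h5 : sharpNorm M T ν (U - truncation M T θ U) ≤
          ((θ : ℝ≥0∞) ^ k)⁻¹ * (C2 * sharpNorm M T (ν + k) U) := by
        rw [← ENNReal.div_eq_inv_mul, ENNReal.le_div_iff_mul_le (Or.inl hθ') (Or.inl hθt), mul_comm]
        exact h4
      refine h5.trans ?_
      rw [← mul_assoc, mul_comm ((θ : ℝ≥0∞) ^ k)⁻¹]
      gcongr
      exact le_add_self.trans (le_self_add.trans le_self_add)

/-! ### Square integrals in `[0, ∞]` -/

theorem ennreal_add_sq_le (a b : ℝ≥0∞) : (a + b) ^ 2 ≤ 2 * (a ^ 2 + b ^ 2) := by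
  rcases eq_or_ne a ⊤ with rfl | ha
  · simp
  rcases eq_or_ne b ⊤ with rfl | hb
  · simp
  lift a to ℝ≥0 using ha
  lift b to ℝ≥0 using hb
  exact_mod_cast (add_sq_le : (a + b) ^ 2 ≤ 2 * (a ^ 2 + b ^ 2))

theorem ennreal_sum_sq_le {ι : Type*} (s : Finset ι) (f : ι → ℝ≥0∞) :
    (∑ i ∈ s, f i) ^ 2 ≤ s.card * ∑ i ∈ s, f i ^ 2 := by
  by_cases h : ∀ i ∈ s, f i ≠ ⊤
  · have e : ∀ i ∈ s, f i = ((f i).toNNReal : ℝ≥0∞) := fun i hi => (ENNReal.coe_toNNReal (h i hi)).symm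
    have h2 : ∑ i ∈ s, f i ^ 2 = ((∑ i ∈ s, (f i).toNNReal ^ 2 : ℝ≥0) : ℝ≥0∞) := by
      push_cast
      exact Finset.sum_congr rfl fun i hi => by rw [← e i hi]
    rw [Finset.sum_congr rfl e, h2]
    exact_mod_cast sq_sum_le_card_mul_sum_sq (s := s) (f := fun i => (f i).toNNReal)
  · push Not at h
    obtain ⟨i, hi, hfi⟩ := h
    have h1 : ∑ i ∈ s, f i ^ 2 = ⊤ := ENNReal.sum_eq_top.2 ⟨i, hi, by simp [hfi]⟩
    have h2 : (s.card : ℝ≥0∞) ≠ 0 := by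
      simpa using Finset.ne_empty_of_mem hi
    rw [h1, ENNReal.mul_top h2]
    exact le_top

theorem lintegral_mul_sq_le {α : Type*} [MeasurableSpace α] (μ : Measure α) {f g : α → ℝ≥0∞}
    (hf : AEMeasurable f μ) (hg : AEMeasurable g μ) :
    (∫⁻ x, f x * g x ∂μ) ^ 2 ≤ (∫⁻ x, f x ^ 2 ∂μ) * ∫⁻ x, g x ^ 2 ∂μ := by
  have h := ENNReal.lintegral_mul_le_Lp_mul_Lq μ (Real.HolderConjugate.two_two) hf hg
  have h2 := ENNReal.rpow_le_rpow h (z := 2) (by norm_num)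
  rw [ENNReal.mul_rpow_of_nonneg _ _ (by norm_num), ← ENNReal.rpow_mul, ← ENNReal.rpow_mul] at h2
  norm_num at h2
  exact h2

theorem enorm_sq_eq (x : ℝ) : ‖x‖ₑ ^ 2 = ENNReal.ofReal (x ^ 2) := by
  rw [Real.enorm_eq_ofReal_abs, ← ENNReal.ofReal_pow (abs_nonneg _), sq_abs]

theorem aemeasurable_of_continuousOn {f : ℝ → ℝ} {s : Set ℝ} (hs : MeasurableSet s)
    (hf : ContinuousOn f s) : AEMeasurable (fun x => ‖f x‖ₑ) (volume.restrict s) :=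
  (hf.aestronglyMeasurable hs).enorm

/-! ### Second order operators in one variable -/

/-- The operator `A d²/dx² + B d/dx`. -/
noncomputable def dop (A B : ℝ → ℝ) (f : ℝ → ℝ) (x : ℝ) : ℝ :=
  A x * deriv (deriv f) x + B x * deriv f x

theorem smooth_deriv {O : Set ℝ} (hO : IsOpen O) {f : ℝ → ℝ} (hf : ContDiffOn ℝ ∞ f O) :
    ContDiffOn ℝ ∞ (deriv f) O := hf.deriv_of_isOpen hO (by simp)

theorem smooth_hasDerivAt {O : Set ℝ} (hO : IsOpen O) {f : ℝ → ℝ} (hf : ContDiffOn ℝ ∞ f O) {x : ℝ}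
    (hx : x ∈ O) : HasDerivAt f (deriv f x) x :=
  ((hf.differentiableOn (by simp)).differentiableAt (hO.mem_nhds hx)).hasDerivAt

theorem smooth_dop {O : Set ℝ} (hO : IsOpen O) {A B f : ℝ → ℝ} (hA : ContDiffOn ℝ ∞ A O)
    (hB : ContDiffOn ℝ ∞ B O) (hf : ContDiffOn ℝ ∞ f O) : ContDiffOn ℝ ∞ (dop A B f) O :=
  (hA.mul (smooth_deriv hO (smooth_deriv hO hf))).add (hB.mul (smooth_deriv hO hf))

theorem smooth_dop_iterate {O : Set ℝ} (hO : IsOpen O) {A B f : ℝ → ℝ} (hA : ContDiffOn ℝ ∞ A O)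
    (hB : ContDiffOn ℝ ∞ B O) (hf : ContDiffOn ℝ ∞ f O) (k : ℕ) :
    ContDiffOn ℝ ∞ ((dop A B)^[k] f) O := by
  induction k with
  | zero => exact hf
  | succ k ih =>
    rw [Function.iterate_succ_apply']
    exact smooth_dop hO hA hB ih

theorem dop_congr {O : Set ℝ} (hO : IsOpen O) {A B f g : ℝ → ℝ} (h : ∀ x ∈ O, f x = g x) (k : ℕ) :
    ∀ x ∈ O, (dop A B)^[k] f x = (dop A B)^[k] g x := by
  induction k with
  | zero => exact h
  | succ k ih =>
    intro x hx
    rw [Function.iterate_succ_apply', Function.iterate_succ_apply']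
    have h1 : (dop A B)^[k] f =ᶠ[𝓝 x] (dop A B)^[k] g := Filter.mem_of_superset (hO.mem_nhds hx) ih
    rw [dop, dop, h1.deriv.deriv_eq, h1.deriv_eq]

theorem dop_add {O : Set ℝ} (hO : IsOpen O) {A B f g : ℝ → ℝ} (hA : ContDiffOn ℝ ∞ A O)
    (hB : ContDiffOn ℝ ∞ B O) (hf : ContDiffOn ℝ ∞ f O) (hg : ContDiffOn ℝ ∞ g O) (k : ℕ) :
    ∀ x ∈ O, (dop A B)^[k] (fun x => f x + g x) x = (dop A B)^[k] f x + (dop A B)^[k] g x := by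
  induction k with
  | zero => exact fun x _ => rfl
  | succ k ih =>
    intro x hx
    rw [Function.iterate_succ_apply', Function.iterate_succ_apply', Function.iterate_succ_apply']
    have h1 := smooth_dop_iterate hO hA hB hf k
    have h2 := smooth_dop_iterate hO hA hB hg k
    have d1 : ∀ y ∈ O, HasDerivAt ((dop A B)^[k] (fun x => f x + g x))
        (deriv ((dop A B)^[k] f) y + deriv ((dop A B)^[k] g) y) y := fun y hy =>
      ((smooth_hasDerivAt hO h1 hy).add (smooth_hasDerivAt hO h2 hy)).congr_of_eventuallyEq
        (Filter.mem_of_superset (hO.mem_nhds hy) ih)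
    have d2 : ∀ y ∈ O, HasDerivAt (fun y => deriv ((dop A B)^[k] f) y + deriv ((dop A B)^[k] g) y)
        (deriv (deriv ((dop A B)^[k] f)) y + deriv (deriv ((dop A B)^[k] g)) y) y := fun y hy =>
      (smooth_hasDerivAt hO (smooth_deriv hO h1) hy).add
        (smooth_hasDerivAt hO (smooth_deriv hO h2) hy)
    rw [dop, dop, dop, deriv2_eq hO d1 d2 hx, (d1 x hx).deriv]
    ring

/-- The functions `f`, `f'`, `L f`, `(L f)'`, `L² f`, … for `L = A d²/dx² + B d/dx`. -/
noncomputable def jet (A B : ℝ → ℝ) : ℕ → (ℝ → ℝ) → ℝ → ℝ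
  | 0, f => f
  | 1, f => deriv f
  | n + 2, f => jet A B n (dop A B f)

theorem jet_even (A B : ℝ → ℝ) (k : ℕ) (f : ℝ → ℝ) : jet A B (2 * k) f = (dop A B)^[k] f := by
  induction k generalizing f with
  | zero => rfl
  | succ k ih => rw [Function.iterate_succ_apply, ← ih, mul_add]; rfl

theorem jet_odd (A B : ℝ → ℝ) (k : ℕ) (f : ℝ → ℝ) :
    jet A B (2 * k + 1) f = deriv ((dop A B)^[k] f) := by
  induction k generalizing f with
  | zero => rfl
  | succ k ih => rw [Function.iterate_succ_apply, ← ih, mul_add]; rfl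

/-- Open sets and coefficients for which `A d²/dx² + B d/dx` is a regular operator. -/
structure RegularOp (O O' : Set ℝ) (A B : ℝ → ℝ) : Prop where
  isOpen : IsOpen O
  isOpen' : IsOpen O'
  sub : O ⊆ O'
  smoothA : ContDiffOn ℝ ∞ A O'
  smoothB : ContDiffOn ℝ ∞ B O'
  ne : ∀ x ∈ O', A x ≠ 0

namespace RegularOp

variable {O O' : Set ℝ} {A B : ℝ → ℝ}

theorem smooth_dop (R : RegularOp O O' A B) {f : ℝ → ℝ} (hf : ContDiffOn ℝ ∞ f O) :
    ContDiffOn ℝ ∞ (dop A B f) O :=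
  Smoothing.smooth_dop R.isOpen (R.smoothA.mono R.sub) (R.smoothB.mono R.sub) hf

theorem smooth_jet (R : RegularOp O O' A B) (n : ℕ) {f : ℝ → ℝ} (hf : ContDiffOn ℝ ∞ f O) :
    ContDiffOn ℝ ∞ (jet A B n f) O := by
  induction n using Nat.twoStepInduction generalizing f with
  | zero => exact hf
  | one => exact smooth_deriv R.isOpen hf
  | more n ih _ => exact ih (R.smooth_dop hf)

/-- Since `A ≠ 0`, the equation `L f = A f'' + B f'` can be solved for `f''`, so differentiating a
jet leads only to that jet and the next one. The coefficients do not depend on `f`. -/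
theorem deriv_jet (R : RegularOp O O' A B) (n : ℕ) : ∃ γ δ : ℝ → ℝ, ContDiffOn ℝ ∞ γ O' ∧
    ContDiffOn ℝ ∞ δ O' ∧ ∀ f, ContDiffOn ℝ ∞ f O → ∀ x ∈ O,
      deriv (jet A B n f) x = γ x * jet A B (n + 1) f x + δ x * jet A B n f x := by
  induction n using Nat.twoStepInduction with
  | zero =>
    refine ⟨fun _ => 1, fun _ => 0, contDiffOn_const, contDiffOn_const, fun f _ x _ => ?_⟩
    simp [jet]
  | one =>
    refine ⟨fun x => (A x)⁻¹, fun x => -(B x * (A x)⁻¹), R.smoothA.inv R.ne,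
      (R.smoothB.mul (R.smoothA.inv R.ne)).neg, fun f _ x hx => ?_⟩
    have := R.ne x (R.sub hx)
    simp only [jet, dop]
    field_simp
    ring
  | more n ih _ =>
    obtain ⟨γ, δ, h1, h2, h3⟩ := ih
    exact ⟨γ, δ, h1, h2, fun f hf x hx => h3 _ (R.smooth_dop hf) x hx⟩

/-- `P` is a combination, with coefficients smooth on `O'`, of the first `n` jets. -/
def IsComb (_ : RegularOp O O' A B) (n : ℕ) (P : (ℝ → ℝ) → ℝ → ℝ) : Prop :=
  ∃ α : ℕ → ℝ → ℝ, (∀ i, ContDiffOn ℝ ∞ (α i) O') ∧ ∀ f, ContDiffOn ℝ ∞ f O → ∀ x ∈ O,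
    P f x = ∑ i ∈ Finset.range (n + 1), α i x * jet A B i f x

namespace IsComb

variable {R : RegularOp O O' A B} {n : ℕ} {P Q : (ℝ → ℝ) → ℝ → ℝ}

theorem congr (h : R.IsComb n P)
    (h' : ∀ f, ContDiffOn ℝ ∞ f O → ∀ x ∈ O, Q f x = P f x) : R.IsComb n Q := by
  obtain ⟨α, h1, h2⟩ := h
  exact ⟨α, h1, fun f hf x hx => (h' f hf x hx).trans (h2 f hf x hx)⟩

theorem add (hP : R.IsComb n P) (hQ : R.IsComb n Q) :
    R.IsComb n (fun f x => P f x + Q f x) := by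
  obtain ⟨α, h1, h2⟩ := hP
  obtain ⟨β, k1, k2⟩ := hQ
  refine ⟨fun i x => α i x + β i x, fun i => (h1 i).add (k1 i), fun f hf x hx => ?_⟩
  simp only [h2 f hf x hx, k2 f hf x hx, ← Finset.sum_add_distrib, add_mul]

theorem fun_mul (hP : R.IsComb n P) {c : ℝ → ℝ} (hc : ContDiffOn ℝ ∞ c O') :
    R.IsComb n (fun f x => c x * P f x) := by
  obtain ⟨α, h1, h2⟩ := hP
  refine ⟨fun i x => c x * α i x, fun i => hc.mul (h1 i), fun f hf x hx => ?_⟩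
  simp only [h2 f hf x hx, Finset.mul_sum, mul_assoc]

theorem jet (R : RegularOp O O' A B) {i n : ℕ} (hi : i ≤ n) : R.IsComb n (jet A B i) := by
  refine ⟨fun j _ => if j = i then 1 else 0, fun j => contDiffOn_const, fun f _ x _ => ?_⟩
  simp [Nat.lt_succ_of_le hi]

theorem sum {ι : Type*} (s : Finset ι) {P : ι → (ℝ → ℝ) → ℝ → ℝ} (h : ∀ i ∈ s, R.IsComb n (P i)) :
    R.IsComb n (fun f x => ∑ i ∈ s, P i f x) := by
  choose! α h1 h2 using h
  refine ⟨fun j x => ∑ i ∈ s, α i j x, fun j => ContDiffOn.sum fun i hi => h1 i hi j,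
    fun f hf x hx => ?_⟩
  simp only [Finset.sum_mul]
  rw [Finset.sum_comm]
  exact Finset.sum_congr rfl fun i hi => h2 i hi f hf x hx

theorem deriv (hP : R.IsComb n P) : R.IsComb (n + 1) (fun f => deriv (P f)) := by
  obtain ⟨α, h1, h2⟩ := hP
  choose γ δ hγ hδ hj using R.deriv_jet
  have key : R.IsComb (n + 1) (fun f x => ∑ i ∈ Finset.range (n + 1),
      ((_root_.deriv (α i) x + α i x * δ i x) * Smoothing.jet A B i f x +
        α i x * γ i x * Smoothing.jet A B (i + 1) f x)) := by
    refine sum _ fun i hi => ?_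
    have hi' := Finset.mem_range.1 hi
    exact ((jet R (by omega)).fun_mul ((smooth_deriv R.isOpen' (h1 i)).add ((h1 i).mul (hδ i)))).add
      ((jet R (by omega)).fun_mul ((h1 i).mul (hγ i)))
  refine key.congr fun f hf x hx => ?_
  have hev : P f =ᶠ[𝓝 x] fun x => ∑ i ∈ Finset.range (n + 1), α i x * Smoothing.jet A B i f x :=
    Filter.mem_of_superset (R.isOpen.mem_nhds hx) fun y hy => h2 f hf y hy
  have hd : HasDerivAt (fun x => ∑ i ∈ Finset.range (n + 1), α i x * Smoothing.jet A B i f x)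
      (∑ i ∈ Finset.range (n + 1), (_root_.deriv (α i) x * Smoothing.jet A B i f x +
        α i x * _root_.deriv (Smoothing.jet A B i f) x)) x :=
    HasDerivAt.fun_sum fun i _ => (smooth_hasDerivAt R.isOpen' (h1 i) (R.sub hx)).mul
      (smooth_hasDerivAt R.isOpen (R.smooth_jet i hf) hx)
  rw [hev.deriv_eq, hd.deriv]
  refine Finset.sum_congr rfl fun i _ => ?_
  rw [hj i f hf x hx]
  ring

theorem mono {m : ℕ} (hP : R.IsComb n P) (hm : n ≤ m) : R.IsComb m P := by
  obtain ⟨α, h1, h2⟩ := hP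
  have key : R.IsComb m (fun f x => ∑ i ∈ Finset.range (n + 1), α i x * Smoothing.jet A B i f x) :=
    sum _ fun i hi => (jet R (by have := Finset.mem_range.1 hi; omega)).fun_mul (h1 i)
  exact key.congr h2

theorem dop {A' B' : ℝ → ℝ} (hA' : ContDiffOn ℝ ∞ A' O') (hB' : ContDiffOn ℝ ∞ B' O')
    (hP : R.IsComb n P) : R.IsComb (n + 2) (fun f => dop A' B' (P f)) :=
  (hP.deriv.deriv.fun_mul hA').add ((hP.deriv.mono (by omega)).fun_mul hB')

/-- Leibniz' rule and `deriv_jet` express `(A' d² + B' d)^m (ζ f)` through the jets of the reference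
operator up to order `2m`. Only the reference operator must be nondegenerate; `A'` may vanish. -/
theorem dop_iterate {A' B' ζ : ℝ → ℝ} (hA' : ContDiffOn ℝ ∞ A' O') (hB' : ContDiffOn ℝ ∞ B' O')
    (hζ : ContDiffOn ℝ ∞ ζ O') (m : ℕ) :
    R.IsComb (2 * m) (fun f => (Smoothing.dop A' B')^[m] (fun x => ζ x * f x)) := by
  induction m with
  | zero => exact (jet R le_rfl).fun_mul hζ
  | succ m ih =>
    simp only [Function.iterate_succ_apply']
    exact ih.dop hA' hB'

end IsComb

end RegularOp

/-! ### Interior estimates -/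

/-- A bounded interval on which the first derivative can be estimated through the operator. -/
structure InteriorOp (O O' : Set ℝ) (A B ρ : ℝ → ℝ) (a b : ℝ) : Prop extends
    RegularOp O O' A B where
  lt : a < b
  sub1 : Ioo a b ⊆ O
  sub2 : Icc a b ⊆ O'
  contρ : ContinuousOn ρ (Icc a b)
  posρ : ∀ x ∈ Icc a b, 0 < ρ x
  derivρ : ∀ x ∈ Ioo a b, HasDerivAt ρ (ρ x * B x / A x) x

theorem exists_sq_le {f : ℝ → ℝ} {a b : ℝ} (hab : a < b) (hf : ContinuousOn f (Ioo a b)) :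
    ∃ x ∈ Ioo a b, ‖f x‖ₑ ^ 2 ≤ ENNReal.ofReal (b - a)⁻¹ * ∫⁻ y in Ioo a b, ‖f y‖ₑ ^ 2 := by
  obtain ⟨x, hx, h⟩ := exists_le_setLAverage (μ := volume) (s := Ioo a b)
    (f := fun x => ‖f x‖ₑ ^ 2) (by simp [hab]) (by simp)
    ((aemeasurable_of_continuousOn measurableSet_Ioo hf).pow_const 2)
  refine ⟨x, hx, h.trans_eq ?_⟩
  rw [setLAverage_eq, Real.volume_Ioo, ENNReal.div_eq_inv_mul,
    ENNReal.ofReal_inv_of_pos (by linarith)]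

theorem enorm_le_of_abs_le {x : ℝ} {c : ℝ} (h : |x| ≤ c) : ‖x‖ₑ ≤ ENNReal.ofReal c := by
  rw [Real.enorm_eq_ofReal_abs]
  exact ENNReal.ofReal_le_ofReal h

namespace InteriorOp

variable {O O' : Set ℝ} {A B ρ : ℝ → ℝ} {a b : ℝ}

/-- With the integrating factor, `(ρ g')' = (ρ / A) L g`. So `g'` is controlled everywhere by its
value at one point and the `L¹` norm of `L g`. No boundary condition and no regularity of `g` up to
the ends is used. -/
theorem deriv_bound (S : InteriorOp O O' A B ρ a b) :
    ∃ C : ℝ≥0, ∀ g, ContDiffOn ℝ ∞ g O → ∫⁻ x in Ioo a b, ‖deriv g x‖ₑ ^ 2 ≤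
      C * ((∫⁻ x in Ioo a b, ‖g x‖ₑ ^ 2) + ∫⁻ x in Ioo a b, ‖dop A B g x‖ₑ ^ 2) := by
  have hab := S.lt
  set l := (b - a) / 3 with hl
  have hlpos : 0 < l := by rw [hl]; linarith
  have hσc : ContinuousOn (fun x => ρ x / A x) (Icc a b) :=
    S.contρ.div (S.smoothA.continuousOn.mono S.sub2) fun x hx => S.ne x (S.sub2 hx)
  obtain ⟨s, hs⟩ := isCompact_Icc.exists_bound_of_continuousOn hσc
  obtain ⟨r1, hr1⟩ := isCompact_Icc.exists_bound_of_continuousOn S.contρ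
  have hinvc : ContinuousOn (fun x => (ρ x)⁻¹) (Icc a b) := S.contρ.inv₀ fun x hx => (S.posρ x hx).ne'
  obtain ⟨r0, hr0⟩ := isCompact_Icc.exists_bound_of_continuousOn hinvc
  set c1 : ℝ≥0∞ := ENNReal.ofReal r0 ^ 2 * (2 * (ENNReal.ofReal r1 ^ 2 * (ENNReal.ofReal l⁻¹ ^ 2 *
    (2 * (ENNReal.ofReal l⁻¹ + ENNReal.ofReal l⁻¹))) + ENNReal.ofReal s ^ 2 * ENNReal.ofReal (b - a)))
    with hc1
  have hc1t : c1 * ENNReal.ofReal (b - a) ≠ ⊤ := by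
    rw [hc1]; finiteness
  refine ⟨(c1 * ENNReal.ofReal (b - a)).toNNReal, fun g hg => ?_⟩
  rw [ENNReal.coe_toNNReal hc1t]
  set I0 := ∫⁻ x in Ioo a b, ‖g x‖ₑ ^ 2 with hI0
  set I1 := ∫⁻ x in Ioo a b, ‖dop A B g x‖ₑ ^ 2 with hI1
  have hgc : ContinuousOn g (Ioo a b) := hg.continuousOn.mono S.sub1
  have hLc : ContinuousOn (dop A B g) (Ioo a b) :=
    (S.toRegularOp.smooth_dop hg).continuousOn.mono S.sub1
  -- In each outer third some value of `g²` is at most its average. The mean value theorem between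
  -- these two points, which are at least `l` apart, produces a point `y` where `g'` is bounded by
  -- the `L²` norm of `g`.
  obtain ⟨η, hη, hηg⟩ := exists_sq_le (f := g) (a := a) (b := a + l) (by linarith)
    (hgc.mono (Ioo_subset_Ioo_right (by linarith)))
  obtain ⟨ξ, hξ, hξg⟩ := exists_sq_le (f := g) (a := b - l) (b := b) (by linarith)
    (hgc.mono (Ioo_subset_Ioo_left (by linarith)))
  have hηξ : l ≤ ξ - η := by have := hη.2; have := hξ.1; linarith
  have hsubJ : Icc η ξ ⊆ Ioo a b := fun x hx => ⟨hη.1.trans_le hx.1, hx.2.trans_lt hξ.2⟩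
  obtain ⟨y, hy, hyg⟩ := exists_hasDerivAt_eq_slope g (deriv g) (by linarith : η < ξ)
    (hgc.mono hsubJ) fun x hx => smooth_hasDerivAt S.isOpen hg (S.sub1 (hsubJ (Ioo_subset_Icc_self hx)))
  have hyJ : y ∈ Ioo a b := hsubJ (Ioo_subset_Icc_self hy)
  have bη : ‖g η‖ₑ ^ 2 ≤ ENNReal.ofReal l⁻¹ * I0 := by
    refine hηg.trans ?_
    rw [add_sub_cancel_left]
    gcongr
    exact lintegral_mono_set (Ioo_subset_Ioo_right (by linarith))
  have bξ : ‖g ξ‖ₑ ^ 2 ≤ ENNReal.ofReal l⁻¹ * I0 := by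
    refine hξg.trans ?_
    rw [sub_sub_cancel]
    gcongr
    exact lintegral_mono_set (Ioo_subset_Ioo_left (by linarith))
  have by' : ‖deriv g y‖ₑ ^ 2 ≤ ENNReal.ofReal l⁻¹ ^ 2 *
      (2 * (ENNReal.ofReal l⁻¹ + ENNReal.ofReal l⁻¹)) * I0 := by
    rw [hyg, div_eq_inv_mul, enorm_mul, mul_pow, mul_assoc]
    have h1 : ‖(ξ - η)⁻¹‖ₑ ≤ ENNReal.ofReal l⁻¹ := by
      refine enorm_le_of_abs_le ?_
      rw [abs_of_pos (inv_pos.2 (by linarith))]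
      exact inv_anti₀ hlpos hηξ
    have h2 : ‖g ξ - g η‖ₑ ^ 2 ≤ 2 * (ENNReal.ofReal l⁻¹ + ENNReal.ofReal l⁻¹) * I0 := by
      refine (pow_le_pow_left₀ zero_le (enorm_sub_le) 2).trans ?_
      refine (ennreal_add_sq_le _ _).trans ?_
      rw [mul_assoc, add_mul]
      gcongr
    gcongr
  have hpoint : ∀ x ∈ Ioo a b, ‖deriv g x‖ₑ ^ 2 ≤ c1 * (I0 + I1) := by
    intro x hx
    have hder : ∀ z ∈ Ioo a b, HasDerivAt (fun z => ρ z * deriv g z) (ρ z / A z * dop A B g z) z := by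
      intro z hz
      have hA := S.ne z (S.sub (S.sub1 hz))
      refine ((S.derivρ z hz).mul (smooth_hasDerivAt S.isOpen (smooth_deriv S.isOpen hg)
        (S.sub1 hz))).congr_deriv ?_
      rw [dop]
      field_simp
      ring
    have hsub : uIcc y x ⊆ Ioo a b := ordConnected_Ioo.uIcc_subset hyJ hx
    have hFc : ContinuousOn (fun z => ρ z / A z * dop A B g z) (Ioo a b) :=
      (hσc.mono Ioo_subset_Icc_self).mul hLc
    have hFTC := intervalIntegral.integral_eq_sub_of_hasDerivAt (fun z hz => hder z (hsub hz))
      (hFc.mono hsub).intervalIntegrable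
    have h1 : ‖∫ z in y..x, ρ z / A z * dop A B g z‖ₑ ≤
        ENNReal.ofReal s * ∫⁻ z in Ioo a b, ‖dop A B g z‖ₑ := by
      rw [← lintegral_const_mul' _ _ (by simp)]
      have h2 : ‖∫ z in y..x, ρ z / A z * dop A B g z‖ₑ =
          ‖∫ z in uIoc y x, ρ z / A z * dop A B g z‖ₑ := by
        rw [← ofReal_norm, ← ofReal_norm, intervalIntegral.norm_intervalIntegral_eq]
      rw [h2]
      refine (enorm_integral_le_lintegral_enorm _).trans ?_
      refine (lintegral_mono_set (uIoc_subset_uIcc.trans hsub)).trans ?_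
      refine setLIntegral_mono' measurableSet_Ioo fun z hz => ?_
      rw [enorm_mul]
      gcongr
      exact enorm_le_of_abs_le (hs z (Ioo_subset_Icc_self hz))
    -- Cauchy–Schwarz against the constant 1.
    have h2 : (∫⁻ z in Ioo a b, ‖dop A B g z‖ₑ) ^ 2 ≤ ENNReal.ofReal (b - a) * I1 := by
      have := lintegral_mul_sq_le (volume.restrict (Ioo a b)) (f := fun _ => 1)
        (g := fun z => ‖dop A B g z‖ₑ) aemeasurable_const
        (aemeasurable_of_continuousOn measurableSet_Ioo hLc)
      simpa using this
    have h3 : deriv g x = (ρ x)⁻¹ * (ρ y * deriv g y + ∫ z in y..x, ρ z / A z * dop A B g z) := by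
      rw [hFTC]
      have := (S.posρ x (Ioo_subset_Icc_self hx)).ne'
      field_simp
      ring
    rw [h3, enorm_mul, mul_pow]
    have h4 : ‖(ρ x)⁻¹‖ₑ ≤ ENNReal.ofReal r0 :=
      enorm_le_of_abs_le (hr0 x (Ioo_subset_Icc_self hx))
    have h5 : ‖ρ y‖ₑ ≤ ENNReal.ofReal r1 := enorm_le_of_abs_le (hr1 y (Ioo_subset_Icc_self hyJ))
    have h6 : ‖ρ y * deriv g y + ∫ z in y..x, ρ z / A z * dop A B g z‖ₑ ^ 2 ≤
        2 * (ENNReal.ofReal r1 ^ 2 * (ENNReal.ofReal l⁻¹ ^ 2 *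
          (2 * (ENNReal.ofReal l⁻¹ + ENNReal.ofReal l⁻¹)) * I0) +
          ENNReal.ofReal s ^ 2 * (ENNReal.ofReal (b - a) * I1)) := by
      refine (pow_le_pow_left₀ zero_le (enorm_add_le _ _) 2).trans ?_
      refine (ennreal_add_sq_le _ _).trans ?_
      rw [enorm_mul, mul_pow]
      gcongr
      refine (pow_le_pow_left₀ zero_le h1 2).trans ?_
      rw [mul_pow]
      gcongr
    refine (mul_le_mul' (pow_le_pow_left₀ zero_le h4 2) h6).trans ?_
    rw [hc1]
    generalize ENNReal.ofReal l⁻¹ ^ 2 * (2 * (ENNReal.ofReal l⁻¹ + ENNReal.ofReal l⁻¹)) = q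
    rw [mul_assoc, mul_assoc]
    gcongr
    rw [← mul_assoc, ← mul_assoc (ENNReal.ofReal s ^ 2), add_mul]
    gcongr
    · exact le_self_add
    · exact le_add_self
  refine (setLIntegral_mono' measurableSet_Ioo hpoint).trans_eq ?_
  rw [setLIntegral_const, Real.volume_Ioo]
  ring

/-- Even jets are powers of the operator; an odd jet is the derivative of such a power and is
handled by `deriv_bound`, using the next power, which still has order at most `m`. -/
theorem jet_bound (S : InteriorOp O O' A B ρ a b) (m : ℕ) :
    ∃ C : ℝ≥0, ∀ f, ContDiffOn ℝ ∞ f O → ∀ i ≤ 2 * m, ∫⁻ x in Ioo a b, ‖jet A B i f x‖ₑ ^ 2 ≤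
      C * ∑ k ∈ Finset.range (m + 1), ∫⁻ x in Ioo a b, ‖(dop A B)^[k] f x‖ₑ ^ 2 := by
  obtain ⟨C, hC⟩ := S.deriv_bound
  refine ⟨2 * C + 1, fun f hf i hi => ?_⟩
  set tot := ∑ k ∈ Finset.range (m + 1), ∫⁻ x in Ioo a b, ‖(dop A B)^[k] f x‖ₑ ^ 2
  have hterm : ∀ k ≤ m, ∫⁻ x in Ioo a b, ‖(dop A B)^[k] f x‖ₑ ^ 2 ≤ tot := fun k hk =>
    Finset.single_le_sum (f := fun k => ∫⁻ x in Ioo a b, ‖(dop A B)^[k] f x‖ₑ ^ 2)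
      (fun _ _ => zero_le) (Finset.mem_range.2 (by omega))
  rcases Nat.even_or_odd' i with ⟨k, rfl | rfl⟩
  · rw [jet_even]
    refine (hterm k (by omega)).trans ?_
    push_cast
    rw [add_mul, one_mul]
    exact le_add_self
  · rw [jet_odd]
    have hs : ContDiffOn ℝ ∞ ((dop A B)^[k] f) O := by
      rw [← jet_even]; exact S.toRegularOp.smooth_jet _ hf
    refine (hC _ hs).trans ?_
    rw [← Function.iterate_succ_apply' (dop A B) k f]
    have h1 := hterm k (by omega)
    have h2 := hterm (k + 1) (by omega)
    calc (C : ℝ≥0∞) * _ ≤ C * (tot + tot) := by gcongr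
      _ ≤ _ := by
        push_cast
        rw [add_mul, one_mul, ← two_mul, ← mul_assoc, mul_comm (C : ℝ≥0∞)]
        exact le_self_add

theorem comb_bound (S : InteriorOp O O' A B ρ a b) {m : ℕ} {P : (ℝ → ℝ) → ℝ → ℝ}
    (hP : S.toRegularOp.IsComb (2 * m) P) :
    ∃ C : ℝ≥0, ∀ f, ContDiffOn ℝ ∞ f O → ∫⁻ x in Ioo a b, ‖P f x‖ₑ ^ 2 ≤
      C * ∑ k ∈ Finset.range (m + 1), ∫⁻ x in Ioo a b, ‖(dop A B)^[k] f x‖ₑ ^ 2 := by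
  obtain ⟨α, hα, hPα⟩ := hP
  obtain ⟨C, hC⟩ := S.jet_bound m
  have hb : ∀ i, ∃ c, ∀ x ∈ Icc a b, ‖α i x‖ ≤ c := fun i =>
    isCompact_Icc.exists_bound_of_continuousOn ((hα i).continuousOn.mono S.sub2)
  choose c hc using hb
  refine ⟨(2 * m + 1 : ℕ) * ∑ i ∈ Finset.range (2 * m + 1), (c i).toNNReal ^ 2 * C, fun f hf => ?_⟩
  set tot := ∑ k ∈ Finset.range (m + 1), ∫⁻ x in Ioo a b, ‖(dop A B)^[k] f x‖ₑ ^ 2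
  have h1 : ∀ x ∈ Ioo a b, ‖P f x‖ₑ ^ 2 ≤ ((2 * m + 1 : ℕ) : ℝ≥0∞) *
      ∑ i ∈ Finset.range (2 * m + 1), ENNReal.ofReal (c i) ^ 2 * ‖jet A B i f x‖ₑ ^ 2 := by
    intro x hx
    rw [hPα f hf x (S.sub1 hx)]
    refine (pow_le_pow_left₀ zero_le (enorm_sum_le _ _) 2).trans ?_
    refine (ennreal_sum_sq_le _ _).trans ?_
    rw [Finset.card_range]
    gcongr with i _
    rw [enorm_mul, mul_pow]
    gcongr
    exact enorm_le_of_abs_le (hc i x (Ioo_subset_Icc_self hx))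
  refine (setLIntegral_mono' measurableSet_Ioo h1).trans ?_
  rw [lintegral_const_mul' _ _ (ENNReal.natCast_ne_top _), lintegral_finsetSum' _ fun i _ =>
    ((aemeasurable_of_continuousOn measurableSet_Ioo
      ((S.toRegularOp.smooth_jet i hf).continuousOn.mono S.sub1)).pow_const 2).const_mul _]
  push_cast
  rw [mul_assoc, Finset.sum_mul]
  gcongr with i hi
  rw [lintegral_const_mul' _ _ (by finiteness), mul_assoc]
  have := Finset.mem_range.1 hi
  gcongr
  · exact le_rfl
  · exact hC f hf i (by omega)

end InteriorOp

/-! ### Cut-offs and changes of the chart in the space variable -/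

theorem lap_eq_dop (M : ℝ) : lap M = dop (fun x => x) (fun _ => M / 2) := rfl

theorem smooth_lap_iterate (M : ℝ) {O : Set ℝ} (hO : IsOpen O) {f : ℝ → ℝ}
    (hf : ContDiffOn ℝ ∞ f O) (k : ℕ) : ContDiffOn ℝ ∞ ((lap M)^[k] f) O := by
  rw [lap_eq_dop]
  exact smooth_dop_iterate hO contDiffOn_id contDiffOn_const hf k

/-- On `]1/3, 1[` the operator is uniformly elliptic, and its coefficients are smooth past the end
1. Functions need only be smooth in `]0,1[`. -/
theorem interiorOp_lap (M : ℝ) : InteriorOp (Ioo 0 1) (Ioi 0) (fun x => x) (fun _ => M / 2)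
    (fun x => x ^ (M / 2)) (1 / 3) 1 where
  isOpen := isOpen_Ioo
  isOpen' := isOpen_Ioi
  sub := Ioo_subset_Ioi_self
  smoothA := contDiffOn_id
  smoothB := contDiffOn_const
  ne _ hx := (mem_Ioi.1 hx).ne'
  lt := by norm_num
  sub1 := Ioo_subset_Ioo_left (by norm_num)
  sub2 x hx := lt_of_lt_of_le (by norm_num) hx.1
  contρ x hx := (Real.continuousAt_rpow_const _ _
    (Or.inl (by have := hx.1; intro h; rw [h] at this; norm_num at this))).continuousWithinAt
  posρ x hx := Real.rpow_pos_of_pos (lt_of_lt_of_le (by norm_num) hx.1) _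
  derivρ x hx := by
    have hx0 : 0 < x := lt_trans (by norm_num) hx.1
    refine (Real.hasDerivAt_rpow_const (Or.inl hx0.ne')).congr_deriv ?_
    rw [Real.rpow_sub_one hx0.ne']
    ring

theorem weight_le_one {M : ℝ} (hM : 2 ≤ M) {x : ℝ} (hx : x ∈ Ioo (0 : ℝ) 1) :
    ENNReal.ofReal (x ^ (M / 2 - 1)) ≤ 1 :=
  ENNReal.ofReal_le_one.2 (Real.rpow_le_one hx.1.le hx.2.le (by linarith))

theorem l2Sq_le_sqint {M : ℝ} (hM : 2 ≤ M) (f : ℝ → ℝ) :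
    l2Sq M f ≤ ∫⁻ x in Ioo 0 1, ‖f x‖ₑ ^ 2 :=
  setLIntegral_mono' measurableSet_Ioo fun x hx => by
    simpa using mul_le_mul_right (weight_le_one hM hx) (‖f x‖ₑ ^ 2)

theorem setLIntegral_split_le (F : ℝ → ℝ≥0∞) : ∫⁻ x in Ioo (0 : ℝ) 1, F x ≤
    (∫⁻ x in Ioo (0 : ℝ) (1 / 3), F x) + ∫⁻ x in Ioo (1 / 3 : ℝ) 1, F x := by
  rw [setLIntegral_congr (Ioo_ae_eq_Ioc (a := (0 : ℝ)) (b := 1 / 3))]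
  refine le_trans (lintegral_mono_set fun x hx => ?_) (lintegral_union_le _ _ _)
  rcases le_or_gt x (1 / 3) with h | h
  · exact Or.inl ⟨hx.1, h⟩
  · exact Or.inr ⟨h, hx.2⟩

theorem sqint_le_l2Sq {M : ℝ} (hM : 2 ≤ M) : ∃ C : ℝ≥0, ∀ f : ℝ → ℝ,
    ∫⁻ x in Ioo (1 / 3 : ℝ) 1, ‖f x‖ₑ ^ 2 ≤ C * l2Sq M f := by
  set w : ℝ := (1 / 3 : ℝ) ^ (M / 2 - 1) with hw
  have hw0 : 0 < w := Real.rpow_pos_of_pos (by norm_num) _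
  refine ⟨(w⁻¹).toNNReal, fun f => ?_⟩
  rw [l2Sq, ← lintegral_const_mul' _ _ (by simp)]
  refine le_trans (setLIntegral_mono' measurableSet_Ioo fun x hx => ?_)
    (lintegral_mono_set (Ioo_subset_Ioo_left (by norm_num)))
  have h1 : w ≤ x ^ (M / 2 - 1) :=
    Real.rpow_le_rpow (by norm_num) hx.1.le (by linarith)
  have h2 : (1 : ℝ≥0∞) ≤ ENNReal.ofReal w⁻¹ * ENNReal.ofReal (x ^ (M / 2 - 1)) := by
    rw [← ENNReal.ofReal_mul (by positivity), ← ENNReal.ofReal_one]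
    refine ENNReal.ofReal_le_ofReal ?_
    rw [← div_eq_inv_mul, le_div_iff₀ hw0, one_mul]
    exact h1
  calc ‖f x‖ₑ ^ 2 = ‖f x‖ₑ ^ 2 * 1 := (mul_one _).symm
    _ ≤ ‖f x‖ₑ ^ 2 * (ENNReal.ofReal w⁻¹ * ENNReal.ofReal (x ^ (M / 2 - 1))) := by gcongr
    _ = _ := by rw [mul_left_comm]; rfl

theorem l2Sq_add_le {M : ℝ} {f g : ℝ → ℝ} (hf : ContinuousOn f (Ioo 0 1)) :
    l2Sq M (fun x => f x + g x) ≤ 2 * l2Sq M f + 2 * l2Sq M g := by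
  have h : ∀ x, ‖f x + g x‖ₑ ^ 2 * ENNReal.ofReal (x ^ (M / 2 - 1)) ≤
      2 * (‖f x‖ₑ ^ 2 * ENNReal.ofReal (x ^ (M / 2 - 1))) +
        2 * (‖g x‖ₑ ^ 2 * ENNReal.ofReal (x ^ (M / 2 - 1))) := fun x => by
    rw [← mul_add, ← add_mul, ← mul_assoc]
    gcongr
    exact (pow_le_pow_left₀ zero_le (enorm_add_le _ _) 2).trans (ennreal_add_sq_le _ _)
  refine (lintegral_mono h).trans ?_
  rw [lintegral_add_left', lintegral_const_mul' _ _ (by simp), lintegral_const_mul' _ _ (by simp)]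
  · rfl
  · exact (((aemeasurable_of_continuousOn measurableSet_Ioo hf).pow_const 2).mul
      (by fun_prop)).const_mul 2

theorem sum_sqint_le {M : ℝ} (hM : 2 ≤ M) : ∃ C : ℝ≥0, ∀ (m : ℕ) (V : ℝ → ℝ),
    ∑ k ∈ Finset.range (m + 1), ∫⁻ x in Ioo (1 / 3 : ℝ) 1, ‖(lap M)^[k] V x‖ₑ ^ 2 ≤
      C * ∑ k ∈ Finset.range (m + 1), l2Sq M ((lap M)^[k] V) := by
  obtain ⟨C, hC⟩ := sqint_le_l2Sq hM
  refine ⟨C, fun m V => ?_⟩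
  rw [Finset.mul_sum]
  exact Finset.sum_le_sum fun k _ => hC _

/-- Near the degenerate point the cut-off is 1 and nothing changes; on `]1/3, 1[` the interior
estimate absorbs the derivatives of `ζ`. -/
theorem l2Sq_cutoff_le {M : ℝ} (hM : 2 ≤ M) {ζ : ℝ → ℝ} (hζ : ContDiff ℝ ∞ ζ)
    (hζ1 : ∀ x ≤ 1 / 3, ζ x = 1) (m : ℕ) : ∃ C : ℝ≥0, ∀ V, ContDiffOn ℝ ∞ V (Ioo 0 1) →
      l2Sq M ((lap M)^[m] (fun x => ζ x * V x)) ≤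
        C * ∑ k ∈ Finset.range (m + 1), l2Sq M ((lap M)^[k] V) := by
  obtain ⟨C1, hC1⟩ := (interiorOp_lap M).comb_bound
    (RegularOp.IsComb.dop_iterate (R := (interiorOp_lap M).toRegularOp)
      (A' := fun x => x) (B' := fun _ => M / 2) contDiffOn_id contDiffOn_const hζ.contDiffOn m)
  obtain ⟨C2, hC2⟩ := sum_sqint_le hM
  refine ⟨1 + C1 * C2, fun V hV => ?_⟩
  refine (setLIntegral_split_le _).trans ?_
  push_cast
  rw [add_mul, one_mul, mul_assoc]
  gcongr
  · refine le_trans ?_ (Finset.single_le_sum (f := fun k => l2Sq M ((lap M)^[k] V))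
      (fun _ _ => zero_le) (Finset.self_mem_range_succ m))
    refine le_trans (le_of_eq (setLIntegral_congr_fun measurableSet_Ioo fun x hx => ?_))
      (lintegral_mono_set (Ioo_subset_Ioo_right (by norm_num)))
    have := lap_congr (M := M) (f := fun x => ζ x * V x) (g := V) (isOpen_Ioo (a := 0) (b := 1 / 3))
      (fun x hx => by simp [hζ1 x hx.2.le]) m x hx
    simp only [this]
  · refine le_trans ?_ ((hC1 V hV).trans (mul_le_mul_right (hC2 m V) _))
    refine setLIntegral_mono' measurableSet_Ioo fun x hx => ?_
    rw [← lap_eq_dop]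
    simpa using mul_le_mul_right (weight_le_one hM ⟨lt_trans (by norm_num) hx.1, hx.2⟩)
      (‖(lap M)^[m] (fun x => ζ x * V x) x‖ₑ ^ 2)

/-- In the coordinate `1 - x` the operator of the other end has smooth coefficients and degenerates
only at `x = 1`. -/
theorem lap_reflect (M : ℝ) (f : ℝ → ℝ) (m : ℕ) (x : ℝ) : (lap M)^[m] (fun s => f (1 - s)) x =
    (dop (fun x => 1 - x) (fun _ => -(M / 2)))^[m] f (1 - x) := by
  induction m generalizing f with
  | zero => rfl
  | succ m ih =>
    rw [Function.iterate_succ_apply, Function.iterate_succ_apply, ← ih]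
    refine congrFun (congrArg _ (funext fun s => ?_)) x
    have h1 : deriv (fun s => f (1 - s)) = fun s => -deriv f (1 - s) := by
      funext s; rw [deriv_comp_const_sub]
    have h2 : deriv (fun s => -deriv f (1 - s)) s = deriv (deriv f) (1 - s) := by
      rw [deriv.fun_neg, deriv_comp_const_sub, neg_neg]
    rw [lap, h1, h2, dop]
    ring

theorem setLIntegral_reflect (F : ℝ → ℝ≥0∞) :
    ∫⁻ x in Ioo (0 : ℝ) 1, F (1 - x) = ∫⁻ x in Ioo (0 : ℝ) 1, F x := by
  have h := (volume.measurePreserving_sub_left (1 : ℝ)).setLIntegral_comp_preimage_emb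
    (MeasurableEquiv.subLeft (1 : ℝ)).measurableEmbedding F (Ioo 0 1)
  rw [← h]
  congr 2
  ext x
  simp only [mem_Ioo, mem_preimage]
  constructor <;> rintro ⟨h1, h2⟩ <;> constructor <;> linarith

/-- `ζ V` lives in `]1/3, 1[`, where the reflected operator of the other end is a combination of
jets of `lap M`. That it degenerates at `x = 1` is harmless, since only `lap M` has to be elliptic
there. -/
theorem l2Sq_reflect_le {M M' : ℝ} (hM : 2 ≤ M) (hM' : 2 ≤ M') {ζ : ℝ → ℝ} (hζ : ContDiff ℝ ∞ ζ)
    (m : ℕ) : ∃ C : ℝ≥0, ∀ V, ContDiffOn ℝ ∞ V (Ioo 0 1) →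
      (∀ x ∈ Ioo (0 : ℝ) (1 / 3), ζ x * V x = 0) →
      l2Sq M' ((lap M')^[m] (fun s => ζ (1 - s) * V (1 - s))) ≤
        C * ∑ k ∈ Finset.range (m + 1), l2Sq M ((lap M)^[k] V) := by
  obtain ⟨C1, hC1⟩ := (interiorOp_lap M).comb_bound
    (RegularOp.IsComb.dop_iterate (R := (interiorOp_lap M).toRegularOp)
      (A' := fun x => 1 - x) (B' := fun _ => -(M' / 2)) (contDiffOn_const.sub contDiffOn_id)
      contDiffOn_const hζ.contDiffOn m)
  obtain ⟨C2, hC2⟩ := sum_sqint_le hM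
  refine ⟨C1 * C2, fun V hV h0 => ?_⟩
  refine (l2Sq_le_sqint hM' _).trans ?_
  have h1 := lap_reflect M' (fun x => ζ x * V x) m
  simp only [h1]
  rw [setLIntegral_reflect (fun x => ‖(dop (fun x => 1 - x) fun _ => -(M' / 2))^[m]
    (fun x => ζ x * V x) x‖ₑ ^ 2)]
  refine (setLIntegral_split_le _).trans ?_
  have h2 : ∀ x ∈ Ioo (0 : ℝ) (1 / 3), ‖(dop (fun x => 1 - x) fun _ => -(M' / 2))^[m]
    (fun x => ζ x * V x) x‖ₑ ^ 2 = 0 := fun x hx => by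
    rw [dop_congr (g := fun _ => 0) isOpen_Ioo h0 m x hx]
    have : ∀ k, (dop (fun x => 1 - x) fun _ => -(M' / 2))^[k] (fun _ => (0 : ℝ)) = fun _ => 0 := by
      intro k
      refine Function.iterate_fixed ?_ k
      funext x
      simp [dop]
    simp [this]
  rw [setLIntegral_congr_fun measurableSet_Ioo h2, lintegral_zero, zero_add]
  refine (hC1 V hV).trans ?_
  push_cast
  rw [mul_assoc]
  exact mul_le_mul_right (hC2 m V) _

/-! ### The norms of a function given in one of the charts -/

theorem chart_chart (μ : Fin 2) (x : ℝ) : chart μ (chart μ x) = x := by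
  fin_cases μ <;> simp [chart]

theorem sum_fin_two_rev {R : Type*} [AddCommMonoid R] (μ : Fin 2) (f : Fin 2 → R) :
    ∑ i, f i = f μ + f μ.rev := by
  fin_cases μ <;> simp [add_comm]

theorem five_le_param {N : ℝ} (hN : 5 ≤ N) (μ : Fin 2) : 5 ≤ param N μ := by
  fin_cases μ <;> simp [param, hN]

/-- The cut-off at the end `μ`, in the coordinate of that end. -/
noncomputable def cut (χ : ℝ → ℝ) (μ : Fin 2) (s : ℝ) : ℝ := weight χ μ (chart μ s)

namespace IsCutoff

variable {χ : ℝ → ℝ}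

theorem cut_contDiff (hχ : IsCutoff χ) (μ : Fin 2) : ContDiff ℝ ∞ (cut χ μ) := by
  have := hχ.smooth
  fin_cases μ
  · have h : cut χ 0 = χ := by funext s; simp [cut, weight, chart]
    change ContDiff ℝ ∞ (cut χ 0)
    rwa [h]
  · have h : cut χ 1 = fun s => 1 - χ (1 - s) := by funext s; simp [cut, weight, chart]
    change ContDiff ℝ ∞ (cut χ 1)
    rw [h]
    exact contDiff_const.sub (this.comp (contDiff_const.sub contDiff_id))

theorem cut_eq_one (hχ : IsCutoff χ) (μ : Fin 2) {s : ℝ} (hs : s ≤ 1 / 3) : cut χ μ s = 1 := by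
  fin_cases μ
  · simpa [cut, weight, chart] using hχ.eq_one s (by linarith)
  · simpa [cut, weight, chart] using hχ.eq_zero (1 - s) (by linarith)

theorem cut_eq_zero (hχ : IsCutoff χ) (μ : Fin 2) {s : ℝ} (hs : 2 / 3 ≤ s) : cut χ μ s = 0 := by
  fin_cases μ
  · simpa [cut, weight, chart] using hχ.eq_zero s (by linarith)
  · simp [cut, weight, chart, hχ.eq_one (1 - s) (by linarith)]

end IsCutoff

theorem piece_chart (χ : ℝ → ℝ) (μ : Fin 2) (V : ℝ → ℝ) :
    piece χ μ (fun x => V (chart μ x)) = fun s => cut χ μ s * V s := by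
  funext s
  rw [piece, chart_chart, cut]

theorem piece_rev_chart (χ : ℝ → ℝ) (μ : Fin 2) (V : ℝ → ℝ) :
    piece χ μ.rev (fun x => V (chart μ x)) = fun s => (1 - cut χ μ (1 - s)) * V (1 - s) := by
  funext s
  fin_cases μ <;> simp [piece, cut, chart, weight]

theorem starNormSq_chart_le {N : ℝ} (hN : 5 ≤ N) {χ : ℝ → ℝ} (hχ : IsCutoff χ) (μ : Fin 2)
    (κ : ℕ) : ∃ C : ℝ≥0, ∀ V, ContDiffOn ℝ ∞ V (Ioo 0 1) →
      starNormSq N χ κ (fun x => V (chart μ x)) ≤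
        C * ∑ k ∈ Finset.range (κ + 1), l2Sq (param N μ) ((lap (param N μ))^[k] V) := by
  have h2 : ∀ i, 2 ≤ param N i := fun i => le_trans (by norm_num) (five_le_param hN i)
  choose C1 hC1 using l2Sq_cutoff_le (h2 μ) (hχ.cut_contDiff μ) (fun x hx => hχ.cut_eq_one μ hx)
  choose C2 hC2 using l2Sq_reflect_le (h2 μ) (h2 μ.rev) (ζ := fun s => 1 - cut χ μ s)
    (contDiff_const.sub (hχ.cut_contDiff μ))
  refine ⟨∑ m ∈ Finset.range (κ + 1), C1 m + ∑ m ∈ Finset.range (κ + 1), C2 m, fun V hV => ?_⟩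
  rw [starNormSq, sum_fin_two_rev μ, piece_chart, piece_rev_chart]
  push_cast
  rw [add_mul, Finset.sum_mul, Finset.sum_mul]
  have hmono : ∀ m ∈ Finset.range (κ + 1),
      ∑ k ∈ Finset.range (m + 1), l2Sq (param N μ) ((lap (param N μ))^[k] V) ≤
      ∑ k ∈ Finset.range (κ + 1), l2Sq (param N μ) ((lap (param N μ))^[k] V) := fun m hm =>
    Finset.sum_le_sum_of_subset (Finset.range_mono (by have := Finset.mem_range.1 hm; omega))
  gcongr with m hm m hm
  · exact (hC1 m V hV).trans (mul_le_mul_right (hmono m hm) _)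
  · refine (hC2 m V hV fun x hx => ?_).trans (mul_le_mul_right (hmono m hm) _)
    rw [hχ.cut_eq_one μ hx.2.le]
    ring

/-- Split `V` by the cut-off. The first part is the piece of `V` at its own end. The second is the
piece at the other end, seen through the reflection; since `V` vanishes beyond `2/3`, that piece
vanishes near the degenerate point of the other end, and the reflected estimate brings it back. -/
theorem l2Sq_le_starNormSq {N : ℝ} (hN : 5 ≤ N) {χ : ℝ → ℝ} (hχ : IsCutoff χ) (μ : Fin 2)
    (m : ℕ) : ∃ C : ℝ≥0, ∀ V, ContDiffOn ℝ ∞ V (Ioo 0 1) →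
      (∀ x ∈ Ioo (0 : ℝ) 1, 2 / 3 ≤ x → V x = 0) →
      l2Sq (param N μ) ((lap (param N μ))^[m] V) ≤
        C * starNormSq N χ m (fun x => V (chart μ x)) := by
  have h2 : ∀ i, 2 ≤ param N i := fun i => le_trans (by norm_num) (five_le_param hN i)
  obtain ⟨C, hC⟩ := l2Sq_reflect_le (h2 μ.rev) (h2 μ) (ζ := fun _ => 1) contDiff_const m
  refine ⟨2 + 2 * C, fun V hV h0 => ?_⟩
  have s1 : ContDiffOn ℝ ∞ (fun s => cut χ μ s * V s) (Ioo 0 1) :=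
    (hχ.cut_contDiff μ).contDiffOn.mul hV
  have s2 : ContDiffOn ℝ ∞ (fun s => (1 - cut χ μ s) * V s) (Ioo 0 1) :=
    (contDiff_const.sub (hχ.cut_contDiff μ)).contDiffOn.mul hV
  have hr : ContDiffOn ℝ ∞ (fun s : ℝ => 1 - s) (Ioo 0 1) := contDiffOn_const.sub contDiffOn_id
  have hm : MapsTo (fun s : ℝ => 1 - s) (Ioo 0 1) (Ioo 0 1) := fun s hs =>
    ⟨by linarith [hs.2], by linarith [hs.1]⟩
  have s3 := s2.comp hr hm
  have hsplit : (lap (param N μ))^[m] V = (lap (param N μ))^[m]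
      (fun s => cut χ μ s * V s + (1 - cut χ μ s) * V s) := by
    congr 1; funext s; ring
  have e : l2Sq (param N μ) ((lap (param N μ))^[m] V) ≤
      2 * l2Sq (param N μ) ((lap (param N μ))^[m] (fun s => cut χ μ s * V s)) +
      2 * l2Sq (param N μ) ((lap (param N μ))^[m] (fun s => (1 - cut χ μ s) * V s)) := by
    rw [hsplit]
    refine le_trans (le_of_eq (l2Sq_congr fun x hx => ?_))
      (l2Sq_add_le (smooth_lap_iterate (param N μ) isOpen_Ioo s1 m).continuousOn)
    exact dop_add isOpen_Ioo contDiffOn_id contDiffOn_const s1 s2 m x hx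
  refine e.trans ?_
  push_cast
  rw [add_mul, mul_assoc]
  have hstar := starNormSq.eq_1 N χ m (fun x => V (chart μ x))
  rw [sum_fin_two_rev μ, piece_chart, piece_rev_chart] at hstar
  gcongr
  · rw [hstar]
    exact (Finset.single_le_sum (f := fun k => l2Sq (param N μ) ((lap (param N μ))^[k]
      (fun s => cut χ μ s * V s))) (fun _ _ => zero_le) (Finset.self_mem_range_succ m)).trans
      le_self_add
  · have h3 := hC _ s3 (fun x hx => by
      simp only [Function.comp]
      rw [h0 (1 - x) ⟨by linarith [hx.2], by linarith [hx.1]⟩ (by linarith [hx.2])]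
      ring)
    simp only [Function.comp, sub_sub_cancel, one_mul] at h3
    refine h3.trans (mul_le_mul_right ?_ _)
    rw [hstar]
    exact le_add_self

/-! ### A sequence with alternating moments

The weights of the Lagrange interpolation at the nodes `2 ^ k`, evaluated at `-1`. -/

/-- The factors of the Lagrange weight at `2 ^ k` that belong to the smaller nodes. -/
noncomputable def lowFactor (k : ℕ) : ℝ :=
  ∏ j ∈ Finset.range k, (-1 - (2 : ℝ) ^ j) / (2 ^ k - 2 ^ j)

/-- The factors of the Lagrange weight at `2 ^ k` that belong to the next `p` larger nodes. -/
noncomputable def highFactor (k p : ℕ) : ℝ :=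
  ∏ i ∈ Finset.range p, (-1 - (2 : ℝ) ^ (k + 1 + i)) / (2 ^ k - 2 ^ (k + 1 + i))

/-- The Lagrange weight at `2 ^ k`, for the nodes `2 ^ j` with `j ≤ m`. -/
noncomputable def lagrangeWeight (m k : ℕ) : ℝ :=
  if k ≤ m then lowFactor k * highFactor k (m - k) else 0

theorem lagrangeWeight_eq {m k : ℕ} (hk : k ≤ m) : lagrangeWeight m k =
    (Lagrange.basis (Finset.range (m + 1)) (fun j : ℕ => (2 : ℝ) ^ j) k).eval (-1) := by
  rw [lagrangeWeight, if_pos hk, Lagrange.basis, Polynomial.eval_prod]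
  have e1 : ∀ j : ℕ, (Lagrange.basisDivisor ((2 : ℝ) ^ k) (2 ^ j)).eval (-1) =
      (-1 - (2 : ℝ) ^ j) / (2 ^ k - 2 ^ j) := fun j => by
    simp [Lagrange.basisDivisor, div_eq_inv_mul]
  simp only [e1]
  have hs : (Finset.range (m + 1)).erase k = Finset.range k ∪ Finset.Ico (k + 1) (m + 1) := by
    ext j
    simp only [Finset.mem_erase, Finset.mem_range, Finset.mem_union, Finset.mem_Ico]
    omega
  have hd : Disjoint (Finset.range k) (Finset.Ico (k + 1) (m + 1)) := by
    rw [Finset.disjoint_left]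
    intro j
    simp only [Finset.mem_range, Finset.mem_Ico]
    omega
  rw [hs, Finset.prod_union hd, Finset.prod_Ico_eq_prod_range, lowFactor, highFactor]
  congr 3
  omega

/-- Interpolation at `m + 1` nodes reproduces `X^n` for `n ≤ m`; it is evaluated at `-1`. -/
theorem sum_lagrangeWeight {m n : ℕ} (hn : n ≤ m) :
    ∑ k ∈ Finset.range (m + 1), lagrangeWeight m k * ((2 : ℝ) ^ k) ^ n = (-1) ^ n := by
  have hinj : Set.InjOn (fun j : ℕ => (2 : ℝ) ^ j) (Finset.range (m + 1)) :=
    (pow_right_injective₀ (by norm_num) (by norm_num)).injOn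
  have hdeg : (Polynomial.X ^ n : Polynomial ℝ).degree < (Finset.range (m + 1)).card := by
    rw [Polynomial.degree_X_pow, Finset.card_range]
    exact_mod_cast Nat.lt_succ_of_le hn
  have h := congrArg (Polynomial.eval (-1)) (Lagrange.eq_interpolate hinj hdeg)
  rw [Lagrange.interpolate_apply, Polynomial.eval_finsetSum] at h
  simp only [Polynomial.eval_pow, Polynomial.eval_X, Polynomial.eval_mul, Polynomial.eval_C] at h
  rw [h]
  refine Finset.sum_congr rfl fun k hk => ?_
  rw [lagrangeWeight_eq (Nat.lt_succ_iff.1 (Finset.mem_range.1 hk)), mul_comm]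

/-- The excess over 1 decays geometrically in `i`, so products over the larger nodes increase and
stay below `exp 4`, uniformly in `k`. -/
theorem highFactor_term (k i : ℕ) : 1 ≤ (-1 - (2 : ℝ) ^ (k + 1 + i)) / (2 ^ k - 2 ^ (k + 1 + i)) ∧
    (-1 - (2 : ℝ) ^ (k + 1 + i)) / (2 ^ k - 2 ^ (k + 1 + i)) ≤ Real.exp (4 * (1 / 2) ^ (i + 1)) := by
  have hk : (1 : ℝ) ≤ 2 ^ k := one_le_pow₀ (by norm_num)
  have hi : (1 : ℝ) ≤ 2 ^ i := one_le_pow₀ (by norm_num)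
  have e : (2 : ℝ) ^ (k + 1 + i) = 2 * 2 ^ k * 2 ^ i := by ring
  have e2 : (1 / 2 : ℝ) ^ (i + 1) = 1 / (2 * 2 ^ i) := by rw [one_div_pow, pow_succ']
  rw [e, e2, ← neg_div_neg_eq]
  set K := (2 : ℝ) ^ k
  set I := (2 : ℝ) ^ i
  have hKI : K ≤ K * I := le_mul_of_one_le_right (by linarith) hi
  have hpos : 0 < -(K - 2 * K * I) := by nlinarith
  constructor
  · rw [le_div_iff₀ hpos]
    nlinarith
  · refine le_trans ?_ (Real.add_one_le_exp _)
    rw [div_le_iff₀ hpos]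
    have e3 : (4 * (1 / (2 * I)) + 1) * -(K - 2 * K * I) = 3 * K + 2 * K * I - 2 * K / I := by
      field_simp
      ring
    rw [e3]
    have : 2 * K / I ≤ 2 * K := div_le_self (by linarith) hi
    nlinarith

theorem highFactor_mono (k : ℕ) : Monotone (highFactor k) := by
  refine monotone_nat_of_le_succ fun p => ?_
  rw [highFactor, highFactor, Finset.prod_range_succ]
  refine le_mul_of_one_le_right (Finset.prod_nonneg fun i _ => ?_) (highFactor_term k p).1
  exact zero_le_one.trans (highFactor_term k i).1

theorem highFactor_le (k p : ℕ) : highFactor k p ≤ Real.exp 4 := by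
  refine (Finset.prod_le_prod (fun i _ => zero_le_one.trans (highFactor_term k i).1)
    fun i _ => (highFactor_term k i).2).trans ?_
  rw [← Real.exp_sum]
  refine Real.exp_le_exp.2 ?_
  simp only [pow_succ']
  rw [← Finset.mul_sum, ← Finset.mul_sum]
  have := sum_geometric_two_le p
  linarith

theorem highFactor_nonneg (k p : ℕ) : 0 ≤ highFactor k p :=
  Finset.prod_nonneg fun i _ => zero_le_one.trans (highFactor_term k i).1

/-- A bound for `lowFactor`. -/
noncomputable def lowBound (k : ℕ) : ℝ := ∏ j ∈ Finset.range k, 4 * (2 : ℝ) ^ j / 2 ^ k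

/-- For `j < k`, `1 + 2^j ≤ 2 · 2^j` and `2^k - 2^j ≥ 2^k / 2`. -/
theorem abs_lowFactor_le (k : ℕ) : |lowFactor k| ≤ lowBound k := by
  rw [lowFactor, Finset.abs_prod]
  refine Finset.prod_le_prod (fun _ _ => abs_nonneg _) fun j hj => ?_
  have hj' := Finset.mem_range.1 hj
  have hj1 : (1 : ℝ) ≤ 2 ^ j := one_le_pow₀ (by norm_num)
  have hk : (2 : ℝ) * 2 ^ j ≤ 2 ^ k := by
    rw [← pow_succ']
    exact pow_le_pow_right₀ (by norm_num) hj'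
  rw [abs_div, abs_of_neg (by linarith), abs_of_pos (by linarith),
    div_le_div_iff₀ (by linarith) (by linarith)]
  nlinarith

/-- The ratio of consecutive bounds tends to 0 geometrically, so `lowBound` decays faster than any
power of `2^k` grows. -/
theorem lowBound_succ (k : ℕ) : lowBound (k + 1) = lowBound k * (2 * (1 / 2) ^ k) := by
  rw [lowBound, Finset.prod_range_succ', lowBound]
  congr 1
  · refine Finset.prod_congr rfl fun j _ => ?_
    rw [pow_succ, pow_succ]
    field_simp
  · rw [pow_succ, one_div_pow]
    field_simp
    norm_num

theorem lowBound_pos (k : ℕ) : 0 < lowBound k := Finset.prod_pos fun j _ => by positivity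

theorem summable_lowBound (n : ℕ) : Summable fun k => lowBound k * ((2 : ℝ) ^ k) ^ n := by
  have hpos : ∀ k, 0 < lowBound k * ((2 : ℝ) ^ k) ^ n := fun k =>
    mul_pos (lowBound_pos k) (by positivity)
  refine summable_of_ratio_test_tendsto_lt_one zero_lt_one
    (Eventually.of_forall fun k => (hpos k).ne') ?_
  have e : ∀ k, ‖lowBound (k + 1) * ((2 : ℝ) ^ (k + 1)) ^ n‖ / ‖lowBound k * ((2 : ℝ) ^ k) ^ n‖ =
      2 * 2 ^ n * (1 / 2) ^ k := fun k => by
    rw [Real.norm_of_nonneg (hpos _).le, Real.norm_of_nonneg (hpos _).le, lowBound_succ,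
      pow_succ, mul_pow]
    have := (lowBound_pos k).ne'
    field_simp
  simp only [e]
  have := (tendsto_pow_atTop_nhds_zero_of_lt_one (r := (1 / 2 : ℝ)) (by norm_num)
    (by norm_num)).const_mul (2 * 2 ^ n : ℝ)
  simpa using this

theorem abs_lagrangeWeight_le (m k : ℕ) : |lagrangeWeight m k| ≤ lowBound k * Real.exp 4 := by
  rw [lagrangeWeight]
  split_ifs
  · rw [abs_mul, abs_of_nonneg (highFactor_nonneg _ _)]
    exact mul_le_mul (abs_lowFactor_le k) (highFactor_le _ _) (highFactor_nonneg _ _)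
      (lowBound_pos k).le
  · rw [abs_zero]
    exact mul_nonneg (lowBound_pos k).le (Real.exp_pos _).le

/-- For fixed `k` the Lagrange weights converge as the number of nodes grows. Dominated convergence,
with majorant `lowBound k * exp 4`, carries the exact moments to the limit. The moment conditions
say that `∑ a_k v(-2^k t)` has the same derivatives as `v` at 0, to every order. -/
theorem exists_alternating_moments : ∃ a : ℕ → ℝ, ∀ n : ℕ,
    (Summable fun k => |a k| * ((2 : ℝ) ^ k) ^ n) ∧ ∑' k, a k * (-(2 : ℝ) ^ k) ^ n = 1 := by
  have hlim : ∀ k, Tendsto (fun m => lagrangeWeight m k) atTop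
      (𝓝 (lowFactor k * ⨆ p, highFactor k p)) := by
    intro k
    have h1 : Tendsto (highFactor k) atTop (𝓝 (⨆ p, highFactor k p)) :=
      tendsto_atTop_ciSup (highFactor_mono k) ⟨Real.exp 4, by rintro _ ⟨p, rfl⟩; exact highFactor_le k p⟩
    refine ((h1.comp (tendsto_sub_atTop_nat k)).const_mul (lowFactor k)).congr' ?_
    filter_upwards [eventually_ge_atTop k] with m hm
    rw [lagrangeWeight, if_pos hm]
    rfl
  refine ⟨fun k => lowFactor k * ⨆ p, highFactor k p, fun n => ?_⟩
  have hbound : ∀ k, |lowFactor k * ⨆ p, highFactor k p| ≤ lowBound k * Real.exp 4 := fun k =>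
    le_of_tendsto (hlim k).abs (Eventually.of_forall fun m => abs_lagrangeWeight_le m k)
  have hs : Summable fun k => lowBound k * Real.exp 4 * ((2 : ℝ) ^ k) ^ n := by
    refine ((summable_lowBound n).mul_left (Real.exp 4)).congr fun k => ?_
    ring
  refine ⟨Summable.of_nonneg_of_le (fun k => by positivity)
    (fun k => mul_le_mul_of_nonneg_right (hbound k) (by positivity)) hs, ?_⟩
  have ht := tendsto_tsum_of_dominated_convergence (𝓕 := atTop)
    (f := fun m k => lagrangeWeight m k * ((2 : ℝ) ^ k) ^ n)
    (g := fun k => lowFactor k * (⨆ p, highFactor k p) * ((2 : ℝ) ^ k) ^ n) hs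
    (fun k => (hlim k).mul_const _) (Eventually.of_forall fun m k => by
      rw [norm_mul, Real.norm_eq_abs, Real.norm_of_nonneg (by positivity : (0 : ℝ) ≤ (2 ^ k) ^ n)]
      exact mul_le_mul_of_nonneg_right (abs_lagrangeWeight_le m k) (by positivity))
  have hc : Tendsto (fun m => ∑' k, lagrangeWeight m k * ((2 : ℝ) ^ k) ^ n) atTop
      (𝓝 ((-1) ^ n)) := by
    refine tendsto_const_nhds.congr' ?_
    filter_upwards [eventually_ge_atTop n] with m hm
    rw [← sum_lagrangeWeight hm]
    refine (tsum_eq_sum fun k hk => ?_).symm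
    rw [Finset.mem_range, not_lt] at hk
    rw [lagrangeWeight, if_neg (by omega), zero_mul]
  have h := tendsto_nhds_unique ht hc
  have e : ∀ k, lowFactor k * (⨆ p, highFactor k p) * (-(2 : ℝ) ^ k) ^ n =
      (-1) ^ n * (lowFactor k * (⨆ p, highFactor k p) * ((2 : ℝ) ^ k) ^ n) := fun k => by
    rw [neg_pow]
    ring
  simp only [e]
  rw [tsum_mul_left, h, ← mul_pow]
  norm_num

/-! ### Smoothness from partial derivatives -/

/-- Joint differentiability needs continuity of only one partial derivative: the mean value
inequality handles the move in `t`, and the move in `x` is made on the single line through the base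
point. -/
theorem hasFDerivWithinAt_of_partials {B : Set ℝ} {G G1 : ℝ → ℝ → ℝ} {t x d : ℝ}
    (h1 : ∀ r, ∀ y ∈ B, HasDerivAt (fun r => G r y) (G1 r y) r)
    (hc : ContinuousWithinAt (fun p : ℝ × ℝ => G1 p.1 p.2) (univ ×ˢ B) (t, x))
    (h2 : HasDerivWithinAt (G t) d B x) :
    HasFDerivWithinAt (fun p : ℝ × ℝ => G p.1 p.2)
      (G1 t x • ContinuousLinearMap.fst ℝ ℝ ℝ + d • ContinuousLinearMap.snd ℝ ℝ ℝ)
      (univ ×ˢ B) (t, x) := by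
  refine HasFDerivWithinAt.of_isLittleO ?_
  rw [Asymptotics.isLittleO_iff]
  intro ε hε
  have hε2 : 0 < ε / 2 := by linarith
  obtain ⟨δ, hδ, hδc⟩ := Metric.continuousWithinAt_iff.1 hc (ε / 2) hε2
  obtain ⟨δ', hδ', hd⟩ := Metric.mem_nhdsWithin_iff.1
    (Asymptotics.isLittleO_iff.1 (hasDerivWithinAt_iff_isLittleO.1 h2) hε2)
  refine Metric.mem_nhdsWithin_iff.2 ⟨min δ δ', lt_min hδ hδ', ?_⟩
  rintro ⟨r, y⟩ ⟨hb, -, hy⟩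
  have hy : y ∈ B := hy
  rw [Metric.mem_ball, Prod.dist_eq, max_lt_iff, lt_min_iff, lt_min_iff] at hb
  have e2 : |G t y - G t x - (y - x) * d| ≤ ε / 2 * |y - x| := by
    have := hd ⟨Metric.mem_ball.2 hb.2.2, hy⟩
    simpa using this
  have e1 : |(G r y - G1 t x * r) - (G t y - G1 t x * t)| ≤ ε / 2 * |r - t| := by
    have := (convex_ball t δ).norm_image_sub_le_of_norm_hasDerivWithin_le
      (f := fun s => G s y - G1 t x * s) (f' := fun s => G1 s y - G1 t x) (C := ε / 2)
      (x := t) (y := r)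
      (fun s _ => by
        simpa using ((h1 s y hy).fun_sub ((hasDerivAt_id s).const_mul (G1 t x))).hasDerivWithinAt)
      (fun s hs => by
        have := hδc (x := (s, y)) ⟨mem_univ _, hy⟩ (by
          rw [Prod.dist_eq, max_lt_iff]
          exact ⟨Metric.mem_ball.1 hs, hb.2.1⟩)
        rw [Real.dist_eq] at this
        exact this.le)
      (Metric.mem_ball_self hδ) (Metric.mem_ball.2 hb.1.1)
    simpa using this
  have n1 : |r - t| ≤ ‖((r, y) : ℝ × ℝ) - (t, x)‖ := norm_fst_le (((r, y) : ℝ × ℝ) - (t, x))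
  have n2 : |y - x| ≤ ‖((r, y) : ℝ × ℝ) - (t, x)‖ := norm_snd_le (((r, y) : ℝ × ℝ) - (t, x))
  simp only [mem_ofPred_eq, add_apply, smul_apply,
    ContinuousLinearMap.coe_fst', ContinuousLinearMap.coe_snd', Prod.fst_sub, Prod.snd_sub,
    smul_eq_mul, Real.norm_eq_abs]
  have e3 : G r y - G t x - (G1 t x * (r - t) + d * (y - x)) =
      ((G r y - G1 t x * r) - (G t y - G1 t x * t)) + (G t y - G t x - (y - x) * d) := by ring
  rw [e3]
  refine (abs_add_le _ _).trans ((add_le_add e1 e2).trans ?_)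
  nlinarith

/-- Induction on the order of differentiability, carried out for the whole family at once because it
is closed under both partial derivatives. -/
theorem smoothOn_of_partials {B : Set ℝ} (hB : UniqueDiffOn ℝ B) (F : Set (ℝ → ℝ → ℝ))
    (hF : ∀ G ∈ F, ContinuousOn (fun p : ℝ × ℝ => G p.1 p.2) (univ ×ˢ B) ∧
      ∃ G1 ∈ F, ∃ G2 ∈ F, (∀ t, ∀ x ∈ B, HasDerivAt (fun r => G r x) (G1 t x) t) ∧
        ∀ t, ∀ x ∈ B, HasDerivWithinAt (G t) (G2 t x) B x) :
    ∀ G ∈ F, SmoothOn (univ ×ˢ B) G := by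
  have key : ∀ n : ℕ, ∀ G ∈ F, ContDiffOn ℝ n (fun p : ℝ × ℝ => G p.1 p.2) (univ ×ˢ B) := by
    intro n
    induction n with
    | zero => exact fun G hG => contDiffOn_zero.2 (hF G hG).1
    | succ n ih =>
      intro G hG
      obtain ⟨-, G1, hG1, G2, hG2, h1, h2⟩ := hF G hG
      push_cast
      refine (contDiffOn_succ_iff_hasFDerivWithinAt_of_uniqueDiffOn
        (uniqueDiffOn_univ.prod hB)).2 ⟨by simp, fun p => G1 p.1 p.2 • ContinuousLinearMap.fst ℝ ℝ ℝ +
          G2 p.1 p.2 • ContinuousLinearMap.snd ℝ ℝ ℝ, ?_, ?_⟩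
      · exact ((ih G1 hG1).smul contDiffOn_const).add ((ih G2 hG2).smul contDiffOn_const)
      · rintro ⟨t, x⟩ ⟨-, hx⟩
        exact hasFDerivWithinAt_of_partials h1 ((hF G1 hG1).1 (t, x) ⟨mem_univ _, hx⟩)
          (h2 t x hx)
  exact fun G hG => contDiffOn_infty.2 fun n => key n G hG

/-! ### Higher order reflections -/

/-- The coefficients of the reflections. -/
noncomputable def seeley : ℕ → ℝ := exists_alternating_moments.choose

theorem seeley_summable (n : ℕ) : Summable fun k => |seeley k| * ((2 : ℝ) ^ k) ^ n :=
  (exists_alternating_moments.choose_spec n).1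

theorem seeley_tsum (n : ℕ) : ∑' k, seeley k * (-(2 : ℝ) ^ k) ^ n = 1 :=
  (exists_alternating_moments.choose_spec n).2

/-- The combination of dilated reflections of `v` that extends the `i`-th derivatives. -/
noncomputable def mirror (i : ℕ) (v : ℝ → ℝ → ℝ) (t x : ℝ) : ℝ :=
  ∑' k, seeley k * (-(2 : ℝ) ^ k) ^ i * v (-(2 : ℝ) ^ k * t) x

/-- The extension of `v` from `t ≥ 0` to all `t`. -/
noncomputable def reflectExt (i : ℕ) (v : ℝ → ℝ → ℝ) (t x : ℝ) : ℝ :=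
  if 0 ≤ t then v t x else mirror i v t x

/-- Smooth functions for `t ≥ 0` and `0 ≤ x < 1` that vanish for `t > c` and for `x > 2/3`. -/
structure HalfOn (c : ℝ) (v : ℝ → ℝ → ℝ) : Prop where
  smooth : SmoothOn (Ici 0 ×ˢ Ico 0 1) v
  zero_t : ∀ t ∈ Ici (0 : ℝ), ∀ x ∈ Ico (0 : ℝ) 1, c < t → v t x = 0
  zero_x : ∀ t ∈ Ici (0 : ℝ), ∀ x ∈ Ico (0 : ℝ) 1, 2 / 3 < x → v t x = 0

theorem uniqueDiffOn_Ico01 : UniqueDiffOn ℝ (Ico (0 : ℝ) 1) := uniqueDiffOn_Ico 0 1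

namespace HalfOn

variable {c : ℝ} {v : ℝ → ℝ → ℝ}

theorem pdt (h : HalfOn c v) : HalfOn c (pdt (Ici 0) v) where
  smooth := h.smooth.pdt (uniqueDiffOn_Ici 0) uniqueDiffOn_Ico01
  zero_t t ht x hx htc := by
    have hev : (fun r => v r x) =ᶠ[𝓝[Ici 0] t] fun _ => 0 := by
      filter_upwards [self_mem_nhdsWithin, mem_nhdsWithin_of_mem_nhds (lt_mem_nhds htc)] with r h1 h2
      exact h.zero_t r h1 x hx h2
    rw [Smoothing.pdt, hev.derivWithin_eq (h.zero_t t ht x hx htc)]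
    simp
  zero_x t ht x hx hx2 := by
    have hev : (fun r => v r x) =ᶠ[𝓝[Ici 0] t] fun _ => 0 := by
      filter_upwards [self_mem_nhdsWithin] with r h1
      exact h.zero_x r h1 x hx hx2
    rw [Smoothing.pdt, hev.derivWithin_eq (h.zero_x t ht x hx hx2)]
    simp

theorem pdx (h : HalfOn c v) : HalfOn c (pdx (Ico 0 1) v) where
  smooth := h.smooth.pdx (uniqueDiffOn_Ici 0) uniqueDiffOn_Ico01
  zero_t t ht x hx htc := by
    have hev : v t =ᶠ[𝓝[Ico 0 1] x] fun _ => 0 := by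
      filter_upwards [self_mem_nhdsWithin] with y h1
      exact h.zero_t t ht y h1 htc
    rw [Smoothing.pdx, hev.derivWithin_eq (h.zero_t t ht x hx htc)]
    simp
  zero_x t ht x hx hx2 := by
    have hev : v t =ᶠ[𝓝[Ico 0 1] x] fun _ => 0 := by
      filter_upwards [self_mem_nhdsWithin, mem_nhdsWithin_of_mem_nhds (lt_mem_nhds hx2)] with y h1 h2
      exact h.zero_x t ht y h1 h2
    rw [Smoothing.pdx, hev.derivWithin_eq (h.zero_x t ht x hx hx2)]
    simp

theorem bounded (h : HalfOn c v) : ∃ C, ∀ t ∈ Ici (0 : ℝ), ∀ x ∈ Ico (0 : ℝ) 1, |v t x| ≤ C := by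
  have hK : IsCompact (Icc (0 : ℝ) c ×ˢ Icc (0 : ℝ) (2 / 3)) := isCompact_Icc.prod isCompact_Icc
  obtain ⟨C, hC⟩ := hK.exists_bound_of_continuousOn (f := fun p : ℝ × ℝ => v p.1 p.2)
    ((ContDiffOn.continuousOn h.smooth).mono (prod_mono Icc_subset_Ici_self fun x hx =>
      ⟨hx.1, hx.2.trans_lt (by norm_num)⟩))
  refine ⟨max C 0, fun t ht x hx => ?_⟩
  by_cases h1 : c < t
  · rw [h.zero_t t ht x hx h1, abs_zero]
    exact le_max_right _ _
  by_cases h2 : 2 / 3 < x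
  · rw [h.zero_x t ht x hx h2, abs_zero]
    exact le_max_right _ _
  · exact (hC (t, x) ⟨⟨ht, not_lt.1 h1⟩, hx.1, not_lt.1 h2⟩).trans (le_max_left _ _)

end HalfOn

/-- For `t ≤ t₀ < 0` the points `-2^k t` leave the support once `k` is large, uniformly in `t`. Away
from `t = 0` the series is therefore a finite sum. -/
theorem mirror_eq_sum (c : ℝ) {t₀ : ℝ} (ht₀ : t₀ < 0) : ∃ K : ℕ, ∀ (i : ℕ)
    (v : ℝ → ℝ → ℝ) (x : ℝ), (∀ t, c < t → v t x = 0) → ∀ t ≤ t₀, mirror i v t x =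
      ∑ k ∈ Finset.range K, seeley k * (-(2 : ℝ) ^ k) ^ i * v (-(2 : ℝ) ^ k * t) x := by
  obtain ⟨K, hK⟩ := pow_unbounded_of_one_lt (c / (-t₀)) (by norm_num : (1 : ℝ) < 2)
  refine ⟨K, fun i v x hv t ht => tsum_eq_sum fun k hk => ?_⟩
  rw [Finset.mem_range, not_lt] at hk
  rw [hv, mul_zero]
  have h1 : (2 : ℝ) ^ K ≤ 2 ^ k := pow_le_pow_right₀ (by norm_num) hk
  rw [div_lt_iff₀ (by linarith)] at hK
  have h2 : (0 : ℝ) < 2 ^ K := by positivity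
  nlinarith

theorem reflectExt_of_nonneg (i : ℕ) (v : ℝ → ℝ → ℝ) {t : ℝ} (ht : 0 ≤ t) (x : ℝ) :
    reflectExt i v t x = v t x := if_pos ht

theorem reflectExt_of_neg (i : ℕ) (v : ℝ → ℝ → ℝ) {t : ℝ} (ht : t < 0) (x : ℝ) :
    reflectExt i v t x = mirror i v t x := if_neg (not_le.2 ht)

/-- The `i`-th moment is 1 for every `i`, so all derivatives of the reflection fit continuously at
`t = 0`. -/
theorem mirror_zero (i : ℕ) (v : ℝ → ℝ → ℝ) (x : ℝ) : mirror i v 0 x = v 0 x := by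
  simp only [mirror, mul_zero]
  rw [tsum_mul_right, seeley_tsum, one_mul]

theorem neg_two_pow_mul_nonneg (k : ℕ) {t : ℝ} (ht : t ≤ 0) : 0 ≤ -(2 : ℝ) ^ k * t := by
  have : (0 : ℝ) < 2 ^ k := by positivity
  nlinarith

namespace HalfOn

variable {c : ℝ} {v : ℝ → ℝ → ℝ}

theorem mirror_continuousOn (h : HalfOn c v) (i : ℕ) :
    ContinuousOn (fun p : ℝ × ℝ => mirror i v p.1 p.2) (Iic 0 ×ˢ Ico 0 1) := by
  obtain ⟨C, hC⟩ := h.bounded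
  refine continuousOn_tsum (u := fun k => |seeley k| * ((2 : ℝ) ^ k) ^ i * C) (fun k => ?_)
    ((seeley_summable i).mul_right C) fun k p hp => ?_
  · refine continuousOn_const.mul ?_
    exact (ContDiffOn.continuousOn h.smooth).comp (f := fun p : ℝ × ℝ => (-(2 : ℝ) ^ k * p.1, p.2))
      (by fun_prop) fun p hp => ⟨neg_two_pow_mul_nonneg k hp.1, hp.2⟩
  · rw [norm_mul, norm_mul, norm_pow, norm_neg, Real.norm_of_nonneg (by positivity : (0 : ℝ) ≤ 2 ^ k)]
    exact mul_le_mul_of_nonneg_left (hC _ (neg_two_pow_mul_nonneg k hp.1) _ hp.2) (by positivity)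

theorem reflectExt_continuousOn (h : HalfOn c v) (i : ℕ) :
    ContinuousOn (fun p : ℝ × ℝ => reflectExt i v p.1 p.2) (univ ×ˢ Ico 0 1) := by
  have h1 : ContinuousOn (fun p : ℝ × ℝ => v (max p.1 0) p.2) (univ ×ˢ Ico 0 1) :=
    (ContDiffOn.continuousOn h.smooth).comp (f := fun p : ℝ × ℝ => (max p.1 0, p.2))
      (by fun_prop) fun p hp => ⟨le_max_right p.1 0, hp.2⟩
  have h2 : ContinuousOn (fun p : ℝ × ℝ => mirror i v (min p.1 0) p.2) (univ ×ˢ Ico 0 1) :=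
    (h.mirror_continuousOn i).comp (f := fun p : ℝ × ℝ => (min p.1 0, p.2))
      (by fun_prop) fun p hp => ⟨min_le_right p.1 0, hp.2⟩
  have h3 : ContinuousOn (fun p : ℝ × ℝ => v 0 p.2) (univ ×ˢ Ico 0 1) :=
    (ContDiffOn.continuousOn h.smooth).comp (f := fun p : ℝ × ℝ => ((0 : ℝ), p.2))
      (by fun_prop) fun p hp => ⟨self_mem_Ici, hp.2⟩
  refine (h1.add (h2.sub h3)).congr fun p _ => ?_
  simp only [Pi.add_apply, Pi.sub_apply]
  rcases le_or_gt 0 p.1 with hp | hp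
  · rw [reflectExt_of_nonneg i v hp, max_eq_left hp, min_eq_right hp, mirror_zero]
    ring
  · rw [reflectExt_of_neg i v hp, max_eq_right hp.le, min_eq_left hp.le]
    ring

theorem vanish (h : HalfOn c v) (hc : 0 ≤ c) {x : ℝ} (hx : x ∈ Ico (0 : ℝ) 1) :
    ∀ t, c < t → v t x = 0 := fun t ht => h.zero_t t (hc.trans ht.le) x hx ht

theorem reflectExt_hasDerivWithinAt_x (h : HalfOn c v) (hc : 0 ≤ c) (i : ℕ) (t : ℝ) {x : ℝ}
    (hx : x ∈ Ico (0 : ℝ) 1) : HasDerivWithinAt (reflectExt i v t)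
      (reflectExt i (Smoothing.pdx (Ico 0 1) v) t x) (Ico 0 1) x := by
  rcases le_or_gt 0 t with ht | ht
  · rw [reflectExt_of_nonneg _ _ ht, funext (reflectExt_of_nonneg i v ht)]
    exact h.smooth.hasDerivWithinAt_pdx uniqueDiffOn_Ico01 ht hx
  · obtain ⟨K, hK⟩ := mirror_eq_sum c ht
    rw [reflectExt_of_neg _ _ ht, funext (reflectExt_of_neg i v ht),
      hK i _ x (h.pdx.vanish hc hx) t le_rfl]
    have hd : HasDerivWithinAt
        (fun y => ∑ k ∈ Finset.range K, seeley k * (-(2 : ℝ) ^ k) ^ i * v (-(2 : ℝ) ^ k * t) y)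
        (∑ k ∈ Finset.range K, seeley k * (-(2 : ℝ) ^ k) ^ i *
          Smoothing.pdx (Ico 0 1) v (-(2 : ℝ) ^ k * t) x) (Ico 0 1) x :=
      HasDerivWithinAt.fun_sum fun k _ => (h.smooth.hasDerivWithinAt_pdx uniqueDiffOn_Ico01
        (neg_two_pow_mul_nonneg k ht.le) hx).const_mul _
    exact hd.congr (fun y hy => hK i v y (h.vanish hc hy) t le_rfl)
      (hK i v x (h.vanish hc hx) t le_rfl)

theorem hasDerivAt_t (h : HalfOn c v) {t x : ℝ} (ht : 0 < t) (hx : x ∈ Ico (0 : ℝ) 1) :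
    HasDerivAt (fun r => v r x) (Smoothing.pdt (Ici 0) v t x) t :=
  (h.smooth.hasDerivWithinAt_pdt (uniqueDiffOn_Ici 0) ht.le hx).hasDerivAt (Ici_mem_nhds ht)

/-- Each term gains a factor `-2^k`, which raises the index `i` by one. At the junction `t = 0` the
derivative exists because both sides have the same continuous limit of derivatives. -/
theorem reflectExt_hasDerivAt_t (h : HalfOn c v) (hc : 0 ≤ c) (i : ℕ) (t : ℝ) {x : ℝ}
    (hx : x ∈ Ico (0 : ℝ) 1) : HasDerivAt (fun r => reflectExt i v r x)
      (reflectExt (i + 1) (Smoothing.pdt (Ici 0) v) t x) t := by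
  have hcont : ∀ {w : ℝ → ℝ → ℝ}, HalfOn c w → ∀ j, Continuous fun r => reflectExt j w r x :=
    fun hw j => continuousOn_univ.1 ((hw.reflectExt_continuousOn j).comp
      (f := fun r : ℝ => (r, x)) (by fun_prop) fun r _ => ⟨mem_univ r, hx⟩)
  refine hasDerivAt_of_hasDerivAt_of_ne' (x := 0)
    (g := fun r => reflectExt (i + 1) (Smoothing.pdt (Ici 0) v) r x) (fun t ht => ?_)
    (hcont h i).continuousAt (hcont h.pdt (i + 1)).continuousAt t
  rcases ht.lt_or_gt with ht | ht
  · obtain ⟨K, hK⟩ := mirror_eq_sum c (by linarith : t / 2 < 0)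
    rw [reflectExt_of_neg _ _ ht, hK (i + 1) _ x (h.pdt.vanish hc hx) t (by linarith)]
    have hd : HasDerivAt
        (fun r => ∑ k ∈ Finset.range K, seeley k * (-(2 : ℝ) ^ k) ^ i * v (-(2 : ℝ) ^ k * r) x)
        (∑ k ∈ Finset.range K, seeley k * (-(2 : ℝ) ^ k) ^ (i + 1) *
          Smoothing.pdt (Ici 0) v (-(2 : ℝ) ^ k * t) x) t := by
      refine HasDerivAt.fun_sum fun k _ => ?_
      have hpos : 0 < -(2 : ℝ) ^ k * t := by
        have : (0 : ℝ) < 2 ^ k := by positivity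
        nlinarith
      have h1 : HasDerivAt (fun r => -(2 : ℝ) ^ k * r) (-(2 : ℝ) ^ k) t := by
        simpa using (hasDerivAt_id t).const_mul (-(2 : ℝ) ^ k)
      refine (((h.hasDerivAt_t hpos hx).comp t h1).const_mul
        (seeley k * (-(2 : ℝ) ^ k) ^ i)).congr_deriv ?_
      ring
    refine hd.congr_of_eventuallyEq ?_
    filter_upwards [gt_mem_nhds (by linarith : t < t / 2)] with r hr
    rw [reflectExt_of_neg _ _ (by linarith), hK i v x (h.vanish hc hx) r hr.le]
  · rw [reflectExt_of_nonneg _ _ ht.le]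
    refine (h.hasDerivAt_t ht hx).congr_of_eventuallyEq ?_
    filter_upwards [lt_mem_nhds ht] with r hr
    exact reflectExt_of_nonneg i v hr.le x

/-- The reflections with all indices `i` and all admissible `v` form a family closed under both
partial derivatives; this is why the index is part of the definition. -/
theorem reflectExt_smooth (h : HalfOn c v) (hc : 0 ≤ c) (i : ℕ) :
    SmoothOn (univ ×ˢ Ico 0 1) (reflectExt i v) := by
  refine smoothOn_of_partials uniqueDiffOn_Ico01
    {G | ∃ (i : ℕ) (v : ℝ → ℝ → ℝ), HalfOn c v ∧ G = reflectExt i v} ?_ _ ⟨i, v, h, rfl⟩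
  rintro _ ⟨i, v, hv, rfl⟩
  exact ⟨hv.reflectExt_continuousOn i, _, ⟨i + 1, _, hv.pdt, rfl⟩, _, ⟨i, _, hv.pdx, rfl⟩,
    fun t x hx => hv.reflectExt_hasDerivAt_t hc i t hx,
    fun t x hx => hv.reflectExt_hasDerivWithinAt_x hc i t hx⟩

theorem reflectExt_zero (h : HalfOn c v) {t x : ℝ} (hx : x ∈ Ico (0 : ℝ) 1)
    (htx : c < |t| ∨ 2 / 3 < x) (i : ℕ) : reflectExt i v t x = 0 := by
  have hv : ∀ s, 0 ≤ s → |t| ≤ s → v s x = 0 := fun s h0 hs => by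
    rcases htx with h1 | h1
    · exact h.zero_t s h0 x hx (h1.trans_le hs)
    · exact h.zero_x s h0 x hx h1
  rcases le_or_gt 0 t with ht | ht
  · rw [reflectExt_of_nonneg _ _ ht]
    exact hv t ht (abs_of_nonneg ht).le
  · rw [reflectExt_of_neg _ _ ht, mirror]
    refine (tsum_congr fun k => ?_).trans tsum_zero
    rw [hv _ (neg_two_pow_mul_nonneg k ht.le), mul_zero]
    have : (1 : ℝ) ≤ 2 ^ k := one_le_pow₀ (by norm_num)
    rw [abs_of_neg ht]
    nlinarith

end HalfOn

/-! ### Bounds for reflections in the time variable -/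

/-- The operator `-d²/dt²`. -/
noncomputable abbrev negD2 : (ℝ → ℝ) → ℝ → ℝ := dop (fun _ => -1) (fun _ => 0)

theorem negD2_apply (f : ℝ → ℝ) (t : ℝ) : negD2 f t = -deriv (deriv f) t := by
  simp [dop]

theorem timeLap_iterate (ι : ℕ) (U : ℝ → ℝ → ℝ) (t x : ℝ) :
    timeLap^[ι] U t x = negD2^[ι] (fun r => U r x) t := by
  induction ι generalizing U with
  | zero => rfl
  | succ ι ih =>
    rw [Function.iterate_succ_apply, Function.iterate_succ_apply, ih]
    refine congrFun (congrArg _ (funext fun r => ?_)) t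
    simp [timeLap, dop]

theorem negD2_smooth {O : Set ℝ} (hO : IsOpen O) {f : ℝ → ℝ} (hf : ContDiffOn ℝ ∞ f O) (k : ℕ) :
    ContDiffOn ℝ ∞ (negD2^[k] f) O :=
  smooth_dop_iterate hO contDiffOn_const contDiffOn_const hf k

theorem negD2_zero {O : Set ℝ} (hO : IsOpen O) {f : ℝ → ℝ} (hf : ∀ t ∈ O, f t = 0) (k : ℕ) :
    ∀ t ∈ O, negD2^[k] f t = 0 := fun t ht => by
  rw [dop_congr (g := fun _ => 0) hO hf k t ht]
  have : negD2^[k] (fun _ => (0 : ℝ)) = fun _ => 0 :=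
    Function.iterate_fixed (by funext x; simp [dop]) k
  rw [this]

theorem negD2_reflect (c : ℝ) (f : ℝ → ℝ) (k : ℕ) (t : ℝ) :
    negD2^[k] (fun s => f (c - s)) t = negD2^[k] f (c - t) := by
  induction k generalizing f with
  | zero => rfl
  | succ m ih =>
    rw [Function.iterate_succ_apply, Function.iterate_succ_apply, ← ih]
    refine congrFun (congrArg _ (funext fun s => ?_)) t
    have h1 : deriv (fun s => f (c - s)) = fun s => -deriv f (c - s) := by
      funext s; rw [deriv_comp_const_sub]
    have h2 : deriv (fun s => -deriv f (c - s)) s = deriv (deriv f) (c - s) := by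
      rw [deriv.fun_neg, deriv_comp_const_sub, neg_neg]
    rw [negD2_apply, h1, h2, negD2_apply]

theorem negD2_sum {f : ℝ → ℝ} (hf : ContDiffOn ℝ ∞ f (Ioi 0)) (K : ℕ) (b : ℕ → ℝ) (m : ℕ) :
    ∀ t ∈ Iio (0 : ℝ), negD2^[m] (fun t => ∑ k ∈ Finset.range K, b k * f (-(2 : ℝ) ^ k * t)) t =
      ∑ k ∈ Finset.range K, b k * ((2 : ℝ) ^ k) ^ (2 * m) * negD2^[m] f (-(2 : ℝ) ^ k * t) := by
  have hpos : ∀ (k : ℕ) {t : ℝ}, t < 0 → 0 < -(2 : ℝ) ^ k * t := fun k t ht => by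
    have : (0 : ℝ) < 2 ^ k := by positivity
    nlinarith
  have hd : ∀ {g : ℝ → ℝ}, ContDiffOn ℝ ∞ g (Ioi 0) → ∀ (d : ℕ → ℝ), ∀ t ∈ Iio (0 : ℝ),
      HasDerivAt (fun t => ∑ k ∈ Finset.range K, d k * g (-(2 : ℝ) ^ k * t))
        (∑ k ∈ Finset.range K, d k * -(2 : ℝ) ^ k * deriv g (-(2 : ℝ) ^ k * t)) t := by
    intro g hg d t ht
    refine HasDerivAt.fun_sum fun k _ => ?_
    have h1 : HasDerivAt (fun r => -(2 : ℝ) ^ k * r) (-(2 : ℝ) ^ k) t := by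
      simpa using (hasDerivAt_id t).const_mul (-(2 : ℝ) ^ k)
    refine (((smooth_hasDerivAt isOpen_Ioi hg (hpos k ht)).comp t h1).const_mul (d k)).congr_deriv ?_
    ring
  induction m with
  | zero => simp
  | succ m ih =>
    intro t ht
    rw [Function.iterate_succ_apply']
    have h1 := dop_congr (A := fun _ => -1) (B := fun _ => 0) isOpen_Iio ih 1 t ht
    simp only [Function.iterate_one] at h1
    have hg := negD2_smooth isOpen_Ioi hf m
    refine (h1.trans (negD2_apply _ t)).trans ?_
    rw [deriv2_eq isOpen_Iio (hd hg _) (hd (smooth_deriv isOpen_Ioi hg) _) ht,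
      ← Finset.sum_neg_distrib]
    refine Finset.sum_congr rfl fun k _ => ?_
    rw [Function.iterate_succ_apply', negD2_apply]
    ring

/-- The dilation by `2^k ≥ 1` can only decrease the integral. -/
theorem setLIntegral_dilate_le (F : ℝ → ℝ≥0∞) (k : ℕ) :
    ∫⁻ t in Iio (0 : ℝ), F (-(2 : ℝ) ^ k * t) ≤ ∫⁻ t in Ioi (0 : ℝ), F t := by
  have h2 : (0 : ℝ) < 2 ^ k := by positivity
  have hc : -(2 : ℝ) ^ k ≠ 0 := by linarith
  have hpre : (fun t => -(2 : ℝ) ^ k * t) ⁻¹' Ioi 0 = Iio 0 := by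
    ext t
    simp only [mem_preimage, mem_Ioi, mem_Iio]
    constructor <;> intro h <;> nlinarith
  have he := (Homeomorph.mulLeft₀ _ hc).measurableEmbedding
  have hm := Real.smul_map_volume_mul_left hc
  have e : ∫⁻ t in Ioi (0 : ℝ), F t = ENNReal.ofReal |-(2 : ℝ) ^ k| *
      ∫⁻ t in Iio (0 : ℝ), F (-(2 : ℝ) ^ k * t) := by
    conv_lhs => rw [← hm]
    rw [Measure.restrict_smul, lintegral_smul_measure, smul_eq_mul, ← hpre]
    congr 1
    rw [← Homeomorph.coe_mulLeft₀ _ hc, he.restrict_map, he.lintegral_map]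
    rfl
  rw [e]
  refine le_mul_of_one_le_left zero_le ?_
  rw [ENNReal.one_le_ofReal, abs_neg, abs_of_pos h2]
  exact one_le_pow₀ (by norm_num)

theorem enorm_sum_mul_sq_le {b h : ℕ → ℝ} (hb : Summable fun k => |b k|) (K : ℕ) :
    ‖∑ k ∈ Finset.range K, b k * h k‖ₑ ^ 2 ≤
      ENNReal.ofReal (∑' k, |b k|) * ∑' k, ENNReal.ofReal |b k| * ‖h k‖ₑ ^ 2 := by
  have h1 : (∑ k ∈ Finset.range K, b k * h k) ^ 2 ≤
      (∑ k ∈ Finset.range K, |b k|) * ∑ k ∈ Finset.range K, |b k| * h k ^ 2 :=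
    Finset.sum_sq_le_sum_mul_sum_of_sq_le_mul _ (fun _ _ => abs_nonneg _)
      (fun _ _ => by positivity) fun k _ => by
        rw [mul_pow, ← mul_assoc, abs_mul_abs_self, sq (b k)]
  rw [enorm_sq_eq]
  refine (ENNReal.ofReal_le_ofReal h1).trans ?_
  rw [ENNReal.ofReal_mul (Finset.sum_nonneg fun _ _ => abs_nonneg _)]
  refine mul_le_mul' (ENNReal.ofReal_le_ofReal (hb.sum_le_tsum _ fun _ _ => abs_nonneg _)) ?_
  rw [ENNReal.ofReal_sum_of_nonneg fun _ _ => by positivity]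
  refine le_trans (le_of_eq (Finset.sum_congr rfl fun k _ => ?_))
    (ENNReal.sum_le_tsum (Finset.range K))
  rw [ENNReal.ofReal_mul (abs_nonneg _), enorm_sq_eq]

/-- Differentiating `2m` times multiplies the `k`-th term by `2^(2mk)`, and these weights are still
summable. Cauchy–Schwarz with weights `|b_k|` then reduces the bound to the single dilations. -/
theorem mirror_bound (c : ℝ) (m : ℕ) : ∃ C : ℝ≥0, ∀ f : ℝ → ℝ, ContDiffOn ℝ ∞ f (Ioi 0) →
    (∀ t, c < t → f t = 0) →
      ∫⁻ t in Iio 0, ‖negD2^[m] (fun t => mirror 0 (fun r _ => f r) t 0) t‖ₑ ^ 2 ≤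
        C * ∫⁻ t in Ioi 0, ‖negD2^[m] f t‖ₑ ^ 2 := by
  set b : ℕ → ℝ := fun k => seeley k * ((2 : ℝ) ^ k) ^ (2 * m) with hb
  have hbs : Summable fun k => |b k| := by
    refine (seeley_summable (2 * m)).congr fun k => ?_
    rw [hb, abs_mul, abs_of_pos (by positivity : (0 : ℝ) < (2 ^ k) ^ (2 * m))]
  set S := (∑' k, |b k|).toNNReal with hS
  refine ⟨S * S, fun f hf hc => ?_⟩
  have hpt : ∀ t ∈ Iio (0 : ℝ), ‖negD2^[m] (fun t => mirror 0 (fun r _ => f r) t 0) t‖ₑ ^ 2 ≤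
      S * ∑' k, ENNReal.ofReal |b k| * ‖negD2^[m] f (-(2 : ℝ) ^ k * t)‖ₑ ^ 2 := by
    intro t ht
    obtain ⟨K, hK⟩ := mirror_eq_sum c (by have := mem_Iio.1 ht; linarith : t / 2 < 0)
    have e := dop_congr (A := fun _ => -1) (B := fun _ => 0) (isOpen_Iio (a := t / 2))
      (fun s hs => hK 0 (fun r _ => f r) 0 hc s (mem_Iio.1 hs).le) m t
      (by have := mem_Iio.1 ht; rw [mem_Iio]; linarith)
    rw [e]
    simp only [pow_zero, mul_one]
    rw [negD2_sum hf K seeley m t ht]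
    exact enorm_sum_mul_sq_le hbs K
  refine (setLIntegral_mono' measurableSet_Iio hpt).trans ?_
  rw [lintegral_const_mul' _ _ (by simp), lintegral_tsum fun k => ?_]
  · push_cast
    rw [mul_assoc]
    gcongr
    have h1 : ∀ k, ∫⁻ t in Iio 0, ENNReal.ofReal |b k| * ‖negD2^[m] f (-(2 : ℝ) ^ k * t)‖ₑ ^ 2 ≤
        ENNReal.ofReal |b k| * ∫⁻ t in Ioi 0, ‖negD2^[m] f t‖ₑ ^ 2 := fun k => by
      rw [lintegral_const_mul' _ _ (by simp)]
      exact mul_le_mul_right (setLIntegral_dilate_le (fun t => ‖negD2^[m] f t‖ₑ ^ 2) k) _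
    refine (ENNReal.tsum_le_tsum h1).trans ?_
    rw [ENNReal.tsum_mul_right, ← ENNReal.ofReal_tsum_of_nonneg (fun _ => abs_nonneg _) hbs]
    rfl
  · refine ((aemeasurable_of_continuousOn measurableSet_Iio ?_).pow_const 2).const_mul _
    refine (negD2_smooth isOpen_Ioi hf m).continuousOn.comp (by fun_prop) fun t ht => ?_
    have : (0 : ℝ) < 2 ^ k := by positivity
    have := mem_Iio.1 ht
    rw [mem_Ioi]
    nlinarith

theorem interiorOp_negD2 {T : ℝ} (hT : 0 < T) :
    InteriorOp (Ioo 0 T) univ (fun _ => -1) (fun _ => 0) (fun _ => 1) 0 T where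
  isOpen := isOpen_Ioo
  isOpen' := isOpen_univ
  sub := subset_univ _
  smoothA := contDiffOn_const
  smoothB := contDiffOn_const
  ne _ _ := by norm_num
  lt := hT
  sub1 := subset_rfl
  sub2 := subset_univ _
  contρ := continuousOn_const
  posρ _ _ := one_pos
  derivρ x _ := by simpa using hasDerivAt_const x (1 : ℝ)

theorem mirror_cutoff_bound {T : ℝ} (hT : 0 < T) {ζ : ℝ → ℝ} (hζ : ContDiff ℝ ∞ ζ)
    (h0 : ∀ t, 2 * T / 3 ≤ t → ζ t = 0) (m : ℕ) : ∃ C : ℝ≥0, ∀ f, ContDiffOn ℝ ∞ f (Ioo 0 T) →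
      ∫⁻ t in Iio 0, ‖negD2^[m] (fun t => mirror 0 (fun r _ => ζ r * f r) t 0) t‖ₑ ^ 2 ≤
        C * ∑ k ∈ Finset.range (m + 1), ∫⁻ t in Ioo 0 T, ‖negD2^[k] f t‖ₑ ^ 2 := by
  obtain ⟨C1, hC1⟩ := mirror_bound (2 * T / 3) m
  obtain ⟨C2, hC2⟩ := (interiorOp_negD2 hT).comb_bound
    (RegularOp.IsComb.dop_iterate (R := (interiorOp_negD2 hT).toRegularOp)
      (A' := fun _ => -1) (B' := fun _ => 0) contDiffOn_const contDiffOn_const hζ.contDiffOn m)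
  refine ⟨C1 * C2, fun f hf => ?_⟩
  have hz : ∀ t ∈ Ioi (2 * T / 3), ζ t * f t = 0 := fun t ht => by
    rw [h0 t (mem_Ioi.1 ht).le, zero_mul]
  -- `f` is smooth only on `]0, T[`, but the product vanishes beyond `2T/3`, so the values of `f`
  -- from `T` onwards do not matter.
  have hs : ContDiffOn ℝ ∞ (fun t => ζ t * f t) (Ioi 0) := by
    intro t ht
    rcases lt_or_ge t T with h | h
    · exact (((hζ.contDiffOn.mul hf) t ⟨ht, h⟩).contDiffAt
        (Ioo_mem_nhds ht h)).contDiffWithinAt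
    · have hev : (fun t => ζ t * f t) =ᶠ[𝓝 t] fun _ => 0 :=
        Filter.mem_of_superset (isOpen_Ioi.mem_nhds (show 2 * T / 3 < t by linarith)) hz
      exact (contDiffAt_const.congr_of_eventuallyEq hev).contDiffWithinAt
  refine (hC1 _ hs hz).trans ?_
  push_cast
  rw [mul_assoc]
  refine mul_le_mul_right (le_trans ?_ (hC2 f hf)) _
  refine (lintegral_mono_set (t := Ioo 0 T ∪ Ici T) fun t ht => ?_).trans
    ((lintegral_union_le _ _ _).trans ?_)
  · rcases lt_or_ge t T with h | h
    · exact Or.inl ⟨ht, h⟩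
    · exact Or.inr h
  · rw [setLIntegral_congr_fun (g := fun _ => 0) measurableSet_Ici fun t ht => ?_, lintegral_zero,
      add_zero]
    have := negD2_zero isOpen_Ioi hz m t (show 2 * T / 3 < t by have := mem_Ici.1 ht; linarith)
    simp only [this, enorm_zero]
    norm_num

/-! ### The extension operator in the time variable -/

/-- The cut-off in the time variable. -/
noncomputable def timeCut (T : ℝ) (χ : ℝ → ℝ) (t : ℝ) : ℝ := χ (t / T)

/-- The extension of functions on `[0,T]`. -/
noncomputable def timeExt (T : ℝ) (χ : ℝ → ℝ) (f : ℝ → ℝ) (t : ℝ) : ℝ :=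
  reflectExt 0 (fun r _ => timeCut T χ r * f r) t 0 +
    reflectExt 0 (fun r _ => (1 - timeCut T χ (T - r)) * f (T - r)) (T - t) 0

section timeExt

variable {T : ℝ} {χ : ℝ → ℝ}

theorem timeCut_contDiff (hχ : IsCutoff χ) (T : ℝ) : ContDiff ℝ ∞ (timeCut T χ) :=
  hχ.smooth.comp (contDiff_id.div_const T)

theorem timeCut_eq_one (hχ : IsCutoff χ) (hT : 0 < T) {t : ℝ} (ht : t ≤ T / 3) :
    timeCut T χ t = 1 := hχ.eq_one _ (by rw [div_le_iff₀ hT]; linarith)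

theorem timeCut_eq_zero (hχ : IsCutoff χ) (hT : 0 < T) {t : ℝ} (ht : 2 * T / 3 ≤ t) :
    timeCut T χ t = 0 := hχ.eq_zero _ (by rw [le_div_iff₀ hT]; linarith)

/-- For `t < 0` the second summand is `(1 - timeCut t) f t`, whose weight is 0, so the uncontrolled
value of `f` outside `[0,T]` does not enter. -/
theorem timeExt_of_neg (hχ : IsCutoff χ) (hT : 0 < T) (f : ℝ → ℝ) {t : ℝ} (ht : t < 0) :
    timeExt T χ f t = mirror 0 (fun r _ => timeCut T χ r * f r) t 0 := by
  rw [timeExt, reflectExt_of_neg _ _ ht, reflectExt_of_nonneg _ _ (by linarith), sub_sub_cancel,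
    timeCut_eq_one hχ hT (by linarith)]
  ring

theorem timeExt_of_mem (T : ℝ) (χ : ℝ → ℝ) (f : ℝ → ℝ) {t : ℝ} (ht : t ∈ Icc 0 T) :
    timeExt T χ f t = f t := by
  rw [timeExt, reflectExt_of_nonneg _ _ ht.1, reflectExt_of_nonneg _ _ (by linarith [ht.2]),
    sub_sub_cancel]
  ring

theorem timeExt_of_gt (hχ : IsCutoff χ) (hT : 0 < T) (f : ℝ → ℝ) {t : ℝ} (ht : T < t) :
    timeExt T χ f t =
      mirror 0 (fun r _ => (1 - timeCut T χ (T - r)) * f (T - r)) (T - t) 0 := by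
  rw [timeExt, reflectExt_of_nonneg _ _ (by linarith), reflectExt_of_neg _ _ (by linarith),
    timeCut_eq_zero hχ hT (by linarith)]
  ring

theorem setLIntegral_const_sub (c : ℝ) (F : ℝ → ℝ≥0∞) {s s' : Set ℝ}
    (h : (fun t => c - t) ⁻¹' s = s') : ∫⁻ t in s', F (c - t) = ∫⁻ t in s, F t := by
  rw [← (volume.measurePreserving_sub_left c).setLIntegral_comp_preimage_emb
    (MeasurableEquiv.subLeft c).measurableEmbedding F s, h]

theorem timeExt_bound (hχ : IsCutoff χ) (hT : 0 < T) (m : ℕ) :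
    ∃ C : ℝ≥0, ∀ f, ContDiffOn ℝ ∞ f (Ioo 0 T) →
      ∫⁻ t in Ioo (-(2 * T)) (2 * T), ‖negD2^[m] (timeExt T χ f) t‖ₑ ^ 2 ≤
        C * ∑ k ∈ Finset.range (m + 1), ∫⁻ t in Ioo 0 T, ‖negD2^[k] f t‖ₑ ^ 2 := by
  obtain ⟨C1, hC1⟩ := mirror_cutoff_bound hT (timeCut_contDiff hχ T)
    (fun t ht => timeCut_eq_zero hχ hT ht) m
  obtain ⟨C2, hC2⟩ := mirror_cutoff_bound hT (ζ := fun t => 1 - timeCut T χ (T - t))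
    (contDiff_const.sub ((timeCut_contDiff hχ T).comp (contDiff_const.sub contDiff_id)))
    (fun t ht => by rw [timeCut_eq_one hχ hT (by linarith)]; ring) m
  refine ⟨C1 + 1 + C2, fun f hf => ?_⟩
  set tot := ∑ k ∈ Finset.range (m + 1), ∫⁻ t in Ioo 0 T, ‖negD2^[k] f t‖ₑ ^ 2 with htot
  have hpre : (fun t => T - t) ⁻¹' Ioo 0 T = Ioo 0 T := by
    ext t
    simp only [mem_preimage, mem_Ioo]
    constructor <;> rintro ⟨h1, h2⟩ <;> constructor <;> linarith
  have hpre' : (fun t => T - t) ⁻¹' Iio 0 = Ioi T := by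
    ext t
    simp only [mem_preimage, mem_Iio, mem_Ioi, sub_neg]
  have b1 : ∫⁻ t in Iio 0, ‖negD2^[m] (timeExt T χ f) t‖ₑ ^ 2 ≤ C1 * tot := by
    refine le_trans (le_of_eq (setLIntegral_congr_fun measurableSet_Iio fun t ht => ?_)) (hC1 f hf)
    have := dop_congr (A := fun _ => -1) (B := fun _ => 0) isOpen_Iio
      (fun t ht => timeExt_of_neg hχ hT f (mem_Iio.1 ht)) m t ht
    simp only [this]
  have b2 : ∫⁻ t in Ioo 0 T, ‖negD2^[m] (timeExt T χ f) t‖ₑ ^ 2 ≤ 1 * tot := by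
    rw [one_mul]
    refine le_trans (le_of_eq (setLIntegral_congr_fun measurableSet_Ioo fun t ht => ?_))
      (Finset.single_le_sum (f := fun k => ∫⁻ t in Ioo 0 T, ‖negD2^[k] f t‖ₑ ^ 2)
        (fun _ _ => zero_le) (Finset.self_mem_range_succ m))
    have := dop_congr (A := fun _ => -1) (B := fun _ => 0) isOpen_Ioo
      (fun t ht => timeExt_of_mem T χ f (Ioo_subset_Icc_self ht)) m t ht
    simp only [this]
  have b3 : ∫⁻ t in Ioi T, ‖negD2^[m] (timeExt T χ f) t‖ₑ ^ 2 ≤ C2 * tot := by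
    have hf' : ContDiffOn ℝ ∞ (fun t => f (T - t)) (Ioo 0 T) :=
      hf.comp (contDiffOn_const.sub contDiffOn_id) fun t ht => by rwa [← hpre] at ht
    refine le_trans (le_of_eq ?_) ((hC2 _ hf').trans (le_of_eq ?_))
    · rw [← setLIntegral_const_sub T _ hpre']
      refine setLIntegral_congr_fun measurableSet_Ioi fun t ht => ?_
      have := dop_congr (A := fun _ => -1) (B := fun _ => 0) isOpen_Ioi
        (fun t ht => timeExt_of_gt hχ hT f (mem_Ioi.1 ht)) m t ht
      simp only [this]
      rw [negD2_reflect T (fun s =>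
        mirror 0 (fun r _ => (1 - timeCut T χ (T - r)) * f (T - r)) s 0) m t]
    · congr 1
      refine Finset.sum_congr rfl fun k _ => ?_
      rw [← setLIntegral_const_sub T (fun t => ‖negD2^[k] f t‖ₑ ^ 2) hpre]
      refine setLIntegral_congr_fun measurableSet_Ioo fun t _ => ?_
      simp only [negD2_reflect]
  have hcover : ∫⁻ t in Ioo (-(2 * T)) (2 * T), ‖negD2^[m] (timeExt T χ f) t‖ₑ ^ 2 ≤
      (∫⁻ t in Iic 0, ‖negD2^[m] (timeExt T χ f) t‖ₑ ^ 2) +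
      ((∫⁻ t in Ioc 0 T, ‖negD2^[m] (timeExt T χ f) t‖ₑ ^ 2) +
      ∫⁻ t in Ioi T, ‖negD2^[m] (timeExt T χ f) t‖ₑ ^ 2) := by
    refine le_trans (lintegral_mono_set fun t _ => ?_) ((lintegral_union_le _ _ _).trans
      (add_le_add_right (lintegral_union_le _ _ _) _))
    rcases le_or_gt t 0 with h | h
    · exact Or.inl h
    · rcases le_or_gt t T with h' | h'
      · exact Or.inr (Or.inl ⟨h, h'⟩)
      · exact Or.inr (Or.inr h')
  refine hcover.trans ?_
  rw [← setLIntegral_congr Iio_ae_eq_Iic, ← setLIntegral_congr Ioo_ae_eq_Ioc]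
  refine (add_le_add b1 (add_le_add b2 b3)).trans (le_of_eq ?_)
  push_cast
  ring

end timeExt

/-! ### Commutation of the operators in the two variables -/

section Commutation

variable {I J : Set ℝ} {U : ℝ → ℝ → ℝ}

theorem pdt_pdx_comm (hI : IsOpen I) (hJ : IsOpen J) (hU : SmoothOn (I ×ˢ J) U) {t x : ℝ}
    (ht : t ∈ I) (hx : x ∈ J) : pdt I (pdx J U) t x = pdx J (pdt I U) t x := by
  set F : ℝ × ℝ → ℝ := fun p => U p.1 p.2 with hF
  have hR : IsOpen (I ×ˢ J) := hI.prod hJ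
  have hd : ∀ p ∈ I ×ˢ J, fderivWithin ℝ F (I ×ˢ J) p = fderiv ℝ F p := fun p hp =>
    fderivWithin_of_isOpen hR hp
  have hcd : ContDiffAt ℝ ∞ F (t, x) := hU.contDiffAt (hR.mem_nhds ⟨ht, hx⟩)
  have h2 : HasFDerivAt (fderiv ℝ F) (fderiv ℝ (fderiv ℝ F) (t, x)) (t, x) :=
    ((hcd.fderiv_right (m := 1) (by norm_cast)).differentiableAt (by norm_num)).hasFDerivAt
  have hsymm := hcd.isSymmSndFDerivAt (by
    rw [minSmoothness_of_isRCLikeNormedField]; norm_cast)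
  have e1 : HasDerivAt (fun r => pdx J U r x) (fderiv ℝ (fderiv ℝ F) (t, x) (1, 0) (0, 1)) t := by
    have hc : HasDerivAt (fun r : ℝ => (r, x)) ((1 : ℝ), (0 : ℝ)) t :=
      (hasDerivAt_id t).prodMk (hasDerivAt_const t x)
    have h3 := ((ContinuousLinearMap.apply ℝ ℝ ((0 : ℝ), (1 : ℝ))).hasFDerivAt.comp_hasDerivAt t
      (h2.comp_hasDerivAt t hc))
    refine h3.congr_of_eventuallyEq ?_
    filter_upwards [hI.mem_nhds ht] with r hr
    rw [hU.pdx_eq hJ.uniqueDiffOn hr hx, hd (r, x) ⟨hr, hx⟩]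
    rfl
  have e2 : HasDerivAt (pdt I U t) (fderiv ℝ (fderiv ℝ F) (t, x) (0, 1) (1, 0)) x := by
    have hc : HasDerivAt (fun r : ℝ => (t, r)) ((0 : ℝ), (1 : ℝ)) x :=
      (hasDerivAt_const x t).prodMk (hasDerivAt_id x)
    have h3 := ((ContinuousLinearMap.apply ℝ ℝ ((1 : ℝ), (0 : ℝ))).hasFDerivAt.comp_hasDerivAt x
      (h2.comp_hasDerivAt x hc))
    refine h3.congr_of_eventuallyEq ?_
    filter_upwards [hJ.mem_nhds hx] with r hr
    rw [hU.pdt_eq hI.uniqueDiffOn ht hr, hd (t, r) ⟨ht, hr⟩]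
    rfl
  rw [Smoothing.pdt, e1.hasDerivWithinAt.derivWithin (hI.uniqueDiffOn t ht), Smoothing.pdx,
    e2.hasDerivWithinAt.derivWithin (hJ.uniqueDiffOn x hx)]
  exact hsymm _ _

theorem pdt_congr {V : ℝ → ℝ → ℝ} (h : ∀ t ∈ I, ∀ x ∈ J, U t x = V t x) :
    ∀ t ∈ I, ∀ x ∈ J, pdt I U t x = pdt I V t x := fun t ht x hx =>
  derivWithin_congr (fun r hr => h r hr x hx) (h t ht x hx)

theorem pdx_congr {V : ℝ → ℝ → ℝ} (h : ∀ t ∈ I, ∀ x ∈ J, U t x = V t x) :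
    ∀ t ∈ I, ∀ x ∈ J, pdx J U t x = pdx J V t x := fun t ht x hx =>
  derivWithin_congr (fun r hr => h t ht r hr) (h t ht x hx)

theorem SmoothOn.hasDerivAt_pdt (hU : SmoothOn (I ×ˢ J) U) (hI : IsOpen I) {t x : ℝ} (ht : t ∈ I)
    (hx : x ∈ J) : HasDerivAt (fun r => U r x) (Smoothing.pdt I U t x) t :=
  (hU.hasDerivWithinAt_pdt hI.uniqueDiffOn ht hx).hasDerivAt (hI.mem_nhds ht)

theorem SmoothOn.hasDerivAt_pdx (hU : SmoothOn (I ×ˢ J) U) (hJ : IsOpen J) {t x : ℝ} (ht : t ∈ I)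
    (hx : x ∈ J) : HasDerivAt (U t) (Smoothing.pdx J U t x) x :=
  (hU.hasDerivWithinAt_pdx hJ.uniqueDiffOn ht hx).hasDerivAt (hJ.mem_nhds hx)

theorem timeLap_eq_pdt (hI : IsOpen I) (hJ : UniqueDiffOn ℝ J) (hU : SmoothOn (I ×ˢ J) U) :
    ∀ t ∈ I, ∀ x ∈ J, timeLap U t x = -pdt I (pdt I U) t x := fun t ht x hx => by
  rw [timeLap, deriv2_eq hI (fun r hr => hU.hasDerivAt_pdt hI hr hx)
    (fun r hr => (hU.pdt hI.uniqueDiffOn hJ).hasDerivAt_pdt hI hr hx) ht]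

theorem lap_eq_pdx (M : ℝ) (hI : UniqueDiffOn ℝ I) (hJ : IsOpen J) (hU : SmoothOn (I ×ˢ J) U) :
    ∀ t ∈ I, ∀ x ∈ J, lap M (U t) x = x * pdx J (pdx J U) t x + M / 2 * pdx J U t x :=
  fun _ ht _ hx => lap_eq hJ (fun _ hy => hU.hasDerivAt_pdx hJ ht hy)
    (fun _ hy => (hU.pdx hI hJ.uniqueDiffOn).hasDerivAt_pdx hJ ht hy) hx

theorem SmoothOn.timeLap (hI : IsOpen I) (hJ : UniqueDiffOn ℝ J) (hU : SmoothOn (I ×ˢ J) U) :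
    SmoothOn (I ×ˢ J) (timeLap U) :=
  (((hU.pdt hI.uniqueDiffOn hJ).pdt hI.uniqueDiffOn hJ).neg).congr fun p hp =>
    timeLap_eq_pdt hI hJ hU p.1 hp.1 p.2 hp.2

theorem SmoothOn.lap (M : ℝ) (hI : UniqueDiffOn ℝ I) (hJ : IsOpen J) (hU : SmoothOn (I ×ˢ J) U) :
    SmoothOn (I ×ˢ J) (fun t => lap M (U t)) := by
  have h1 := hU.pdx hI hJ.uniqueDiffOn
  have h2 := h1.pdx hI hJ.uniqueDiffOn
  exact (((SmoothOn.of_snd contDiffOn_id fun p _ => mem_univ p.2).mul h2).add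
    (h1.const_mul (M / 2))).congr fun p hp => lap_eq_pdx M hI hJ hU p.1 hp.1 p.2 hp.2

theorem SmoothOn.timeLap_iterate (hI : IsOpen I) (hJ : UniqueDiffOn ℝ J) (hU : SmoothOn (I ×ˢ J) U)
    (ι : ℕ) : SmoothOn (I ×ˢ J) (Smoothing.timeLap^[ι] U) := by
  induction ι with
  | zero => exact hU
  | succ ι ih =>
    rw [Function.iterate_succ_apply']
    exact ih.timeLap hI hJ

theorem SmoothOn.lap_iterate (M : ℝ) (hI : UniqueDiffOn ℝ I) (hJ : IsOpen J)
    (hU : SmoothOn (I ×ˢ J) U) (κ : ℕ) :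
    SmoothOn (I ×ˢ J) (fun t => (Smoothing.lap M)^[κ] (U t)) := by
  induction κ with
  | zero => exact hU
  | succ κ ih =>
    simp only [Function.iterate_succ_apply']
    exact ih.lap M hI hJ

theorem pdt2_pdx_comm (hI : IsOpen I) (hJ : IsOpen J) (hU : SmoothOn (I ×ˢ J) U) :
    ∀ t ∈ I, ∀ x ∈ J, pdt I (pdt I (pdx J U)) t x = pdx J (pdt I (pdt I U)) t x :=
  fun t ht x hx => by
    rw [pdt_congr (fun t ht x hx => pdt_pdx_comm hI hJ hU ht hx) t ht x hx,
      pdt_pdx_comm hI hJ (hU.pdt hI.uniqueDiffOn hJ.uniqueDiffOn) ht hx]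

theorem timeLap_lap (M : ℝ) (hI : IsOpen I) (hJ : IsOpen J) (hU : SmoothOn (I ×ˢ J) U) :
    ∀ t ∈ I, ∀ x ∈ J, timeLap (fun r => lap M (U r)) t x = lap M (timeLap U t) x := by
  intro t ht x hx
  have uI : UniqueDiffOn ℝ I := hI.uniqueDiffOn
  have uJ : UniqueDiffOn ℝ J := hJ.uniqueDiffOn
  have hx1 := hU.pdx uI uJ
  have hx2 := hx1.pdx uI uJ
  have ht1 := hU.pdt uI uJ
  have ht2 := ht1.pdt uI uJ
  have e1 := timeLap_congr hI (lap_eq_pdx M uI hJ hU) 1 t ht x hx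
  simp only [Function.iterate_one] at e1
  have e2 : timeLap (fun t x => x * pdx J (pdx J U) t x + M / 2 * pdx J U t x) t x =
      -(x * pdt I (pdt I (pdx J (pdx J U))) t x + M / 2 * pdt I (pdt I (pdx J U)) t x) := by
    have d : ∀ {V W : ℝ → ℝ → ℝ}, SmoothOn (I ×ˢ J) V → SmoothOn (I ×ˢ J) W → ∀ r ∈ I,
        HasDerivAt (fun r => x * V r x + M / 2 * W r x) (x * pdt I V r x + M / 2 * pdt I W r x) r :=
      fun hV hW r hr => ((hV.hasDerivAt_pdt hI hr hx).const_mul x).fun_add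
        ((hW.hasDerivAt_pdt hI hr hx).const_mul (M / 2))
    rw [timeLap, deriv2_eq hI (d hx2 hx1) (d (hx2.pdt uI uJ) (hx1.pdt uI uJ)) ht]
  have e3 := lap_congr (M := M) hJ (timeLap_eq_pdt hI uJ hU t ht) 1 x hx
  simp only [Function.iterate_one] at e3
  have e4 : lap M (fun x => -pdt I (pdt I U) t x) x =
      x * -pdx J (pdx J (pdt I (pdt I U))) t x + M / 2 * -pdx J (pdt I (pdt I U)) t x :=
    lap_eq hJ (fun y hy => (ht2.hasDerivAt_pdx hJ ht hy).fun_neg)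
      (fun y hy => ((ht2.pdx uI uJ).hasDerivAt_pdx hJ ht hy).fun_neg) hx
  refine e1.trans (e2.trans (Eq.trans ?_ (e3.trans e4).symm))
  rw [pdt2_pdx_comm hI hJ hx1 t ht x hx, pdt2_pdx_comm hI hJ hU t ht x hx,
    pdx_congr (pdt2_pdx_comm hI hJ hU) t ht x hx]
  ring

/-- The `♯`-norm applies the space operator first, whereas `norm2` applies the time operator first;
symmetry of mixed derivatives reconciles the two. -/
theorem timeLap_lap_iterate (M : ℝ) (hI : IsOpen I) (hJ : IsOpen J) (hU : SmoothOn (I ×ˢ J) U)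
    (ι κ : ℕ) : ∀ t ∈ I, ∀ x ∈ J,
      timeLap^[ι] (fun r => (lap M)^[κ] (U r)) t x = (lap M)^[κ] (timeLap^[ι] U t) x := by
  have one : ∀ κ : ℕ, ∀ {U : ℝ → ℝ → ℝ}, SmoothOn (I ×ˢ J) U → ∀ t ∈ I, ∀ x ∈ J,
      timeLap (fun r => (lap M)^[κ] (U r)) t x = (lap M)^[κ] (timeLap U t) x := by
    intro κ
    induction κ with
    | zero => exact fun _ _ _ _ _ => rfl
    | succ κ ih =>
      intro U hU t ht x hx
      simp only [Function.iterate_succ_apply]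
      rw [ih (hU.lap M hI.uniqueDiffOn hJ) t ht x hx]
      exact lap_congr hJ (timeLap_lap M hI hJ hU t ht) κ x hx
  induction ι generalizing U with
  | zero => exact fun _ _ _ _ => rfl
  | succ ι ih =>
    intro t ht x hx
    rw [Function.iterate_succ_apply, Function.iterate_succ_apply,
      ← ih (hU.timeLap hI hJ.uniqueDiffOn) t ht x hx]
    exact timeLap_congr hI (one κ hU) ι t ht x hx

end Commutation

/-! ### Integrals over rectangles -/

section Tonelli

variable {I : Set ℝ} {F : ℝ → ℝ → ℝ}

theorem aemeasurable_rect (M : ℝ) (hI : MeasurableSet I)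
    (hF : ContinuousOn (fun p : ℝ × ℝ => F p.1 p.2) (I ×ˢ Ioo 0 1)) :
    AEMeasurable (fun p : ℝ × ℝ => ‖F p.1 p.2‖ₑ ^ 2 * ENNReal.ofReal (p.2 ^ (M / 2 - 1)))
      ((volume.restrict I).prod (volume.restrict (Ioo 0 1))) := by
  rw [Measure.prod_restrict]
  exact ((hF.aestronglyMeasurable (hI.prod measurableSet_Ioo)).enorm.pow_const 2).mul
    (by fun_prop)

theorem aemeasurable_l2Sq (M : ℝ) (hI : MeasurableSet I)
    (hF : ContinuousOn (fun p : ℝ × ℝ => F p.1 p.2) (I ×ˢ Ioo 0 1)) :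
    AEMeasurable (fun t => l2Sq M (F t)) (volume.restrict I) :=
  (aemeasurable_rect M hI hF).lintegral_prod_right'

theorem aemeasurable_time (M : ℝ) (hI : MeasurableSet I)
    (hF : ContinuousOn (fun p : ℝ × ℝ => F p.1 p.2) (I ×ˢ Ioo 0 1)) :
    AEMeasurable (fun x => (∫⁻ t in I, ‖F t x‖ₑ ^ 2) * ENNReal.ofReal (x ^ (M / 2 - 1)))
      (volume.restrict (Ioo 0 1)) := by
  have h := (aemeasurable_rect M hI hF).lintegral_prod_left'
  simpa only [lintegral_mul_const' _ _ ENNReal.ofReal_ne_top] using h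

/-- Exchanging the integrals allows one-variable time estimates to be applied for each fixed `x`. -/
theorem lintegral_l2Sq (M : ℝ) (hI : MeasurableSet I)
    (hF : ContinuousOn (fun p : ℝ × ℝ => F p.1 p.2) (I ×ˢ Ioo 0 1)) :
    ∫⁻ t in I, l2Sq M (F t) =
      ∫⁻ x in Ioo (0 : ℝ) 1, (∫⁻ t in I, ‖F t x‖ₑ ^ 2) * ENNReal.ofReal (x ^ (M / 2 - 1)) := by
  unfold l2Sq
  rw [lintegral_lintegral_swap (aemeasurable_rect M hI hF)]
  simp only [lintegral_mul_const' _ _ ENNReal.ofReal_ne_top]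

end Tonelli

/-! ### Equivalence of the space-time norms in a chart -/

theorem rpow_half_orders_le {ν : ℕ} {X Y : ℕ × ℕ → ℝ≥0∞} {C : ℕ × ℕ → ℝ≥0}
    (h : ∀ p ∈ orders ν, X p ≤ C p * ∑ q ∈ orders ν, Y q) :
    (∑ p ∈ orders ν, X p) ^ (1 / 2 : ℝ) ≤
      (NNReal.sqrt (∑ p ∈ orders ν, C p) : ℝ≥0) * (∑ q ∈ orders ν, Y q) ^ (1 / 2 : ℝ) := by
  have h1 : ∑ p ∈ orders ν, X p ≤ ((∑ p ∈ orders ν, C p : ℝ≥0) : ℝ≥0∞) * ∑ q ∈ orders ν, Y q := by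
    push_cast
    rw [Finset.sum_mul]
    exact Finset.sum_le_sum h
  refine (ENNReal.rpow_le_rpow h1 (by norm_num)).trans_eq ?_
  rw [ENNReal.mul_rpow_of_nonneg _ _ (by norm_num), NNReal.sqrt_eq_rpow,
    ENNReal.coe_rpow_of_nonneg _ (by norm_num)]

theorem sum_range_le_orders {ν : ℕ} {p : ℕ × ℕ} (hp : p ∈ orders ν) (Y : ℕ × ℕ → ℝ≥0∞) :
    ∑ k ∈ Finset.range (p.2 + 1), Y (p.1, k) ≤ ∑ q ∈ orders ν, Y q := by
  refine (Finset.sum_map (Finset.range (p.2 + 1)) ⟨fun k => (p.1, k), fun a b h => by simpa using h⟩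
    Y).symm.le.trans (Finset.sum_le_sum_of_subset fun q hq => ?_)
  obtain ⟨k, hk, rfl⟩ := Finset.mem_map.1 hq
  have h1 := mem_orders.1 hp
  have h2 := Finset.mem_range.1 hk
  exact mem_orders.2 (show p.1 + k ≤ ν by omega)

theorem sum_range_le_orders' {ν : ℕ} {p : ℕ × ℕ} (hp : p ∈ orders ν) (Y : ℕ × ℕ → ℝ≥0∞) :
    ∑ j ∈ Finset.range (p.1 + 1), Y (j, p.2) ≤ ∑ q ∈ orders ν, Y q := by
  refine (Finset.sum_map (Finset.range (p.1 + 1)) ⟨fun k => (k, p.2), fun a b h => by simpa using h⟩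
    Y).symm.le.trans (Finset.sum_le_sum_of_subset fun q hq => ?_)
  obtain ⟨k, hk, rfl⟩ := Finset.mem_map.1 hq
  have h1 := mem_orders.1 hp
  have h2 := Finset.mem_range.1 hk
  exact mem_orders.2 (show k + p.2 ≤ ν by omega)

theorem timeLap_chart (ι : ℕ) (V : ℝ → ℝ → ℝ) (c : ℝ → ℝ) (t : ℝ) :
    timeLap^[ι] (fun t x => V t (c x)) t = fun x => timeLap^[ι] V t (c x) := by
  funext x
  rw [timeLap_iterate, timeLap_iterate]

/-- The norm of functions on `]0,T[ × ]0,1[`, in one of the charts, that corresponds to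
`sharpNorm`. -/
noncomputable def chartNorm (M T : ℝ) (ν : ℕ) (V : ℝ → ℝ → ℝ) : ℝ≥0∞ :=
  (∑ p ∈ orders ν, ∫⁻ t in Ioo 0 T,
    l2Sq M (timeLap^[p.1] (fun r => (lap M)^[p.2] (V r)) t)) ^ (1 / 2 : ℝ)

theorem norm2_chart_le {N : ℝ} (hN : 5 ≤ N) (T : ℝ) {χ : ℝ → ℝ} (hχ : IsCutoff χ) (μ : Fin 2)
    (ν : ℕ) : ∃ C : ℝ≥0, ∀ V, SmoothOn (Ioo 0 T ×ˢ Ioo 0 1) V →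
      norm2 N T χ ν (fun t x => V t (chart μ x)) ≤ C * chartNorm (param N μ) T ν V := by
  choose C hC using fun κ => starNormSq_chart_le hN hχ μ κ
  refine ⟨NNReal.sqrt (∑ p ∈ orders ν, C p.2), fun V hV => ?_⟩
  refine rpow_half_orders_le (C := fun p => C p.2) fun p hp => ?_
  refine le_trans ?_ (mul_le_mul_right (sum_range_le_orders hp _) _)
  have hs : ∀ k, SmoothOn (Ioo 0 T ×ˢ Ioo 0 1)
      (timeLap^[p.1] (fun r => (lap (param N μ))^[k] (V r))) := fun k =>
    (hV.lap_iterate _ isOpen_Ioo.uniqueDiffOn isOpen_Ioo k).timeLap_iterate isOpen_Ioo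
      isOpen_Ioo.uniqueDiffOn p.1
  rw [← lintegral_finsetSum' _ fun k _ =>
    aemeasurable_l2Sq _ measurableSet_Ioo (ContDiffOn.continuousOn (hs k)),
    ← lintegral_const_mul' _ _ (by simp)]
  refine setLIntegral_mono' measurableSet_Ioo fun t ht => ?_
  rw [timeLap_chart]
  refine (hC p.2 _ ((hV.timeLap_iterate isOpen_Ioo isOpen_Ioo.uniqueDiffOn p.1).slice_snd ht)).trans
    (le_of_eq ?_)
  congr 1
  refine Finset.sum_congr rfl fun k _ => l2Sq_congr fun x hx => ?_
  exact (timeLap_lap_iterate _ isOpen_Ioo isOpen_Ioo hV p.1 k t ht x hx).symm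

theorem lintegral_lap_le {N : ℝ} (hN : 5 ≤ N) (T : ℝ) {χ : ℝ → ℝ} (hχ : IsCutoff χ) (μ : Fin 2)
    (ι κ : ℕ) : ∃ C : ℝ≥0, ∀ V, SmoothOn (Ioo 0 T ×ˢ Ioo 0 1) V →
      (∀ t ∈ Ioo 0 T, ∀ x ∈ Ioo (0 : ℝ) 1, 2 / 3 ≤ x → V t x = 0) →
      ∫⁻ t in Ioo 0 T, l2Sq (param N μ) (timeLap^[ι] (fun r => (lap (param N μ))^[κ] (V r)) t) ≤
        C * ∫⁻ t in Ioo 0 T, starNormSq N χ κ (timeLap^[ι] (fun t x => V t (chart μ x)) t) := by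
  obtain ⟨C, hC⟩ := l2Sq_le_starNormSq hN hχ μ κ
  refine ⟨C, fun V hV h0 => ?_⟩
  rw [← lintegral_const_mul' _ _ (by simp)]
  refine setLIntegral_mono' measurableSet_Ioo fun t ht => ?_
  have h2 : l2Sq (param N μ) (timeLap^[ι] (fun r => (lap (param N μ))^[κ] (V r)) t) =
      l2Sq (param N μ) ((lap (param N μ))^[κ] (timeLap^[ι] V t)) :=
    l2Sq_congr (timeLap_lap_iterate _ isOpen_Ioo isOpen_Ioo hV ι κ t ht)
  rw [timeLap_chart ι V (chart μ) t, h2]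
  refine hC _ ((hV.timeLap_iterate isOpen_Ioo isOpen_Ioo.uniqueDiffOn ι).slice_snd ht)
    fun x hx hx2 => ?_
  rw [timeLap_iterate]
  exact negD2_zero isOpen_Ioo (fun t ht => h0 t ht x hx hx2) ι t ht

theorem chartNorm_le {N : ℝ} (hN : 5 ≤ N) (T : ℝ) {χ : ℝ → ℝ} (hχ : IsCutoff χ) (μ : Fin 2)
    (ν : ℕ) : ∃ C : ℝ≥0, ∀ V, SmoothOn (Ioo 0 T ×ˢ Ioo 0 1) V →
      (∀ t ∈ Ioo 0 T, ∀ x ∈ Ioo (0 : ℝ) 1, 2 / 3 ≤ x → V t x = 0) →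
      chartNorm (param N μ) T ν V ≤ C * norm2 N T χ ν (fun t x => V t (chart μ x)) := by
  choose C hC using fun p : ℕ × ℕ => lintegral_lap_le hN T hχ μ p.1 p.2
  refine ⟨NNReal.sqrt (∑ p ∈ orders ν, C p), fun V hV h0 => ?_⟩
  refine rpow_half_orders_le (C := C) fun p hp => (hC p V hV h0).trans ?_
  exact mul_le_mul_right (Finset.single_le_sum (f := fun p : ℕ × ℕ => ∫⁻ t in Ioo 0 T,
    starNormSq N χ p.2 (timeLap^[p.1] (fun t x => V t (chart μ x)) t)) (fun _ _ => zero_le) hp) _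

/-! ### The extension operator -/

/-- The extension operator for functions on `[0,T] × [0,1[`. -/
noncomputable def extension (T : ℝ) (χ : ℝ → ℝ) (u : ℝ → ℝ → ℝ) (t x : ℝ) : ℝ :=
  timeExt T χ (fun r => u r x) t

section Extension

variable {T : ℝ} {χ : ℝ → ℝ}

/-- At a fixed time the extension is a finite combination of values of `f` in `[0,T]`, with
coefficients independent of `f`. Linearity and commutation with the space operator follow at once.
-/
theorem timeExt_eq_sum (hχ : IsCutoff χ) (hT : 0 < T) (t : ℝ) : ∃ (K : ℕ) (c τ : ℕ → ℝ),
    (∀ k, τ k ∈ Icc 0 T) ∧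
      ∀ f, timeExt T χ f t = ∑ k ∈ Finset.range K, c k * f (τ k) := by
  rcases lt_or_ge t 0 with ht | ht
  · obtain ⟨K, hK⟩ := mirror_eq_sum (2 * T / 3) ht
    refine ⟨K, fun k => seeley k * timeCut T χ (-(2 : ℝ) ^ k * t),
      -- The cap at `T` keeps the sample points in `[0,T]`; it takes effect only where the cut-off
      -- makes the coefficient 0.
      fun k => min (-(2 : ℝ) ^ k * t) T,
      fun k => ⟨le_min (neg_two_pow_mul_nonneg k ht.le) hT.le, min_le_right _ _⟩, fun f => ?_⟩
    rw [timeExt_of_neg hχ hT f ht, hK 0 _ 0 (fun s hs => by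
      rw [timeCut_eq_zero hχ hT hs.le, zero_mul]) t le_rfl]
    refine Finset.sum_congr rfl fun k _ => ?_
    simp only [pow_zero, mul_one]
    rcases le_or_gt (-(2 : ℝ) ^ k * t) T with h | h
    · rw [min_eq_left h]
      ring
    · rw [timeCut_eq_zero hχ hT (by linarith)]
      ring
  rcases le_or_gt t T with ht' | ht'
  · refine ⟨1, fun _ => 1, fun _ => t, fun _ => ⟨ht, ht'⟩, fun f => ?_⟩
    rw [timeExt_of_mem T χ f ⟨ht, ht'⟩]
    simp
  · obtain ⟨K, hK⟩ := mirror_eq_sum (2 * T / 3) (by linarith : T - t < 0)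
    refine ⟨K, fun k => seeley k * (1 - timeCut T χ (T - -(2 : ℝ) ^ k * (T - t))),
      fun k => T - min (-(2 : ℝ) ^ k * (T - t)) T, fun k => ⟨?_, ?_⟩, fun f => ?_⟩
    · have := min_le_right (-(2 : ℝ) ^ k * (T - t)) T
      linarith
    · have := le_min (neg_two_pow_mul_nonneg k (by linarith : T - t ≤ 0)) hT.le
      linarith
    rw [timeExt_of_gt hχ hT f ht', hK 0 _ 0 (fun s hs => by
      rw [timeCut_eq_one hχ hT (by linarith), sub_self, zero_mul]) (T - t) le_rfl]
    refine Finset.sum_congr rfl fun k _ => ?_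
    simp only [pow_zero, mul_one]
    rcases le_or_gt (-(2 : ℝ) ^ k * (T - t)) T with h | h
    · rw [min_eq_left h]
      ring
    · rw [timeCut_eq_one hχ hT (by linarith)]
      ring

theorem lap_sum (M : ℝ) {O : Set ℝ} (hO : IsOpen O) (K : ℕ) (c : ℕ → ℝ) {g : ℕ → ℝ → ℝ}
    (hg : ∀ k, ContDiffOn ℝ ∞ (g k) O) (κ : ℕ) : ∀ x ∈ O,
      (lap M)^[κ] (fun x => ∑ k ∈ Finset.range K, c k * g k x) x =
        ∑ k ∈ Finset.range K, c k * (lap M)^[κ] (g k) x := by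
  have hd : ∀ {g : ℕ → ℝ → ℝ}, (∀ k, ContDiffOn ℝ ∞ (g k) O) → ∀ x ∈ O,
      HasDerivAt (fun x => ∑ k ∈ Finset.range K, c k * g k x)
        (∑ k ∈ Finset.range K, c k * deriv (g k) x) x := fun hg x hx =>
    HasDerivAt.fun_sum fun k _ => (smooth_hasDerivAt hO (hg k) hx).const_mul (c k)
  induction κ with
  | zero => exact fun _ _ => rfl
  | succ κ ih =>
    intro x hx
    have hs : ∀ k, ContDiffOn ℝ ∞ ((lap M)^[κ] (g k)) O := fun k =>
      smooth_lap_iterate M hO (hg k) κ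
    rw [Function.iterate_succ_apply']
    refine (lap_congr hO ih 1 x hx).trans ?_
    rw [Function.iterate_one, lap_eq hO (hd hs) (hd fun k => smooth_deriv hO (hs k)) hx,
      Finset.mul_sum, Finset.mul_sum, ← Finset.sum_add_distrib]
    refine Finset.sum_congr rfl fun k _ => ?_
    rw [Function.iterate_succ_apply', lap]
    ring

theorem lap_extension (hχ : IsCutoff χ) (hT : 0 < T) (M : ℝ) {u : ℝ → ℝ → ℝ}
    (hu : SmoothOn (Icc 0 T ×ˢ Ioo 0 1) u) (κ : ℕ) (t : ℝ) {x : ℝ} (hx : x ∈ Ioo (0 : ℝ) 1) :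
    (lap M)^[κ] (extension T χ u t) x = timeExt T χ (fun r => (lap M)^[κ] (u r) x) t := by
  obtain ⟨K, c, τ, hτ, h⟩ := timeExt_eq_sum hχ hT t
  have e : extension T χ u t = fun x => ∑ k ∈ Finset.range K, c k * u (τ k) x :=
    funext fun x => h _
  rw [e, h, lap_sum M isOpen_Ioo K c (fun k => hu.slice_snd (hτ k)) κ x hx]

theorem halfOn_mul {ζ : ℝ → ℝ} (hT : 0 < T) (hζ : ContDiff ℝ ∞ ζ)
    (h0 : ∀ t, 2 * T / 3 ≤ t → ζ t = 0) {w : ℝ → ℝ → ℝ} (hw : IsLocal T w) :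
    HalfOn (2 * T / 3) (fun t x => ζ t * w t x) where
  smooth := by
    rintro ⟨t, x⟩ ⟨ht, hx⟩
    have ht : 0 ≤ t := ht
    rcases lt_or_ge t T with h | h
    · have h1 : SmoothOn (Icc 0 T ×ˢ Ico 0 1) (fun t x => ζ t * w t x) :=
        (SmoothOn.of_fst hζ.contDiffOn fun p _ => mem_univ p.1).mul hw.1
      refine (h1 (t, x) ⟨⟨ht, h.le⟩, hx⟩).mono_of_mem_nhdsWithin ?_
      refine Filter.mem_of_superset (inter_mem_nhdsWithin _
        ((isOpen_Iio.prod isOpen_univ).mem_nhds (show (t, x) ∈ Iio T ×ˢ univ from ⟨h, mem_univ x⟩))) ?_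
      rintro ⟨r, y⟩ ⟨⟨hr, hy⟩, hr', -⟩
      exact ⟨⟨hr, (mem_Iio.1 hr').le⟩, hy⟩
    · have h2 : 2 * T / 3 < t := by linarith
      refine contDiffWithinAt_const (c := (0 : ℝ)) |>.congr_of_eventuallyEq ?_ ?_
      · filter_upwards [mem_nhdsWithin_of_mem_nhds ((isOpen_Ioi.prod isOpen_univ).mem_nhds
          (show (t, x) ∈ Ioi (2 * T / 3) ×ˢ univ from ⟨h2, mem_univ x⟩))] with p hp
        rw [h0 p.1 (mem_Ioi.1 hp.1).le, zero_mul]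
      · simp only [h0 t h2.le, zero_mul]
  zero_t t _ x _ h := by rw [h0 t h.le, zero_mul]
  zero_x t ht x hx h := by
    rcases le_or_gt t T with h' | h'
    · rw [hw.2 t ⟨ht, h'⟩ x hx h.le, mul_zero]
    · rw [h0 t (by linarith), zero_mul]

theorem isLocal_reflect {w : ℝ → ℝ → ℝ} (hw : IsLocal T w) : IsLocal T (fun t x => w (T - t) x) := by
  have hm : ∀ t ∈ Icc 0 T, T - t ∈ Icc 0 T := fun t ht => ⟨by linarith [ht.2], by linarith [ht.1]⟩
  refine ⟨?_, fun t ht x hx h => hw.2 _ (hm t ht) x hx h⟩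
  exact hw.1.comp (f := fun p : ℝ × ℝ => (T - p.1, p.2))
    ((contDiff_const.sub contDiff_fst).prodMk contDiff_snd).contDiffOn
    fun p hp => ⟨hm p.1 hp.1, hp.2⟩

/-- Each reflected half is supported within distance `2T/3` of its end, so the time support lies in
`[-2T/3, 5T/3]`, inside `]-2T, 2T[`. -/
theorem extension_smooth (hχ : IsCutoff χ) (hT : 0 < T) {u : ℝ → ℝ → ℝ} (hu : IsLocal T u) :
    SmoothOn (univ ×ˢ Ico 0 1) (extension T χ u) ∧ ∀ t, ∀ x ∈ Ico (0 : ℝ) 1,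
      (t ∉ Icc (-(2 * T / 3)) (5 * T / 3) ∨ 2 / 3 < x) → extension T χ u t x = 0 := by
  have h1 := halfOn_mul hT (timeCut_contDiff hχ T) (fun t ht => timeCut_eq_zero hχ hT ht) hu
  have h2 := halfOn_mul hT (ζ := fun t => 1 - timeCut T χ (T - t))
    (contDiff_const.sub ((timeCut_contDiff hχ T).comp (contDiff_const.sub contDiff_id)))
    (fun t ht => by rw [timeCut_eq_one hχ hT (by linarith)]; ring) (isLocal_reflect hu)
  have hc : (0 : ℝ) ≤ 2 * T / 3 := by linarith
  constructor
  · refine SmoothOn.add (h1.reflectExt_smooth hc 0) ?_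
    exact (h2.reflectExt_smooth hc 0).comp (f := fun p : ℝ × ℝ => (T - p.1, p.2))
      ((contDiff_const.sub contDiff_fst).prodMk contDiff_snd).contDiffOn
      fun p hp => ⟨mem_univ _, hp.2⟩
  · intro t x hx h
    have e1 := h1.reflectExt_zero (t := t) hx (h.imp_left fun h => by
      rw [mem_Icc, not_and_or, not_le, not_le] at h
      rcases h with h | h
      · rw [abs_of_neg (by linarith)]; linarith
      · rw [abs_of_pos (by linarith)]; linarith) 0
    have e2 := h2.reflectExt_zero (t := T - t) hx (h.imp_left fun h => by
      rw [mem_Icc, not_and_or, not_le, not_le] at h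
      rcases h with h | h
      · rw [abs_of_pos (by linarith)]; linarith
      · rw [abs_of_neg (by linarith)]; linarith) 0
    exact (congrArg₂ (· + ·) e1 e2).trans (add_zero 0)

theorem extension_isTest (hχ : IsCutoff χ) (hT : 0 < T) {u : ℝ → ℝ → ℝ} (hu : IsLocal T u) :
    IsTest T (extension T χ u) := by
  obtain ⟨h1, h2⟩ := extension_smooth hχ hT hu
  refine ⟨h1.mono (prod_mono_left (subset_univ _)), Icc (-(2 * T / 3)) (5 * T / 3) ×ˢ Icc 0 (2 / 3),
    isCompact_Icc.prod isCompact_Icc, prod_mono (fun t ht => ⟨by linarith [ht.1], by linarith [ht.2]⟩)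
      fun x hx => ⟨hx.1, by linarith [hx.2]⟩, ?_⟩
  rintro ⟨t, x⟩ ⟨-, hx⟩ hK
  refine h2 t x hx ?_
  by_contra hcon
  rw [not_or, not_not, not_lt] at hcon
  exact hK ⟨hcon.1, hx.1, hcon.2⟩

/-- The space operator commutes with the extension, so after exchanging the integrals this is
`timeExt_bound` at each `x`. -/
theorem sharpNorm_extension_le (hχ : IsCutoff χ) (hT : 0 < T) (M : ℝ) (ν : ℕ) :
    ∃ C : ℝ≥0, ∀ u, IsLocal T u →
      sharpNorm M T ν (extension T χ u) ≤ C * chartNorm M T ν u := by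
  choose C hC using timeExt_bound hχ hT
  refine ⟨NNReal.sqrt (∑ p ∈ orders ν, C p.1), fun u hu => ?_⟩
  refine rpow_half_orders_le (C := fun p => C p.1) fun p hp => ?_
  refine le_trans ?_ (mul_le_mul_right (sum_range_le_orders' hp fun p => ∫⁻ t in Ioo 0 T,
    l2Sq M (timeLap^[p.1] (fun r => (lap M)^[p.2] (u r)) t)) _)
  have hIoo : UniqueDiffOn ℝ (Ioo (0 : ℝ) 1) := isOpen_Ioo.uniqueDiffOn
  have hsE : SmoothOn (Ioo (-(2 * T)) (2 * T) ×ˢ Ioo 0 1)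
      (timeLap^[p.1] (fun r => (lap M)^[p.2] (extension T χ u r))) :=
    (((extension_smooth hχ hT hu).1.mono (prod_mono (subset_univ _) Ioo_subset_Ico_self)).lap_iterate
      M isOpen_Ioo.uniqueDiffOn isOpen_Ioo p.2).timeLap_iterate isOpen_Ioo hIoo p.1
  have hul : SmoothOn (Icc 0 T ×ˢ Ioo 0 1) u := SmoothOn.mono hu.1 (prod_mono_right Ioo_subset_Ico_self)
  have hl : SmoothOn (Ioo 0 T ×ˢ Ioo 0 1) (fun r => (lap M)^[p.2] (u r)) :=
    (hul.mono (prod_mono_left Ioo_subset_Icc_self)).lap_iterate M isOpen_Ioo.uniqueDiffOn isOpen_Ioo p.2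
  have hsu : ∀ j, SmoothOn (Ioo 0 T ×ˢ Ioo 0 1) (timeLap^[j] (fun r => (lap M)^[p.2] (u r))) :=
    fun j => hl.timeLap_iterate isOpen_Ioo hIoo j
  rw [lintegral_l2Sq M measurableSet_Ioo (ContDiffOn.continuousOn hsE)]
  simp only [lintegral_l2Sq M measurableSet_Ioo (ContDiffOn.continuousOn (hsu _))]
  rw [← lintegral_finsetSum' _ fun j _ =>
    aemeasurable_time M measurableSet_Ioo (ContDiffOn.continuousOn (hsu j)),
    ← lintegral_const_mul' _ _ (by simp)]
  refine setLIntegral_mono' measurableSet_Ioo fun x hx => ?_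
  rw [← Finset.sum_mul, ← mul_assoc]
  refine mul_le_mul_left ?_ _
  have e : (fun r => (lap M)^[p.2] (extension T χ u r) x) =
      timeExt T χ (fun r => (lap M)^[p.2] (u r) x) :=
    funext fun r => lap_extension hχ hT M hul p.2 r hx
  simp only [timeLap_iterate, e]
  exact hC p.1 _ (hl.slice_fst hx)

/-- One operator serves both ends, since it involves time alone. The upper norm bound combines
`sharpNorm_extension_le` with the chart comparison `chartNorm_le`; the reverse bound only restricts
the extension to `]0, T[`. -/
theorem exists_isExtension {N : ℝ} (hN : 5 ≤ N) (hχ : IsCutoff χ) (hT : 0 < T) (μ : Fin 2) :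
    IsExtension N T χ μ (extension T χ) where
  test u hu := extension_isTest hχ hT hu
  extends_ u _ t ht x _ := timeExt_of_mem T χ _ ht
  map_add u v _ _ := by
    funext t x
    obtain ⟨K, c, τ, -, h⟩ := timeExt_eq_sum hχ hT t
    simp only [extension, Pi.add_apply, h, mul_add, Finset.sum_add_distrib]
  map_smul c u _ := by
    funext t x
    obtain ⟨K, d, τ, -, h⟩ := timeExt_eq_sum hχ hT t
    simp only [extension, Pi.smul_apply, smul_eq_mul, h, Finset.mul_sum]
    exact Finset.sum_congr rfl fun k _ => by ring
  equiv ν := by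
    obtain ⟨C1, hC1⟩ := sharpNorm_extension_le hχ hT (param N μ) ν
    obtain ⟨C2, hC2⟩ := chartNorm_le hN T hχ μ ν
    obtain ⟨C3, hC3⟩ := norm2_chart_le hN T hχ μ ν
    refine ⟨C1 * C2 + C3, fun u hu => ?_⟩
    have hs : SmoothOn (Ioo 0 T ×ˢ Ioo 0 1) u :=
      SmoothOn.mono hu.1 (prod_mono Ioo_subset_Icc_self Ioo_subset_Ico_self)
    push_cast
    rw [add_mul, add_mul]
    constructor
    · refine le_trans ?_ le_self_add
      rw [mul_assoc]
      refine (hC1 u hu).trans (mul_le_mul_right (hC2 u hs fun t ht x hx h => ?_) _)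
      exact hu.2 t (Ioo_subset_Icc_self ht) x (Ioo_subset_Ico_self hx) h
    · refine le_trans ?_ le_add_self
      refine (hC3 u hs).trans (mul_le_mul_right ?_ _)
      refine ENNReal.rpow_le_rpow (Finset.sum_le_sum fun p _ => ?_) (by norm_num)
      refine le_trans (le_of_eq (setLIntegral_congr_fun measurableSet_Ioo fun t ht =>
        l2Sq_congr fun x hx => ?_)) (lintegral_mono_set (Ioo_subset_Ioo (by linarith) (by linarith)))
      refine timeLap_congr isOpen_Ioo (O := Ioo 0 1) (fun r hr y hy => ?_) p.1 t ht x hx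
      refine lap_congr isOpen_Ioo (fun y _ => ?_) p.2 y hy
      exact (timeExt_of_mem T χ (fun r => u r y) (Ioo_subset_Icc_self hr)).symm

end Extension

/-! ### The smoothing operators -/

theorem truncation_smooth {M : ℝ} (hM : 5 ≤ M) (T θ : ℝ) (U : ℝ → ℝ → ℝ) (s : Set (ℝ × ℝ)) :
    SmoothOn s (truncation M T θ U) :=
  comb_smooth hM T (indices θ) (coeff M T U) s

theorem chart_mem_Ioo (μ : Fin 2) {x : ℝ} (hx : x ∈ Ioo (0 : ℝ) 1) : chart μ x ∈ Ioo (0 : ℝ) 1 := by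
  fin_cases μ
  · simpa [chart] using hx
  · simpa [chart, and_comm] using hx

theorem chart_contDiff (μ : Fin 2) : ContDiff ℝ ∞ (chart μ) := by
  fin_cases μ
  · have h : chart 0 = id := by funext x; simp [chart]
    change ContDiff ℝ ∞ (chart 0)
    rw [h]
    exact contDiff_id
  · have h : chart 1 = fun x => 1 - x := by funext x; simp [chart]
    change ContDiff ℝ ∞ (chart 1)
    rw [h]
    exact contDiff_const.sub contDiff_id

theorem sum_weight (χ : ℝ → ℝ) (x : ℝ) : ∑ μ : Fin 2, weight χ μ x = 1 := by
  rw [Fin.sum_univ_two]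
  simp [weight]

theorem SmoothOn.comp_chart {I J J' : Set ℝ} {V : ℝ → ℝ → ℝ} (hV : SmoothOn (I ×ˢ J) V) (μ : Fin 2)
    (h : MapsTo (chart μ) J' J) : SmoothOn (I ×ˢ J') (fun t x => V t (chart μ x)) :=
  ContDiffOn.comp (g := fun p : ℝ × ℝ => V p.1 p.2) (f := fun p : ℝ × ℝ => (p.1, chart μ p.2)) hV
    (contDiff_fst.prodMk ((chart_contDiff μ).comp contDiff_snd)).contDiffOn
    fun _ hp => ⟨hp.1, h hp.2⟩

/-! ### Splitting by the partition of unity and recombining -/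

section Pieces

variable {N T : ℝ} {χ : ℝ → ℝ}

theorem SmoothOn.piece (hχ : IsCutoff χ) {I J J' : Set ℝ} {V : ℝ → ℝ → ℝ}
    (hV : SmoothOn (I ×ˢ J) V) (μ : Fin 2) (h : MapsTo (chart μ) J' J) :
    SmoothOn (I ×ˢ J') (fun t => piece χ μ (V t)) :=
  (SmoothOn.of_snd (hχ.cut_contDiff μ).contDiffOn fun p _ => mem_univ p.2).mul (hV.comp_chart μ h)

theorem isLocal_piece (hχ : IsCutoff χ) {u : ℝ → ℝ → ℝ} (hu : IsSmooth T u) (μ : Fin 2) :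
    IsLocal T (fun t => piece χ μ (u t)) := by
  refine ⟨SmoothOn.piece hχ hu μ fun x hx => ?_, fun t _ x _ h => ?_⟩
  · fin_cases μ
    · simpa [chart] using ⟨hx.1, hx.2.le⟩
    · simpa [chart] using ⟨hx.2.le, hx.1⟩
  · have : cut χ μ x = 0 := hχ.cut_eq_zero μ h
    change cut χ μ x * u t (chart μ x) = 0
    rw [this, zero_mul]

theorem piece_timeLap (μ : Fin 2) (u : ℝ → ℝ → ℝ) (ι : ℕ) (t : ℝ) :
    timeLap^[ι] (fun t => piece χ μ (u t)) t = piece χ μ (timeLap^[ι] u t) := by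
  induction ι generalizing u with
  | zero => rfl
  | succ ι ih =>
    rw [Function.iterate_succ_apply, Function.iterate_succ_apply, ← ih]
    refine congrFun (congrArg _ ?_) t
    funext r s
    have h1 : deriv (fun r => weight χ μ (chart μ s) * u r (chart μ s)) =
        fun r => weight χ μ (chart μ s) * deriv (fun r => u r (chart μ s)) r := by
      funext r
      exact deriv_const_mul_field _
    simp only [timeLap, piece]
    rw [h1, deriv_const_mul_field]
    ring

theorem chartNorm_piece_le (hχ : IsCutoff χ) {u : ℝ → ℝ → ℝ} (hu : SmoothOn (Ioo 0 T ×ˢ Ioo 0 1) u)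
    (μ : Fin 2) (ν : ℕ) :
    chartNorm (param N μ) T ν (fun t => piece χ μ (u t)) ≤ norm2 N T χ ν u := by
  refine ENNReal.rpow_le_rpow (Finset.sum_le_sum fun p _ => ?_) (by norm_num)
  refine setLIntegral_mono' measurableSet_Ioo fun t ht => ?_
  have hs := SmoothOn.piece hχ hu μ fun x hx => chart_mem_Ioo μ hx
  rw [l2Sq_congr (timeLap_lap_iterate (param N μ) isOpen_Ioo isOpen_Ioo hs p.1 p.2 t ht),
    piece_timeLap]
  refine le_trans (Finset.single_le_sum (f := fun m => l2Sq (param N μ)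
    ((lap (param N μ))^[m] (piece χ μ (timeLap^[p.1] u t)))) (fun _ _ => zero_le)
    (Finset.self_mem_range_succ p.2)) ?_
  exact Finset.single_le_sum (f := fun μ => ∑ m ∈ Finset.range (p.2 + 1), l2Sq (param N μ)
    ((lap (param N μ))^[m] (piece χ μ (timeLap^[p.1] u t)))) (fun _ _ => zero_le) (Finset.mem_univ μ)

theorem starNormSq_congr {f g : ℝ → ℝ} (h : ∀ x ∈ Ioo (0 : ℝ) 1, f x = g x) (κ : ℕ) :
    starNormSq N χ κ f = starNormSq N χ κ g := by
  refine Finset.sum_congr rfl fun μ _ => Finset.sum_congr rfl fun m _ => l2Sq_congr ?_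
  refine lap_congr isOpen_Ioo (fun s hs => ?_) m
  rw [piece, piece, h _ (chart_mem_Ioo μ hs)]

theorem norm2_congr {u v : ℝ → ℝ → ℝ} (h : ∀ t ∈ Ioo 0 T, ∀ x ∈ Ioo (0 : ℝ) 1, u t x = v t x)
    (ν : ℕ) : norm2 N T χ ν u = norm2 N T χ ν v := by
  unfold norm2
  congr 1
  refine Finset.sum_congr rfl fun p _ => setLIntegral_congr_fun measurableSet_Ioo fun t ht => ?_
  exact starNormSq_congr (timeLap_congr isOpen_Ioo h p.1 t ht) p.2

theorem starNormSq_add_le (hχ : IsCutoff χ) {f g : ℝ → ℝ} (hf : ContDiffOn ℝ ∞ f (Ioo 0 1))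
    (hg : ContDiffOn ℝ ∞ g (Ioo 0 1)) (κ : ℕ) : starNormSq N χ κ (fun x => f x + g x) ≤
      2 * starNormSq N χ κ f + 2 * starNormSq N χ κ g := by
  have hp : ∀ {f : ℝ → ℝ}, ContDiffOn ℝ ∞ f (Ioo 0 1) → ∀ μ, ContDiffOn ℝ ∞ (piece χ μ f) (Ioo 0 1) :=
    fun hf μ => (hχ.cut_contDiff μ).contDiffOn.mul
      (hf.comp (chart_contDiff μ).contDiffOn fun x hx => chart_mem_Ioo μ hx)
  unfold starNormSq
  simp only [Finset.mul_sum, ← Finset.sum_add_distrib]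
  refine Finset.sum_le_sum fun μ _ => Finset.sum_le_sum fun m _ => ?_
  refine le_trans (le_of_eq (l2Sq_congr fun x hx => ?_))
    (l2Sq_add_le (smooth_lap_iterate (param N μ) isOpen_Ioo (hp hf μ) m).continuousOn)
  have e : piece χ μ (fun x => f x + g x) = fun x => piece χ μ f x + piece χ μ g x := by
    funext s
    simp only [piece, mul_add]
  rw [e]
  exact dop_add isOpen_Ioo contDiffOn_id contDiffOn_const (hp hf μ) (hp hg μ) m x hx

theorem aemeasurable_starNormSq (hχ : IsCutoff χ) {u : ℝ → ℝ → ℝ}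
    (hu : SmoothOn (Ioo 0 T ×ˢ Ioo 0 1) u) (κ : ℕ) :
    AEMeasurable (fun t => starNormSq N χ κ (u t)) (volume.restrict (Ioo 0 T)) := by
  unfold starNormSq
  refine Finset.aemeasurable_fun_sum _ fun μ _ => Finset.aemeasurable_fun_sum _ fun m _ => ?_
  have hs := SmoothOn.piece hχ hu μ fun x hx => chart_mem_Ioo μ hx
  exact aemeasurable_l2Sq _ measurableSet_Ioo (ContDiffOn.continuousOn
    (hs.lap_iterate (param N μ) isOpen_Ioo.uniqueDiffOn isOpen_Ioo m))

/-- A triangle inequality up to the factor 2 is enough, because constants are immaterial. -/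
theorem norm2_add_le (hχ : IsCutoff χ) {u v : ℝ → ℝ → ℝ} (hu : SmoothOn (Ioo 0 T ×ˢ Ioo 0 1) u)
    (hv : SmoothOn (Ioo 0 T ×ˢ Ioo 0 1) v) (ν : ℕ) :
    norm2 N T χ ν (fun t x => u t x + v t x) ≤ 2 * (norm2 N T χ ν u + norm2 N T χ ν v) := by
  have hI : UniqueDiffOn ℝ (Ioo (0 : ℝ) 1) := isOpen_Ioo.uniqueDiffOn
  have h1 : ∀ p ∈ orders ν,
      ∫⁻ t in Ioo 0 T, starNormSq N χ p.2 (timeLap^[p.1] (fun t x => u t x + v t x) t) ≤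
      2 * (∫⁻ t in Ioo 0 T, starNormSq N χ p.2 (timeLap^[p.1] u t)) +
        2 * ∫⁻ t in Ioo 0 T, starNormSq N χ p.2 (timeLap^[p.1] v t) := by
    intro p _
    have hu' := hu.timeLap_iterate isOpen_Ioo hI p.1
    have hv' := hv.timeLap_iterate isOpen_Ioo hI p.1
    rw [← lintegral_const_mul' _ _ (by simp), ← lintegral_const_mul' _ _ (by simp),
      ← lintegral_add_left' ((aemeasurable_starNormSq hχ hu' p.2).const_mul 2)]
    refine setLIntegral_mono' measurableSet_Ioo fun t ht => ?_
    refine le_trans (le_of_eq (starNormSq_congr (fun x hx => ?_) p.2))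
      (starNormSq_add_le hχ (hu'.slice_snd ht) (hv'.slice_snd ht) p.2)
    simp only [timeLap_iterate]
    exact dop_add isOpen_Ioo contDiffOn_const contDiffOn_const (hu.slice_fst hx) (hv.slice_fst hx)
      p.1 t ht
  have h2 := Finset.sum_le_sum h1
  rw [Finset.sum_add_distrib, ← Finset.mul_sum, ← Finset.mul_sum] at h2
  have h3 : (2 : ℝ≥0∞) ^ (1 / 2 : ℝ) ≤ 2 := by
    conv_rhs => rw [← ENNReal.rpow_one 2]
    exact ENNReal.rpow_le_rpow_of_exponent_le (by norm_num) (by norm_num)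
  refine (ENNReal.rpow_le_rpow h2 (by norm_num)).trans
    ((ENNReal.rpow_add_le_add_rpow _ _ (by norm_num) (by norm_num)).trans ?_)
  rw [ENNReal.mul_rpow_of_nonneg _ _ (by norm_num), ENNReal.mul_rpow_of_nonneg _ _ (by norm_num),
    ← mul_add]
  exact mul_le_mul_left h3 _

theorem chartNorm_le_sharpNorm (hT : 0 < T) (M : ℝ) (ν : ℕ) (V : ℝ → ℝ → ℝ) :
    chartNorm M T ν V ≤ sharpNorm M T ν V :=
  ENNReal.rpow_le_rpow (Finset.sum_le_sum fun _ _ =>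
    lintegral_mono_set (Ioo_subset_Ioo (by linarith) (by linarith))) (by norm_num)

theorem norm2_sum_chart_le (hN : 5 ≤ N) (hT : 0 < T) (hχ : IsCutoff χ) (ν : ℕ) :
    ∃ C : ℝ≥0, ∀ (V : Fin 2 → ℝ → ℝ → ℝ) (u : ℝ → ℝ → ℝ),
      (∀ μ, SmoothOn (Ioo 0 T ×ˢ Ioo 0 1) (V μ)) →
      (∀ t ∈ Ioo 0 T, ∀ x ∈ Ioo (0 : ℝ) 1, u t x = ∑ μ, V μ t (chart μ x)) →
      norm2 N T χ ν u ≤ C * ∑ μ, sharpNorm (param N μ) T ν (V μ) := by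
  choose C hC using fun μ => norm2_chart_le hN T hχ μ ν
  refine ⟨2 * (C 0 + C 1), fun V u hV hu => ?_⟩
  have hs : ∀ μ, SmoothOn (Ioo 0 T ×ˢ Ioo 0 1) (fun t x => V μ t (chart μ x)) := fun μ =>
    (hV μ).comp_chart μ fun x hx => chart_mem_Ioo μ hx
  rw [norm2_congr (v := fun t x => V 0 t (chart 0 x) + V 1 t (chart 1 x)) (fun t ht x hx => by
    rw [hu t ht x hx, Fin.sum_univ_two]) ν]
  refine (norm2_add_le hχ (hs 0) (hs 1) ν).trans ?_
  have hb : ∀ μ, norm2 N T χ ν (fun t x => V μ t (chart μ x)) ≤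
      C μ * sharpNorm (param N μ) T ν (V μ) := fun μ =>
    (hC μ (V μ) (hV μ)).trans (mul_le_mul_right (chartNorm_le_sharpNorm hT _ _ _) _)
  push_cast
  rw [Fin.sum_univ_two, mul_assoc]
  refine mul_le_mul_right ((add_le_add (hb 0) (hb 1)).trans ?_) _
  rw [add_mul]
  exact add_le_add (mul_le_mul_right le_self_add _) (mul_le_mul_right le_add_self _)

/-- The extension and chart bounds lead back to the chart norm of the piece, which is contained in
`norm2` of `u` by definition. -/
theorem sharpNorm_piece_le (hN : 5 ≤ N) (hχ : IsCutoff χ)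
    {E : Fin 2 → (ℝ → ℝ → ℝ) → (ℝ → ℝ → ℝ)} (hE : ∀ μ, IsExtension N T χ μ (E μ)) (ν : ℕ) :
    ∃ C : ℝ≥0, ∀ u, IsSmooth T u → ∀ μ,
      sharpNorm (param N μ) T ν (E μ fun t => piece χ μ (u t)) ≤ C * norm2 N T χ ν u := by
  choose C1 hC1 using fun μ => (hE μ).equiv ν
  choose C2 hC2 using fun μ => norm2_chart_le hN T hχ μ ν
  refine ⟨∑ μ, C1 μ * C2 μ, fun u hu μ => ?_⟩
  have hl := isLocal_piece hχ hu μ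
  have hs : SmoothOn (Ioo 0 T ×ˢ Ioo 0 1) u :=
    SmoothOn.mono hu (prod_mono Ioo_subset_Icc_self Ioo_subset_Icc_self)
  have hp : SmoothOn (Ioo 0 T ×ˢ Ioo 0 1) (fun t => piece χ μ (u t)) :=
    SmoothOn.piece hχ hs μ fun x hx => chart_mem_Ioo μ hx
  have h1 := (hC2 μ _ hp).trans
    (mul_le_mul_right (chartNorm_piece_le (N := N) hχ hs μ ν) _)
  refine ((hC1 μ _ hl).1.trans (mul_le_mul_right h1 _)).trans ?_
  rw [← mul_assoc, ← ENNReal.coe_mul]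
  refine mul_le_mul_left (ENNReal.coe_le_coe.2 ?_) _
  exact Finset.single_le_sum (f := fun μ => C1 μ * C2 μ) (fun _ _ => zero_le) (Finset.mem_univ μ)

/-- The truncation estimates are applied to the extended pieces: `sharpNorm_piece_le` bounds what
enters them and `norm2_sum_chart_le` what leaves them. -/
theorem smoothing_estimates (hN : 5 ≤ N) (hT : 0 < T) (hχ : IsCutoff χ)
    {E : Fin 2 → (ℝ → ℝ → ℝ) → (ℝ → ℝ → ℝ)} (hE : ∀ μ, IsExtension N T χ μ (E μ)) {ν ν' : ℕ}
    (hν : ν ≤ ν') : ∃ C : ℝ≥0, ∀ θ : ℝ≥0, ∀ u, IsSmooth T u →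
      norm2 N T χ ν' (smoothing N T χ E θ u)
        ≤ C * (θ : ℝ≥0∞) ^ ((ν' : ℤ) - (ν : ℤ)) * norm2 N T χ ν u ∧
      norm2 N T χ ν (u - smoothing N T χ E θ u)
        ≤ C * (θ : ℝ≥0∞) ^ ((ν : ℤ) - (ν' : ℤ)) * norm2 N T χ ν' u := by
  choose C1 hC1 using fun μ => truncation_estimates hT (five_le_param hN μ) hν
  obtain ⟨A, hA⟩ := norm2_sum_chart_le hN hT hχ ν
  obtain ⟨A', hA'⟩ := norm2_sum_chart_le hN hT hχ ν'
  obtain ⟨B, hB⟩ := sharpNorm_piece_le hN hχ hE ν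
  obtain ⟨B', hB'⟩ := sharpNorm_piece_le hN hχ hE ν'
  refine ⟨A' * (∑ μ, C1 μ) * B + A * (∑ μ, C1 μ) * B', fun θ u hu => ?_⟩
  have hl := fun μ => isLocal_piece hχ hu μ
  have ht := fun μ => (hE μ).test _ (hl μ)
  have htr : ∀ μ, SmoothOn (Ioo 0 T ×ˢ Ioo 0 1)
      (truncation (param N μ) T θ (E μ fun t => piece χ μ (u t))) := fun μ =>
    truncation_smooth (five_le_param hN μ) _ _ _ _
  have hsm : ∀ μ, SmoothOn (Ioo 0 T ×ˢ Ioo 0 1) (E μ fun t => piece χ μ (u t)) := fun μ =>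
    SmoothOn.mono (ht μ).1 (prod_mono (Ioo_subset_Ioo (by linarith) (by linarith))
      Ioo_subset_Ico_self)
  have combine : ∀ (A B : ℝ≥0) (k : ℤ) (X : ℝ≥0∞) (Y Z : Fin 2 → ℝ≥0∞),
      (∀ μ, Y μ ≤ C1 μ * (θ : ℝ≥0∞) ^ k * Z μ) → (∀ μ, Z μ ≤ B * X) →
      A * ∑ μ, Y μ ≤ (A * (∑ μ, C1 μ) * B : ℝ≥0) * (θ : ℝ≥0∞) ^ k * X := by
    intro A B k X Y Z h1 h2
    calc (A : ℝ≥0∞) * ∑ μ, Y μ ≤ A * ∑ μ, C1 μ * (θ : ℝ≥0∞) ^ k * (B * X) :=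
          mul_le_mul_right (Finset.sum_le_sum fun μ _ =>
            (h1 μ).trans (mul_le_mul_right (h2 μ) _)) _
      _ = _ := by
        push_cast
        rw [← Finset.sum_mul, ← Finset.sum_mul]
        ring
  constructor
  · refine ((hA' _ _ htr fun t _ x _ => rfl).trans
      (combine A' B _ _ _ _ (fun μ => (hC1 μ θ _ (ht μ)).1) (hB u hu))).trans ?_
    exact mul_le_mul_left (mul_le_mul_left (ENNReal.coe_le_coe.2 le_self_add) _) _
  · refine ((hA _ _ (fun μ => (hsm μ).sub (htr μ)) fun t ht x hx => ?_).trans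
      (combine A B' _ _ _ _ (fun μ => (hC1 μ θ _ (ht μ)).2) (hB' u hu))).trans ?_
    -- On `[0,T]` the extension equals the piece, and the weights add up to 1, so `u - S u` is the
    -- sum of the two truncation errors.
    · have e : ∀ μ, E μ (fun t => piece χ μ (u t)) t (chart μ x) = weight χ μ x * u t x := fun μ => by
        rw [(hE μ).extends_ _ (hl μ) t (Ioo_subset_Icc_self ht) _
          (Ioo_subset_Ico_self (chart_mem_Ioo μ hx)), piece, chart_chart]
      rw [Finset.sum_sub_distrib, Finset.sum_congr rfl fun μ _ => e μ, ← Finset.sum_mul,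
        sum_weight, one_mul]
      rfl
    · exact mul_le_mul_left (mul_le_mul_left (ENNReal.coe_le_coe.2 le_add_self) _) _

theorem vecNorm2_le {K : ℝ≥0∞} {ν ν' : ℕ} {w w' : (ℝ → ℝ → ℝ) × (ℝ → ℝ → ℝ)}
    (h1 : norm2 N T χ ν w.1 ≤ K * norm2 N T χ ν' w'.1)
    (h2 : norm2 N T χ ν w.2 ≤ K * norm2 N T χ ν' w'.2) :
    vecNorm2 N T χ ν w ≤ K * vecNorm2 N T χ ν' w' := by
  have h : norm2 N T χ ν w.1 ^ 2 + norm2 N T χ ν w.2 ^ 2 ≤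
      K ^ 2 * (norm2 N T χ ν' w'.1 ^ 2 + norm2 N T χ ν' w'.2 ^ 2) := by
    rw [mul_add, ← mul_pow, ← mul_pow]
    exact add_le_add (pow_le_pow_left₀ zero_le h1 2) (pow_le_pow_left₀ zero_le h2 2)
  refine (ENNReal.rpow_le_rpow h (by norm_num)).trans_eq ?_
  rw [ENNReal.mul_rpow_of_nonneg _ _ (by norm_num), ← ENNReal.rpow_natCast, ← ENNReal.rpow_mul]
  norm_num
  rfl

end Pieces

end Smoothing

theorem proposition2 (N T : ℝ) (hN : 5 ≤ N) (hT : 0 < T) (χ : ℝ → ℝ)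
    (hχ : Smoothing.IsCutoff χ) :
    -- the estimates for the truncated expansions, at both ends
    (∀ μ : Fin 2, ∀ ν ν' : ℕ, ν ≤ ν' → ∃ C : ℝ≥0, ∀ θ : ℝ≥0, ∀ U : ℝ → ℝ → ℝ,
      Smoothing.IsTest T U →
        Smoothing.sharpNorm (Smoothing.param N μ) T ν'
            (Smoothing.truncation (Smoothing.param N μ) T θ U)
          ≤ C * (θ : ℝ≥0∞) ^ ((ν' : ℤ) - (ν : ℤ)) *
            Smoothing.sharpNorm (Smoothing.param N μ) T ν U ∧
        Smoothing.sharpNorm (Smoothing.param N μ) T ν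
            (U - Smoothing.truncation (Smoothing.param N μ) T θ U)
          ≤ C * (θ : ℝ≥0∞) ^ ((ν : ℤ) - (ν' : ℤ)) *
            Smoothing.sharpNorm (Smoothing.param N μ) T ν' U) ∧
    -- extensions as used in the construction exist
    (∀ μ : Fin 2, ∃ E : (ℝ → ℝ → ℝ) → (ℝ → ℝ → ℝ), Smoothing.IsExtension N T χ μ E) ∧
    -- the estimates for the smoothing operators, whichever extensions are fixed
    (∀ E : Fin 2 → (ℝ → ℝ → ℝ) → (ℝ → ℝ → ℝ),
      (∀ μ : Fin 2, Smoothing.IsExtension N T χ μ (E μ)) →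
      ∀ ν ν' : ℕ, ν ≤ ν' → ∃ C : ℝ≥0, ∀ θ : ℝ≥0, ∀ w : (ℝ → ℝ → ℝ) × (ℝ → ℝ → ℝ),
        Smoothing.IsSmooth T w.1 → Smoothing.IsSmooth T w.2 →
          Smoothing.vecNorm2 N T χ ν' (Smoothing.vecSmoothing N T χ E θ w)
            ≤ C * (θ : ℝ≥0∞) ^ ((ν' : ℤ) - (ν : ℤ)) * Smoothing.vecNorm2 N T χ ν w ∧
          Smoothing.vecNorm2 N T χ ν (w - Smoothing.vecSmoothing N T χ E θ w)
            ≤ C * (θ : ℝ≥0∞) ^ ((ν : ℤ) - (ν' : ℤ)) * Smoothing.vecNorm2 N T χ ν' w) := by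
  refine ⟨fun μ ν ν' hν =>
      Smoothing.truncation_estimates hT (Smoothing.five_le_param hN μ) hν,
    fun μ => ⟨_, Smoothing.exists_isExtension hN hχ hT μ⟩, fun E hE ν ν' hν => ?_⟩
  obtain ⟨C, hC⟩ := Smoothing.smoothing_estimates hN hT hχ hE hν
  exact ⟨C, fun θ w h1 h2 =>
    ⟨Smoothing.vecNorm2_le (hC θ w.1 h1).1 (hC θ w.2 h2).1,
      Smoothing.vecNorm2_le (hC θ w.1 h1).2 (hC θ w.2 h2).2⟩⟩
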